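/- Let $s>5/2$, $S^1=\mathbb R/\mathbb Z$ and $S^1_{4\pi}=\mathbb R/4\pi\mathbb Z$. Let $H^s_0=\{u\in H^s(S^1;\mathbb R): u(0)=0\}$ and $\mathrm{Diff}^s_0(S^1)=\{\mathrm{id}+h : h\in H^s_0,\ h_x>-1\}$. Let $H^{s-1}(S^1;S^1_{4\pi})/S^1_{4\pi}$ be the set of $H^{s-1}$ maps $\alpha:S^1\to S^1_{4\pi}$ modulo constant phases, with classes $[\alpha]$. Every such $\alpha$ has the form $\alpha(x)=4\pi nx+k(x) \bmod 4\pi$ with winding number $n\in\mathbb Z$ and $k\in H^{s-1}(S^1;\mathbb R)$. Let $$K^s=\mathrm{Diff}_0^s(S^1)\ltimes\bigl(H^{s-1}(S^1;S^1_{4\pi})/S^1_{4\pi}\bigr),\qquad (\varphi,[\alpha])(\psi,[\beta])=(\varphi\circ\psi,[\beta+\alpha\circ\psi]),$$ with the atlas of charts $(\mathrm{id}+h,[4\pi nx+k])\mapsto(h,[k])$, $n\in\mathbb Z$, with values in $E=H_0^s\times(H^{s-1}(S^1;\mathbb R)/\mathbb R)$. Through these charts each tangent space of $K^s$ is identified with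 $E$, and its elements are written $U=(U_1,[U_2])$. Put $\pi(\rho)=\rho-\int_{S^1}\rho\,dx$ and let $A^{-1}$ be the inverse of $A=-\partial_x^2$, $$(A^{-1}f)(x)=-\int_0^x\!\int_0^y f\,dz\,dy+x\int_{S^1}\int_0^y f\,dz\,dy \qquad\text{for } \int_{S^1} f\,dx=0 .$$ Define at the identity $$g_{(\mathrm{id},[0])}(u,v)=\tfrac14\int_{S^1}\bigl(u_{1x}v_{1x}+\pi(u_2)\pi(v_2)\bigr)dx,\qquad \Gamma_{(\mathrm{id},[0])}(u,v)=-\tfrac12\begin{pmatrix}A^{-1}\partial_x\bigl(u_{1x}v_{1x}+\pi(u_2)\pi(v_2)\bigr)\\ [u_{1x}\pi(v_2)+v_{1x}\pi(u_2)]\end{pmatrix},$$ and extend by right invariance, $g_{(\varphi,[\alpha])}(u\circ\varphi,v\circ\varphi)=g_{(\mathrm{id},[0])}(u,v)$ and $\Gamma_{(\varphi,[\alpha])}(u\circ\varphi,v\circ\varphi)=\Gamma_{(\mathrm{id},[0])}(u,v)\circ\varphi$. Let $\nabla_XY=DY\cdot X-\Gamma(Y,X)$ and, at $(\varphi,[\alpha])$,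 $$J(U_1,[U_2])=\Bigl(-\int_0^x\Bigl(U_2-\int_{S^1}U_2\varphi_x\,dz\Bigr)\varphi_x\,dy,\ \Bigl[\frac{U_{1x}}{\varphi_x}\Bigr]\Bigr),\qquad \omega(U,V)=\tfrac14\int_{S^1}(U_{2x}V_1-V_{2x}U_1)\,dx .$$ Then $E$ is a Banach space, $K^s$ is a smooth Banach manifold, the objects $g,\Gamma,\nabla,\omega,J$ are well defined on it (by bounded multilinear maps at each point), $g$ is right-invariant, and $K^s$ with these objects is a (weak) Kähler manifold, in the following sense. (a) $g$ is a smooth symmetric positive definite (weak Riemannian) metric. The map $\Gamma$ is smooth and symmetric, and $\nabla$ is a smooth torsion-free connection compatible with $g$: $X\,g(Y,Z)=g(\nabla_XY,Z)+g(Y,\nabla_XZ)$. (b) $\omega$ is a smooth, (weakly) nondegenerate, closed two-form with $\nabla\omega=0$. (c) $J$ is a smooth $(1,1)$-tensor with $J^2=-I$ and $\nabla J=0$. (d) $\omega(U,V)=g(JU,V)$. (e) $g(U,V)=g(JU,JV)$. (f) The Nijenhuis tensor $N^J(X,Y)=[X,Y]+J[JX,Y]+J[X,JY]-[JX,JY]$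 vanishes for all smooth vector fields $X,Y$. -/

import Mathlib

open Bundle
open scoped Manifold ContDiff Topology

noncomputable section

namespace HunterSaxton

/-- The sequence `(1 + n²)^{r/2} f̂(n)`, `n ∈ ℤ`, for a continuous function `f` on the circle of
length one. -/
def weightedCoeff (r : ℝ) (f : C(UnitAddCircle, ℝ)) (n : ℤ) : ℂ :=
  ((1 + (n : ℝ) ^ 2) ^ (r / 2) : ℝ) • fourierCoeff (fun x : UnitAddCircle => (f x : ℂ)) n

theorem integrable_ofReal (f : C(UnitAddCircle, ℝ)) :
    MeasureTheory.Integrable (fun x : UnitAddCircle => (f x : ℂ)) AddCircle.haarAddCircle :=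
  (Complex.continuous_ofReal.comp f.continuous).integrable_of_hasCompactSupport
    (HasCompactSupport.of_compactSpace _)

theorem weightedCoeff_add (r : ℝ) (f g : C(UnitAddCircle, ℝ)) :
    weightedCoeff r (f + g) = weightedCoeff r f + weightedCoeff r g := by
  funext n
  have h := congrFun (fourierCoeff.add (integrable_ofReal f) (integrable_ofReal g)) n
  have e : (fun x : UnitAddCircle => (((f + g) x : ℝ) : ℂ)) =
      (fun x => (f x : ℂ)) + fun x => (g x : ℂ) := by
    funext x; simp
  simp only [weightedCoeff, e, h, Pi.add_apply, smul_add]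

theorem weightedCoeff_smul (r c : ℝ) (f : C(UnitAddCircle, ℝ)) :
    weightedCoeff r (c • f) = c • weightedCoeff r f := by
  funext n
  have e : (fun x : UnitAddCircle => (((c • f) x : ℝ) : ℂ)) =
      (c : ℂ) • (fun x : UnitAddCircle => (f x : ℂ)) := by
    funext x; simp
  simp only [weightedCoeff, e, fourierCoeff.const_smul, Pi.smul_apply]
  rw [smul_comm]
  simp

theorem eq_zero_of_weightedCoeff (r : ℝ) (f : C(UnitAddCircle, ℝ)) (h : weightedCoeff r f = 0) :
    f = 0 := by
  let F : C(UnitAddCircle, ℂ) := ⟨fun x => (f x : ℂ), Complex.continuous_ofReal.comp f.continuous⟩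
  have h0 : fourierCoeff F = 0 := by
    funext n
    have := congrFun h n
    simp only [weightedCoeff, Pi.zero_apply, smul_eq_zero] at this
    refine this.resolve_left (ne_of_gt ?_)
    positivity
  have hs : Summable (fourierCoeff F) := by rw [h0]; exact summable_zero
  ext x
  have := has_pointwise_sum_fourier_series_of_summable hs x
  rw [h0] at this
  simp only [Pi.zero_apply, zero_smul] at this
  have := this.unique hasSum_zero
  have h2 : ((f x : ℝ) : ℂ) = 0 := this
  simpa using h2

/-- Membership in `H^r(S¹; ℝ)`, for a continuous function: `∑ (1 + n²)^r |f̂(n)|² < ∞`. -/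
def sobolevSubmodule (r : ℝ) : Submodule ℝ C(UnitAddCircle, ℝ) where
  carrier := {f | Memℓp (weightedCoeff r f) 2}
  add_mem' {f g} hf hg := by
    simp only [Set.mem_ofPred_eq, weightedCoeff_add] at *
    exact hf.add hg
  zero_mem' := by
    have : weightedCoeff r 0 = 0 := by simpa using weightedCoeff_smul r 0 0
    simp only [Set.mem_ofPred_eq, this]
    exact zero_memℓp
  smul_mem' c f hf := by
    simp only [Set.mem_ofPred_eq, weightedCoeff_smul] at *
    exact hf.const_smul c

/-- The Sobolev space `H^r(S¹; ℝ)` of the circle `S¹ = ℝ/ℤ`, for `r > 1/2`; each class is given by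
its continuous representative. -/
def Sobolev (r : ℝ) : Type := sobolevSubmodule r

namespace Sobolev

variable {r : ℝ}

instance : AddCommGroup (Sobolev r) := inferInstanceAs (AddCommGroup (sobolevSubmodule r))
instance : Module ℝ (Sobolev r) := inferInstanceAs (Module ℝ (sobolevSubmodule r))

/-- The continuous function on the circle underlying an element of `H^r(S¹; ℝ)`. -/
def toMap : Sobolev r →ₗ[ℝ] C(UnitAddCircle, ℝ) := (sobolevSubmodule r).subtype

theorem toMap_injective : Function.Injective (toMap (r := r)) := Subtype.val_injective

/-- `f ↦ ((1 + n²)^{r/2} f̂(n))_n`, as a map into `ℓ²(ℤ; ℂ)`. -/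
def toSeq : Sobolev r →ₗ[ℝ] lp (fun _ : ℤ => ℂ) 2 where
  toFun f := ⟨weightedCoeff r (toMap f), f.2⟩
  map_add' f g := Subtype.ext (weightedCoeff_add r (toMap f) (toMap g))
  map_smul' c f := Subtype.ext (weightedCoeff_smul r c (toMap f))

theorem toSeq_injective : Function.Injective (toSeq (r := r)) := by
  rw [injective_iff_map_eq_zero]
  intro f hf
  apply toMap_injective
  rw [map_zero]
  exact eq_zero_of_weightedCoeff r _ (congrArg Subtype.val hf)

/-- The norm of `H^r(S¹; ℝ)`: `‖f‖² = ∑ (1 + n²)^r |f̂(n)|²`. -/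
instance : NormedAddCommGroup (Sobolev r) :=
  NormedAddCommGroup.induced (Sobolev r) (lp (fun _ : ℤ => ℂ) 2) toSeq toSeq_injective

instance : NormedSpace ℝ (Sobolev r) :=
  NormedSpace.induced ℝ (Sobolev r) (lp (fun _ : ℤ => ℂ) 2) toSeq

theorem norm_sq (f : Sobolev r) : ‖f‖ ^ 2 = ∑' n : ℤ, (1 + (n : ℝ) ^ 2) ^ r *
    ‖fourierCoeff (fun x : UnitAddCircle => (toMap f x : ℂ)) n‖ ^ 2 := by
  have h := lp.norm_rpow_eq_tsum (p := 2) (by norm_num) (toSeq f)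
  simp only [ENNReal.toReal_ofNat, Real.rpow_ofNat] at h
  change ‖toSeq f‖ ^ 2 = _
  rw [h]
  refine tsum_congr fun n => ?_
  have hp : (0 : ℝ) ≤ 1 + (n : ℝ) ^ 2 := by positivity
  change ‖weightedCoeff r (toMap f) n‖ ^ 2 = _
  rw [weightedCoeff, norm_smul, mul_pow, Real.norm_of_nonneg (Real.rpow_nonneg hp _),
    ← Real.rpow_natCast, ← Real.rpow_mul hp]
  norm_num

/-- The associated `1`-periodic function on the line. -/
def fn (f : Sobolev r) (x : ℝ) : ℝ := toMap f (x : UnitAddCircle)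

theorem summable_deriv (hr : 3 / 2 < r) : ∃ C : ℝ, 0 < C ∧ ∀ f : Sobolev r,
    Summable (fun n : ℤ => 2 * Real.pi * |(n : ℝ)| *
      ‖fourierCoeff (fun x : UnitAddCircle => (toMap f x : ℂ)) n‖) ∧
    ∑' n : ℤ, 2 * Real.pi * |(n : ℝ)| *
      ‖fourierCoeff (fun x : UnitAddCircle => (toMap f x : ℂ)) n‖ ≤ C * ‖f‖ := by
  let w : ℤ → ℝ := fun n => 2 * Real.pi * |(n : ℝ)| * (1 + (n : ℝ) ^ 2) ^ (-(r / 2))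
  have hw0 : ∀ n, 0 ≤ w n := fun n => by positivity
  have hw : Summable fun n => w n ^ (2 : ℝ) := by
    have h1 : Summable fun n : ℤ => (2 * Real.pi) ^ 2 * |(n : ℝ)| ^ (-(2 * r - 2)) :=
      (Real.summable_abs_int_rpow (b := 2 * r - 2) (by linarith)).mul_left _
    refine Summable.of_nonneg_of_le (fun n => by positivity) (fun n => ?_) h1
    by_cases hn : n = 0
    · subst hn
      have : w 0 = 0 := by simp [w]
      rw [this, Real.zero_rpow (by norm_num)]
      positivity
    · have hn' : 0 < |(n : ℝ)| := by positivity
      have hp : (0 : ℝ) < 1 + (n : ℝ) ^ 2 := by positivity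
      have e1 : w n ^ (2 : ℝ) = (2 * Real.pi) ^ 2 * (|(n : ℝ)| ^ 2 * (1 + (n : ℝ) ^ 2) ^ (-r)) := by
        simp only [w, Real.rpow_ofNat, mul_pow]
        rw [← Real.rpow_natCast ((1 + (n : ℝ) ^ 2) ^ (-(r / 2))), ← Real.rpow_mul hp.le]
        have : -(r / 2) * ((2 : ℕ) : ℝ) = -r := by push_cast; ring
        rw [this]; ring
      rw [e1]
      refine mul_le_mul_of_nonneg_left ?_ (by positivity)
      have e2 : (1 + (n : ℝ) ^ 2) ^ (-r) ≤ (|(n : ℝ)| ^ 2) ^ (-r) := by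
        apply Real.rpow_le_rpow_of_nonpos (by positivity) _ (by linarith)
        rw [sq_abs]; linarith
      calc |(n : ℝ)| ^ 2 * (1 + (n : ℝ) ^ 2) ^ (-r)
          ≤ |(n : ℝ)| ^ 2 * (|(n : ℝ)| ^ 2) ^ (-r) :=
            mul_le_mul_of_nonneg_left e2 (by positivity)
        _ = |(n : ℝ)| ^ (-(2 * r - 2)) := by
            rw [← Real.rpow_natCast, ← Real.rpow_mul hn'.le, ← Real.rpow_add hn']
            congr 1; push_cast; ring
  let C : ℝ := (∑' n, w n ^ (2 : ℝ)) ^ (1 / (2 : ℝ)) + 1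
  have hC : 0 < C := by
    have : 0 ≤ ∑' n, w n ^ (2 : ℝ) := tsum_nonneg fun n => by positivity
    positivity
  refine ⟨C, hC, fun f => ?_⟩
  have hf : Summable fun n => ‖weightedCoeff r (toMap f) n‖ ^ (2 : ℝ) := by
    have h2 := (memℓp_gen_iff (p := 2) (by norm_num)).1
      (show Memℓp (weightedCoeff r (toMap f)) 2 from f.2)
    simpa using h2
  have hnorm : (∑' n, ‖weightedCoeff r (toMap f) n‖ ^ (2 : ℝ)) ^ (1 / (2 : ℝ)) = ‖f‖ := by
    change _ = ‖toSeq f‖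
    rw [lp.norm_eq_tsum_rpow (by norm_num)]
    simp [toSeq]
  have key := Real.summable_and_inner_le_Lp_mul_Lq_tsum_of_nonneg Real.HolderConjugate.two_two
    hw0 (fun n => norm_nonneg (weightedCoeff r (toMap f) n)) hw hf
  have e : (fun n => w n * ‖weightedCoeff r (toMap f) n‖) = fun n : ℤ => 2 * Real.pi * |(n : ℝ)| *
      ‖fourierCoeff (fun x : UnitAddCircle => (toMap f x : ℂ)) n‖ := by
    funext n
    have hp : (0 : ℝ) < 1 + (n : ℝ) ^ 2 := by positivity
    rw [weightedCoeff, norm_smul, Real.norm_of_nonneg (Real.rpow_nonneg hp.le _)]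
    simp only [w]
    have : (1 + (n : ℝ) ^ 2) ^ (-(r / 2)) * (1 + (n : ℝ) ^ 2) ^ (r / 2) = 1 := by
      rw [← Real.rpow_add hp]; simp
    linear_combination (2 * Real.pi * |(n : ℝ)| *
      ‖fourierCoeff (fun x : UnitAddCircle => (toMap f x : ℂ)) n‖) * this
  rw [hnorm] at key
  rw [e] at key
  refine ⟨key.1, key.2.trans ?_⟩
  exact mul_le_mul_of_nonneg_right (by simp [C]) (norm_nonneg _)

/-- For `r > 3/2` the elements of `H^r(S¹; ℝ)` are `C¹`, with a bound on the derivative. -/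
theorem exists_deriv_bound (hr : 3 / 2 < r) : ∃ C : ℝ, 0 < C ∧ ∀ f : Sobolev r,
    Differentiable ℝ f.fn ∧ Continuous (deriv f.fn) ∧ ∀ x, |deriv f.fn x| ≤ C * ‖f‖ := by
  obtain ⟨C, hC, h⟩ := summable_deriv hr
  refine ⟨C, hC, fun f => ?_⟩
  obtain ⟨hs, hle⟩ := h f
  let F : C(UnitAddCircle, ℂ) :=
    ⟨fun x => (toMap f x : ℂ), Complex.continuous_ofReal.comp (toMap f).continuous⟩
  let g : ℤ → ℝ → ℂ := fun n y => fourierCoeff F n • fourier n (y : UnitAddCircle)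
  let g' : ℤ → ℝ → ℂ := fun n y =>
    fourierCoeff F n • (2 * Real.pi * Complex.I * n / (1 : ℝ) * fourier n (y : UnitAddCircle))
  have hg : ∀ n y, HasDerivAt (g n) (g' n y) y := fun n y =>
    (hasDerivAt_fourier 1 n y).const_mul (fourierCoeff F n)
  have hu : ∀ n y, ‖g' n y‖ ≤ 2 * Real.pi * |(n : ℝ)| * ‖fourierCoeff F n‖ := by
    intro n y
    simp only [g', norm_smul, norm_mul, norm_div, fourier_apply, Circle.norm_coe]
    simp [abs_of_pos Real.pi_pos]
    exact le_of_eq (by ring)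
  have hs0 : Summable (fourierCoeff F) := by
    refine Summable.of_norm_bounded_eventually hs ?_
    rw [Filter.eventually_cofinite]
    refine (Set.finite_singleton (0 : ℤ)).subset fun n hn => ?_
    by_contra hne
    apply hn
    have h1 : (1 : ℝ) ≤ |(n : ℝ)| := by
      have := Int.one_le_abs (show n ≠ 0 from hne)
      exact_mod_cast this
    have h2 : (1 : ℝ) ≤ 2 * Real.pi * |(n : ℝ)| := by nlinarith [Real.pi_gt_three]
    exact le_mul_of_one_le_left (norm_nonneg _) h2
  have hF : ∀ y : ℝ, HasSum (fun n => g n y) (F (y : UnitAddCircle)) := fun y =>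
    has_pointwise_sum_fourier_series_of_summable hs0 _
  have hd : ∀ y : ℝ, HasDerivAt (fun z : ℝ => ((f.fn z : ℝ) : ℂ)) (∑' n, g' n y) y := by
    intro y
    have := hasDerivAt_tsum (y₀ := 0) hs hg hu (hF 0).summable y
    have e : (fun z : ℝ => ∑' n, g n z) = fun z : ℝ => ((f.fn z : ℝ) : ℂ) := by
      funext z
      exact (hF z).tsum_eq
    rwa [e] at this
  have hd' : ∀ y : ℝ, HasDerivAt f.fn (∑' n, g' n y).re y := fun y => by
    have := (Complex.reCLM.hasFDerivAt.comp_hasDerivAt y (hd y))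
    simpa [Function.comp_def] using this
  have hde : deriv f.fn = fun y => (∑' n, g' n y).re := funext fun y => (hd' y).deriv
  refine ⟨fun y => (hd' y).differentiableAt, ?_, fun x => ?_⟩
  · rw [hde]
    refine Complex.continuous_re.comp (continuous_tsum (fun n => ?_) hs hu)
    have : Continuous fun y : ℝ => fourier n (y : UnitAddCircle) :=
      (map_continuous (fourier n)).comp (AddCircle.continuous_mk' 1)
    exact continuous_const.mul (continuous_const.mul this)
  · rw [hde]
    refine (Complex.abs_re_le_norm _).trans (le_trans ?_ hle)
    exact tsum_of_norm_bounded hs.hasSum (fun n => hu n x)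

theorem fn_add (f g : Sobolev r) (x : ℝ) : (f + g).fn x = f.fn x + g.fn x := rfl

theorem fn_smul (c : ℝ) (f : Sobolev r) (x : ℝ) : (c • f).fn x = c * f.fn x := rfl

theorem fn_sub (f g : Sobolev r) (x : ℝ) : (f - g).fn x = f.fn x - g.fn x := by
  simp [fn]

theorem fn_neg (f : Sobolev r) (x : ℝ) : (-f).fn x = -f.fn x := by
  simp [fn]

theorem fn_zero (x : ℝ) : (0 : Sobolev r).fn x = 0 := rfl

theorem fn_continuous (f : Sobolev r) : Continuous f.fn :=
  (toMap f).continuous.comp (AddCircle.continuous_mk' 1)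

theorem fn_periodic (f : Sobolev r) : Function.Periodic f.fn 1 := fun x => by
  simp only [fn]
  rw [AddCircle.coe_add_period]

theorem fn_bounded (f : Sobolev r) (x : ℝ) : |f.fn x| ≤ ‖toMap f‖ :=
  (toMap f).norm_coe_le_norm _

theorem fn_injective : Function.Injective (fn (r := r)) := fun f g h => by
  apply toMap_injective
  ext x
  obtain ⟨y, rfl⟩ := QuotientAddGroup.mk_surjective x
  exact congrFun h y

variable (r)

/-- The constant functions in `H^r(S¹; ℝ)`. -/
def constants : Submodule ℝ (Sobolev r) where
  carrier := {f | ∃ c : ℝ, ∀ x, f.fn x = c}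
  add_mem' := by
    rintro f g ⟨c, hc⟩ ⟨d, hd⟩
    exact ⟨c + d, fun x => by rw [fn_add, hc, hd]⟩
  zero_mem' := ⟨0, fun x => rfl⟩
  smul_mem' := by
    rintro a f ⟨c, hc⟩
    exact ⟨a * c, fun x => by rw [fn_smul, hc]⟩

instance : IsClosed (constants r : Set (Sobolev r)) := by
  let ev : constants r →ₗ[ℝ] ℝ :=
    { toFun := fun f => f.1.fn 0
      map_add' := fun f g => rfl
      map_smul' := fun c f => rfl }
  have hev : Function.Injective ev := by
    rintro ⟨f, c, hc⟩ ⟨g, d, hd⟩ h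
    have h' : f.fn 0 = g.fn 0 := h
    rw [hc, hd] at h'
    apply Subtype.ext
    apply fn_injective
    funext x
    change f.fn x = g.fn x
    rw [hc, hd, h']
  have : FiniteDimensional ℝ (constants r) := FiniteDimensional.of_injective ev hev
  exact Submodule.closed_of_finiteDimensional _

/-- The closed hyperplane `H_0^r(S¹; ℝ)` of functions vanishing at `0`. -/
def vanishing : Submodule ℝ (Sobolev r) where
  carrier := {f | f.fn 0 = 0}
  add_mem' := by
    intro f g hf hg
    change f.fn 0 + g.fn 0 = 0
    rw [show f.fn 0 = 0 from hf, show g.fn 0 = 0 from hg, add_zero]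
  zero_mem' := rfl
  smul_mem' := by
    intro c f hf
    change c * f.fn 0 = 0
    rw [show f.fn 0 = 0 from hf, mul_zero]

end Sobolev

/-- The closed subspace `H_0^r(S¹; ℝ)` of `H^r(S¹; ℝ)`. -/
abbrev SobolevZero (r : ℝ) : Type := Sobolev.vanishing r

/-- The Banach space `H^r(S¹; ℝ)/ℝ` of functions modulo constants. -/
def SobolevMod (r : ℝ) : Type := Sobolev r ⧸ Sobolev.constants r

namespace SobolevMod

variable {r : ℝ}

instance : NormedAddCommGroup (SobolevMod r) :=
  inferInstanceAs (NormedAddCommGroup (Sobolev r ⧸ Sobolev.constants r))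

instance : NormedSpace ℝ (SobolevMod r) :=
  inferInstanceAs (NormedSpace ℝ (Sobolev r ⧸ Sobolev.constants r))

/-- The class `[f]`. -/
def mk : Sobolev r →ₗ[ℝ] SobolevMod r := (Sobolev.constants r).mkQ

theorem mk_surjective (q : SobolevMod r) : ∃ f, mk f = q :=
  Submodule.mkQ_surjective _ q

end SobolevMod

/-! ### The diffeomorphisms -/

/-- The set of `h ∈ H_0^s(S¹; ℝ)` with `h_x > -1`. -/
def diffSet (s : ℝ) : Set (SobolevZero s) := {h | ∀ x, -1 < deriv h.1.fn x}

/-- `Diff_0^s(S¹) = {id + h | h ∈ H_0^s(S¹; ℝ), h_x > -1}`, with the topology of `H_0^s(S¹; ℝ)`. -/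
abbrev Diff (s : ℝ) : Type := diffSet s

theorem isOpen_diffSet (s : ℝ) [hs : Fact (5 / 2 < s)] : IsOpen (diffSet s) := by
  obtain ⟨C, hC, hb⟩ := Sobolev.exists_deriv_bound (r := s) (by linarith [hs.out])
  rw [Metric.isOpen_iff]
  intro h hh
  obtain ⟨hd, hc, -⟩ := hb h.1
  obtain ⟨x₀, -, hx₀⟩ := (isCompact_Icc (a := (0 : ℝ)) (b := 1)).exists_isMinOn
    ⟨0, by simp⟩ hc.continuousOn
  have hper : Function.Periodic (deriv h.1.fn) 1 := by
    intro x
    have e : (fun y => h.1.fn (y + 1)) = h.1.fn := funext h.1.fn_periodic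
    rw [← deriv_comp_add_const, e]
  have hmin : ∀ x, deriv h.1.fn x₀ ≤ deriv h.1.fn x := by
    intro x
    obtain ⟨y, hy, hxy⟩ := hper.exists_mem_Ico₀ one_pos x
    rw [hxy]
    exact hx₀ ⟨hy.1, hy.2.le⟩
  have hpos : 0 < deriv h.1.fn x₀ + 1 := by linarith [hh x₀]
  refine ⟨(deriv h.1.fn x₀ + 1) / C, by positivity, fun k hk x => ?_⟩
  have hk' : C * ‖k.1 - h.1‖ < deriv h.1.fn x₀ + 1 := by
    have : ‖k.1 - h.1‖ < (deriv h.1.fn x₀ + 1) / C := by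
      rw [Metric.mem_ball, dist_eq_norm] at hk
      exact hk
    rw [lt_div_iff₀ hC] at this
    linarith
  have e : deriv (k.1 - h.1).fn x = deriv k.1.fn x - deriv h.1.fn x := by
    have : (k.1 - h.1).fn = k.1.fn - h.1.fn := funext fun y => Sobolev.fn_sub _ _ y
    rw [this, deriv_sub ((hb k.1).1 x) (hd x)]
  have h1 := (hb (k.1 - h.1)).2.2 x
  rw [e] at h1
  have h2 := hmin x
  have h3 := (abs_le.1 h1).1
  linarith

namespace Diff

variable {s : ℝ}

/-- The lift `ℝ → ℝ` of `φ = id + h`. -/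
def map (φ : Diff s) (x : ℝ) : ℝ := x + φ.1.1.fn x

theorem map_bijective [hs : Fact (5 / 2 < s)] (φ : Diff s) : Function.Bijective φ.map := by
  obtain ⟨C, hC, hb⟩ := Sobolev.exists_deriv_bound (r := s) (by linarith [hs.out])
  have hcont : Continuous φ.map := continuous_id.add φ.1.1.fn_continuous
  constructor
  · refine (strictMono_of_deriv_pos fun x => ?_).injective
    have : HasDerivAt φ.map (1 + deriv φ.1.1.fn x) x :=
      (hasDerivAt_id x).add ((hb φ.1.1).1 x).hasDerivAt
    rw [this.deriv]
    linarith [φ.2 x]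
  · refine hcont.surjective ?_ ?_
    · refine Filter.tendsto_atTop_mono (f := fun x => x - ‖Sobolev.toMap φ.1.1‖) (fun x => ?_)
        (Filter.tendsto_atTop_add_const_right _ _ Filter.tendsto_id)
      have := (abs_le.1 (φ.1.1.fn_bounded x)).1
      simp only [map]; linarith
    · refine Filter.tendsto_atBot_mono (f := fun x => x + ‖Sobolev.toMap φ.1.1‖) (fun x => ?_)
        (Filter.tendsto_atBot_add_const_right _ _ Filter.tendsto_id)
      have := (abs_le.1 (φ.1.1.fn_bounded x)).2
      simp only [map]; linarith

/-- The inverse diffeomorphism `φ⁻¹`, as a map of the line. -/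
def inv [Fact (5 / 2 < s)] (φ : Diff s) : ℝ → ℝ := (Equiv.ofBijective φ.map φ.map_bijective).symm

end Diff

/-! ### The circle-valued maps modulo constant phases -/

/-- The circle `ℝ/4πℤ` of length `4π`. -/
abbrev Circle4π : Type := AddCircle (4 * Real.pi)

theorem coe_eq_zero_iff' (x : ℝ) : (x : Circle4π) = 0 ↔ ∃ n : ℤ, 4 * Real.pi * n = x := by
  rw [AddCircle.coe_eq_zero_iff]
  simp [mul_comm]

/-- `H^r(S¹; ℝ/4πℤ)` for `r > 1/2`: the continuous maps `α` of the circle `ℝ/ℤ` into `ℝ/4πℤ` whose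
continuous lifts `ℝ → ℝ` are of the form `4πnx + h(x)`, where `n ∈ ℤ` is the winding number and
`h ∈ H^r(S¹; ℝ)`. -/
def circleMaps (r : ℝ) : AddSubgroup C(UnitAddCircle, Circle4π) where
  carrier := {α | ∃ (n : ℤ) (h : Sobolev r), ∀ x : ℝ,
    α (x : UnitAddCircle) = ((4 * Real.pi * n * x + h.fn x : ℝ) : Circle4π)}
  add_mem' := by
    rintro α β ⟨n, h, hα⟩ ⟨m, k, hβ⟩
    refine ⟨n + m, h + k, fun x => ?_⟩
    rw [ContinuousMap.add_apply, hα, hβ, ← AddCircle.coe_add, Sobolev.fn_add]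
    push_cast
    congr 1
    ring
  zero_mem' := ⟨0, 0, fun x => by simp [Sobolev.fn_zero]⟩
  neg_mem' := by
    rintro α ⟨n, h, hα⟩
    refine ⟨-n, -h, fun x => ?_⟩
    rw [ContinuousMap.neg_apply, hα, ← AddCircle.coe_neg, Sobolev.fn_neg]
    push_cast
    congr 1
    ring

/-- The constant maps in `H^r(S¹; ℝ/4πℤ)`. -/
def constantPhases (r : ℝ) : AddSubgroup (circleMaps r) where
  carrier := {α | ∃ c : Circle4π, ∀ x, α.1 x = c}
  add_mem' := by
    rintro α β ⟨c, hc⟩ ⟨d, hd⟩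
    exact ⟨c + d, fun x => by
      rw [AddSubgroup.coe_add, ContinuousMap.add_apply, hc, hd]⟩
  zero_mem' := ⟨0, fun x => rfl⟩
  neg_mem' := by
    rintro α ⟨c, hc⟩
    exact ⟨-c, fun x => by rw [AddSubgroup.coe_neg, ContinuousMap.neg_apply, hc]⟩

/-- `H^r(S¹; ℝ/4πℤ)/(ℝ/4πℤ)`: maps that differ by a constant phase are identified. -/
def Phase (r : ℝ) : Type := circleMaps r ⧸ constantPhases r

/-- The class `[α]`. -/
def Phase.mk {r : ℝ} (α : circleMaps r) : Phase r := QuotientAddGroup.mk α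

theorem Phase.mk_surjective {r : ℝ} : Function.Surjective (Phase.mk (r := r)) :=
  QuotientAddGroup.mk_surjective

theorem Phase.mk_eq_mk {r : ℝ} {α β : circleMaps r} :
    Phase.mk α = Phase.mk β ↔ ∃ c : Circle4π, ∀ x, β.1 x - α.1 x = c := by
  refine (QuotientAddGroup.eq (s := constantPhases r)).trans ?_
  change (∃ c, ∀ x, (-α + β).1 x = c) ↔ _
  refine exists_congr fun c => forall_congr' fun x => ?_
  rw [AddSubgroup.coe_add, ContinuousMap.add_apply, AddSubgroup.coe_neg, ContinuousMap.neg_apply,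
    neg_add_eq_sub]

/-- The map `x ↦ 4πnx + h(x)` from `ℝ/ℤ` to `ℝ/4πℤ`. -/
def windMap {r : ℝ} (n : ℤ) (h : Sobolev r) : circleMaps r :=
  ⟨⟨fun x => n • AddCircle.homeomorphAddCircle 1 (4 * Real.pi) one_ne_zero (by positivity) x +
      ((Sobolev.toMap h x : ℝ) : Circle4π), by
      refine Continuous.add ?_ ?_
      · exact (Homeomorph.continuous _).zsmul n
      · exact (AddCircle.continuous_mk' _).comp (Sobolev.toMap h).continuous⟩,
    ⟨n, h, fun x => by
      change n • _ + ((h.fn x : ℝ) : Circle4π) = _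
      rw [AddCircle.coe_add]
      congr 1
      rw [AddCircle.homeomorphAddCircle_apply_mk, ← AddCircle.coe_zsmul]
      congr 1
      simp only [zsmul_eq_mul]
      ring⟩⟩

theorem windMap_apply {r : ℝ} (n : ℤ) (h : Sobolev r) (x : ℝ) :
    (windMap n h).1 (x : UnitAddCircle) = ((4 * Real.pi * n * x + h.fn x : ℝ) : Circle4π) := by
  change n • _ + ((h.fn x : ℝ) : Circle4π) = _
  rw [AddCircle.coe_add]
  congr 1
  rw [AddCircle.homeomorphAddCircle_apply_mk, ← AddCircle.coe_zsmul]
  congr 1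
  simp only [zsmul_eq_mul]
  ring

theorem mk_windMap_eq {r : ℝ} (n m : ℤ) (h k : Sobolev r) :
    Phase.mk (windMap n h) = Phase.mk (windMap m k) ↔ n = m ∧ k - h ∈ Sobolev.constants r := by
  rw [Phase.mk_eq_mk]
  constructor
  · rintro ⟨c, hc⟩
    let F : ℝ → ℝ := fun x => 4 * Real.pi * (m - n : ℤ) * x + (k - h).fn x
    have hF : ∀ x, ((F x : ℝ) : Circle4π) = c := by
      intro x
      rw [← hc (x : UnitAddCircle), windMap_apply, windMap_apply, ← AddCircle.coe_sub]
      congr 1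
      simp only [F, Sobolev.fn_sub]
      push_cast
      ring
    have hFc : Continuous F := (continuous_const.mul continuous_id).add (k - h).fn_continuous
    have hconst : ∀ x, F x = F 0 := by
      intro x
      have h1 : ∀ y, ∃ j : ℤ, (j : ℝ) = (F y - F 0) / (4 * Real.pi) := by
        intro y
        have h2 : ((F y - F 0 : ℝ) : Circle4π) = 0 := by
          rw [AddCircle.coe_sub, hF, hF, sub_self]
        obtain ⟨j, hj⟩ := (coe_eq_zero_iff' _).1 h2
        refine ⟨j, ?_⟩
        rw [← hj]
        field_simp
      choose j hj using h1
      have hjc : Continuous fun y => (j y : ℝ) := by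
        have : (fun y => (j y : ℝ)) = fun y => (F y - F 0) / (4 * Real.pi) := funext hj
        rw [this]
        exact (hFc.sub continuous_const).div_const _
      have hjc' : Continuous j := Int.isClosedEmbedding_coe_real.isInducing.continuous_iff.2 hjc
      have h3 : j x = j 0 := PreconnectedSpace.constant inferInstance hjc'
      have h4 := hj x
      rw [h3, hj 0, sub_self, zero_div] at h4
      have h5 := (div_eq_zero_iff.1 h4.symm).resolve_right (by positivity)
      linarith
    have hnm : n = m := by
      have h1 := hconst 1
      simp only [F, mul_one, mul_zero, zero_add] at h1
      have h2 : (k - h).fn 1 = (k - h).fn 0 := by simpa using (k - h).fn_periodic 0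
      rw [h2] at h1
      have h3 : (4 * Real.pi) * ((m - n : ℤ) : ℝ) = 0 := by linarith
      have h4 := (mul_eq_zero.1 h3).resolve_left (by positivity)
      have h5 : m - n = 0 := by exact_mod_cast h4
      omega
    refine ⟨hnm, F 0, fun x => ?_⟩
    have h1 := hconst x
    subst hnm
    simpa [F] using h1
  · rintro ⟨rfl, c, hc⟩
    refine ⟨(c : Circle4π), fun x => ?_⟩
    obtain ⟨y, rfl⟩ := QuotientAddGroup.mk_surjective x
    rw [windMap_apply, windMap_apply, ← AddCircle.coe_sub, ← hc y, Sobolev.fn_sub]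
    congr 1
    ring

/-- The class of `x ↦ 4πnx + h(x)`, as a function of `n` and of `h` modulo constants. -/
def phaseOf {r : ℝ} (p : ℤ × SobolevMod r) : Phase r :=
  Quotient.liftOn' p.2 (fun h => Phase.mk (windMap p.1 h)) fun h k hk => by
    rw [mk_windMap_eq]
    refine ⟨rfl, ?_⟩
    have := QuotientAddGroup.leftRel_apply.1 hk
    rwa [neg_add_eq_sub] at this

theorem phaseOf_bijective {r : ℝ} : Function.Bijective (phaseOf (r := r)) := by
  constructor
  · rintro ⟨n, h⟩ ⟨m, k⟩ e
    obtain ⟨h, rfl⟩ := SobolevMod.mk_surjective h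
    obtain ⟨k, rfl⟩ := SobolevMod.mk_surjective k
    obtain ⟨rfl, hk⟩ := (mk_windMap_eq n m h k).1 e
    rw [Prod.mk.injEq]
    refine ⟨rfl, ?_⟩
    exact ((Submodule.Quotient.eq (Sobolev.constants r)).2 hk).symm
  · intro a
    obtain ⟨⟨α, n, h, hα⟩, rfl⟩ := Phase.mk_surjective a
    refine ⟨(n, SobolevMod.mk h), ?_⟩
    change Phase.mk (windMap n h) = _
    rw [Phase.mk_eq_mk]
    refine ⟨0, fun x => ?_⟩
    obtain ⟨y, rfl⟩ := QuotientAddGroup.mk_surjective x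
    exact sub_eq_zero.2 ((hα y).trans (windMap_apply n h y).symm)

/-! ### The manifold `K^s` -/

/-- The model space `H_0^s(S¹; ℝ) × (H^{s-1}(S¹; ℝ)/ℝ)`. -/
def Model (s : ℝ) : Type := SobolevZero s × SobolevMod (s - 1)

instance (s : ℝ) : NormedAddCommGroup (Model s) :=
  inferInstanceAs (NormedAddCommGroup (SobolevZero s × SobolevMod (s - 1)))

instance (s : ℝ) : NormedSpace ℝ (Model s) :=
  inferInstanceAs (NormedSpace ℝ (SobolevZero s × SobolevMod (s - 1)))

/-- The space `K^s = Diff_0^s(S¹) × H^{s-1}(S¹; ℝ/4πℤ)/(ℝ/4πℤ)` of pairs `(φ, [α])`. -/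
structure K (s : ℝ) where
  /-- the diffeomorphism `φ` -/
  diffeo : Diff s
  /-- the class `[α]` -/
  phase : Phase (s - 1)

namespace K

variable {s : ℝ}

/-- A point of `K^s` is determined by `φ`, by the winding number of `α`, and by the periodic part of
a lift of `α` modulo constants. -/
def coords : K s ≃ Diff s × (ℤ × SobolevMod (s - 1)) where
  toFun p := (p.diffeo, (Equiv.ofBijective phaseOf phaseOf_bijective).symm p.phase)
  invFun e := ⟨e.1, phaseOf e.2⟩
  left_inv p := by
    obtain ⟨φ, a⟩ := p
    simp only [K.mk.injEq, true_and]
    exact (Equiv.ofBijective phaseOf phaseOf_bijective).apply_symm_apply a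
  right_inv e := Prod.ext rfl ((Equiv.ofBijective phaseOf phaseOf_bijective).symm_apply_apply e.2)

/-- The topology of `K^s`, for which the parts of fixed winding number are open. -/
instance : TopologicalSpace (K s) := TopologicalSpace.induced coords inferInstance

/-- `coords` as a homeomorphism. -/
def coordsHomeo : K s ≃ₜ Diff s × (ℤ × SobolevMod (s - 1)) :=
  coords.toHomeomorphOfIsInducing ⟨rfl⟩

/-- The winding number of `α` at the point `(φ, [α])`. -/
def winding (p : K s) : ℤ := (coordsHomeo p).2.1

/-- `0 ∈ H_0^s` belongs to the chart domain, because the identity is a diffeomorphism. -/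
theorem zero_mem_diffSet : (0 : SobolevZero s) ∈ diffSet s := by
  intro x
  have : (0 : SobolevZero s).1.fn = fun _ => 0 := rfl
  rw [this]
  simp

open Classical in
/-- The chart `(id + h, [4πnx + k(x)]) ↦ (h, [k])` on the part of `K^s` of winding number `n`. -/
def chart [Fact (5 / 2 < s)] (n : ℤ) : OpenPartialHomeomorph (K s) (Model s) where
  toFun p := ((coordsHomeo p).1.1, (coordsHomeo p).2.2)
  invFun e := coordsHomeo.symm
    (if h : e.1 ∈ diffSet s then ⟨e.1, h⟩ else ⟨0, zero_mem_diffSet⟩, (n, e.2))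
  source := {p | p.winding = n}
  target := {e | e.1 ∈ diffSet s}
  map_source' p hp := (coordsHomeo p).1.2
  map_target' e he := by simp [winding]
  left_inv' p hp := by
    have hp' : (coordsHomeo p).2.1 = n := hp
    have h1 : (coordsHomeo p).1.1 ∈ diffSet s := (coordsHomeo p).1.2
    simp only [h1, dif_pos]
    rw [Homeomorph.symm_apply_eq, ← hp']
  right_inv' e he := by
    have he' : e.1 ∈ diffSet s := he
    simp only [Homeomorph.apply_symm_apply, he', dif_pos]
    rfl
  open_source :=
    (isOpen_discrete ({n} : Set ℤ)).preimage
      (continuous_fst.comp (continuous_snd.comp coordsHomeo.continuous))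
  open_target := (isOpen_diffSet s).preimage continuous_fst
  continuousOn_toFun :=
    ((continuous_subtype_val.comp (continuous_fst.comp coordsHomeo.continuous)).prodMk
      (continuous_snd.comp (continuous_snd.comp coordsHomeo.continuous))).continuousOn
  continuousOn_invFun := by
    rw [continuousOn_iff_continuous_domRestrict]
    have c₁ : Continuous fun x : {e : Model s | e.1 ∈ diffSet s} => x.1.1 :=
      (continuous_fst (X := SobolevZero s) (Y := SobolevMod (s - 1))).comp continuous_subtype_val
    have c₂ : Continuous fun x : {e : Model s | e.1 ∈ diffSet s} => x.1.2 :=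
      (continuous_snd (X := SobolevZero s) (Y := SobolevMod (s - 1))).comp continuous_subtype_val
    refine coordsHomeo.symm.continuous.comp (Continuous.prodMk ?_ ?_)
    · have e : (fun x : {e : Model s | e.1 ∈ diffSet s} =>
          (if h : x.1.1 ∈ diffSet s then (⟨x.1.1, h⟩ : Diff s) else ⟨0, zero_mem_diffSet⟩)) =
          fun x => ⟨x.1.1, x.2⟩ := by
        funext x
        exact dif_pos x.2
      rw [e]
      exact c₁.subtype_mk _
    · exact continuous_const.prodMk c₂

/-- The charts are indexed by the winding number. -/
instance [Fact (5 / 2 < s)] : ChartedSpace (Model s) (K s) where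
  atlas := Set.range chart
  chartAt p := chart p.winding
  mem_chart_source _ := rfl
  chart_mem_atlas p := ⟨p.winding, rfl⟩

instance [Fact (5 / 2 < s)] (n : ℕ∞ω) : IsManifold 𝓘(ℝ, Model s) n (K s) := by
  apply isManifold_of_contDiffOn
  rintro e e' ⟨i, rfl⟩ ⟨j, rfl⟩
  refine contDiffOn_id.congr fun x hx => ?_
  simp only [modelWithCornersSelf_coe, modelWithCornersSelf_coe_symm, Set.preimage_id,
    Set.range_id, Set.inter_univ, OpenPartialHomeomorph.trans_source] at hx
  exact (chart i).right_inv (by simpa using hx.1)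

/-- `(φ, [α])(ψ, [β]) = (φ ∘ ψ, [β + α ∘ ψ])`, as a relation between the two factors `p`, `q` and
the product `r`. -/
def IsProduct (p q r : K s) : Prop :=
  (∀ x, r.diffeo.map x = p.diffeo.map (q.diffeo.map x)) ∧
  ∃ α β γ : circleMaps (s - 1), p.phase = Phase.mk α ∧ q.phase = Phase.mk β ∧
    r.phase = Phase.mk γ ∧ ∀ x : ℝ, γ.1 (x : UnitAddCircle) =
      β.1 (x : UnitAddCircle) + α.1 (q.diffeo.map x : UnitAddCircle)

variable [Fact (5 / 2 < s)]

/-- The tangent space at `p`; it is the model space, by means of the chart at `p`. -/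
abbrev T (p : K s) : Type := TangentSpace 𝓘(ℝ, Model s) p

/-- The tangent vector `(U₁, [U₂])` at `p`. -/
def vec (p : K s) (U₁ : SobolevZero s) (U₂ : Sobolev (s - 1)) : T p :=
  ((U₁, SobolevMod.mk U₂) : Model s)

end K

/-! ### Formulas at the identity, for `1`-periodic functions on the line -/

/-- `π(ρ) = ρ - ∫ ρ dx`. -/
def proj (ρ : ℝ → ℝ) (x : ℝ) : ℝ := ρ x - ∫ y in (0 : ℝ)..1, ρ y

/-- `⟨(u₁, [u₂]), (v₁, [v₂])⟩ = (1/4) ∫ (u₁' v₁' + π(u₂) π(v₂)) dx`. -/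
def metricId (u₁ u₂ v₁ v₂ : ℝ → ℝ) : ℝ :=
  1 / 4 * ∫ x in (0 : ℝ)..1, (deriv u₁ x * deriv v₁ x + proj u₂ x * proj v₂ x)

/-- The inverse of `A = -∂ₓ²`, with values in the periodic functions vanishing at `0`. -/
def invA (f : ℝ → ℝ) (x : ℝ) : ℝ :=
  -(∫ y in (0 : ℝ)..x, ∫ z in (0 : ℝ)..y, f z) + x * ∫ y in (0 : ℝ)..1, ∫ z in (0 : ℝ)..y, f z

/-- First component of the Christoffel map at the identity. -/
def christoffelId₁ (u₁ u₂ v₁ v₂ : ℝ → ℝ) (x : ℝ) : ℝ :=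
  -(1 / 2) * invA (deriv fun y => deriv u₁ y * deriv v₁ y + proj u₂ y * proj v₂ y) x

/-- Second component of the Christoffel map at the identity (modulo constants). -/
def christoffelId₂ (u₁ u₂ v₁ v₂ : ℝ → ℝ) (x : ℝ) : ℝ :=
  -(1 / 2) * (deriv u₁ x * proj v₂ x + deriv v₁ x * proj u₂ x)

/-! ### The structures on `K^s` -/

open K

section Structures

variable {s : ℝ} [Fact (5 / 2 < s)]

/-- `g` is the right-invariant metric: `g_{(φ,[α])}(U, V) = ⟨U ∘ φ⁻¹, V ∘ φ⁻¹⟩` at the identity. -/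
def IsTheMetric (g : ∀ p : K s, T p →L[ℝ] T p →L[ℝ] ℝ) : Prop :=
  ∀ (p : K s) (U₁ V₁ : SobolevZero s) (U₂ V₂ : Sobolev (s - 1)),
    g p (p.vec U₁ U₂) (p.vec V₁ V₂) =
      metricId (U₁.1.fn ∘ p.diffeo.inv) (U₂.fn ∘ p.diffeo.inv)
        (V₁.1.fn ∘ p.diffeo.inv) (V₂.fn ∘ p.diffeo.inv)

/-- Right translation by `q = (ψ, [β])` preserves `g`; its tangent map is
`(U₁, [U₂]) ↦ (U₁ ∘ ψ, [U₂ ∘ ψ])`. -/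
def IsRightInvariant (g : ∀ p : K s, T p →L[ℝ] T p →L[ℝ] ℝ) : Prop :=
  ∀ p q r : K s, IsProduct p q r →
    ∀ (U₁ V₁ U₁' V₁' : SobolevZero s) (U₂ V₂ U₂' V₂' : Sobolev (s - 1)),
      U₁'.1.fn = U₁.1.fn ∘ q.diffeo.map → U₂'.fn = U₂.fn ∘ q.diffeo.map →
      V₁'.1.fn = V₁.1.fn ∘ q.diffeo.map → V₂'.fn = V₂.fn ∘ q.diffeo.map →
      g r (r.vec U₁' U₂') (r.vec V₁' V₂') = g p (p.vec U₁ U₂) (p.vec V₁ V₂)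

/-- `Γ` is the Christoffel map: `Γ_{(φ,[α])}(U, V) = Γ_{(id,[0])}(U ∘ φ⁻¹, V ∘ φ⁻¹) ∘ φ`. -/
def IsTheChristoffelMap (Γ : K s → Model s →L[ℝ] Model s →L[ℝ] Model s) : Prop :=
  ∀ (p : K s) (U₁ V₁ : SobolevZero s) (U₂ V₂ : Sobolev (s - 1)),
    ∃ (W₁ : SobolevZero s) (W₂ : Sobolev (s - 1)),
      (∀ x, W₁.1.fn x = christoffelId₁ (U₁.1.fn ∘ p.diffeo.inv) (U₂.fn ∘ p.diffeo.inv)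
        (V₁.1.fn ∘ p.diffeo.inv) (V₂.fn ∘ p.diffeo.inv) (p.diffeo.map x)) ∧
      (∀ x, W₂.fn x = christoffelId₂ (U₁.1.fn ∘ p.diffeo.inv) (U₂.fn ∘ p.diffeo.inv)
        (V₁.1.fn ∘ p.diffeo.inv) (V₂.fn ∘ p.diffeo.inv) (p.diffeo.map x)) ∧
      Γ p (p.vec U₁ U₂) (p.vec V₁ V₂) = p.vec W₁ W₂

/-- `ω_{(φ,[α])}(U, V) = (1/4) ∫ (U₂ₓ V₁ - V₂ₓ U₁) dx`. -/
def IsTheTwoForm (w : ∀ p : K s, T p →L[ℝ] T p →L[ℝ] ℝ) : Prop :=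
  ∀ (p : K s) (U₁ V₁ : SobolevZero s) (U₂ V₂ : Sobolev (s - 1)),
    w p (p.vec U₁ U₂) (p.vec V₁ V₂) =
      1 / 4 * ∫ x in (0 : ℝ)..1, (deriv U₂.fn x * V₁.1.fn x - deriv V₂.fn x * U₁.1.fn x)

/-- `J_{(φ,[α])}(U₁, [U₂]) = (-∫₀ˣ π(U₂) φₓ dy, [U₁ₓ / φₓ])` with `π(U₂) = U₂ - ∫ U₂ φₓ dx`. -/
def IsTheComplexStructure (J : ∀ p : K s, T p →L[ℝ] T p) : Prop :=
  ∀ (p : K s) (U₁ : SobolevZero s) (U₂ : Sobolev (s - 1)),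
    ∃ (W₁ : SobolevZero s) (W₂ : Sobolev (s - 1)),
      (∀ x, W₁.1.fn x = -∫ y in (0 : ℝ)..x,
        (U₂.fn y - ∫ z in (0 : ℝ)..1, U₂.fn z * deriv p.diffeo.map z) * deriv p.diffeo.map y) ∧
      (∀ x, W₂.fn x = deriv U₁.1.fn x / deriv p.diffeo.map x) ∧
      J p (p.vec U₁ U₂) = p.vec W₁ W₂

/-- Smooth vector fields on `K^s`. -/
def IsSmoothField (X : ∀ p : K s, T p) : Prop :=
  ContMDiff 𝓘(ℝ, Model s) 𝓘(ℝ, Model s).tangent ∞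
    (fun p => (⟨p, X p⟩ : TangentBundle 𝓘(ℝ, Model s) (K s)))

/-- Smooth covariant `2`-tensor fields on `K^s`. -/
def IsSmoothForm (b : ∀ p : K s, T p →L[ℝ] T p →L[ℝ] ℝ) : Prop :=
  ContMDiff 𝓘(ℝ, Model s) (𝓘(ℝ, Model s).prod 𝓘(ℝ, Model s →L[ℝ] Model s →L[ℝ] ℝ)) ∞
    (fun p => TotalSpace.mk' (Model s →L[ℝ] Model s →L[ℝ] ℝ)
      (E := fun p : K s => T p →L[ℝ] T p →L[ℝ] ℝ) p (b p))

/-- Smooth `(1,1)`-tensor fields on `K^s`. -/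
def IsSmoothEndo (J : ∀ p : K s, T p →L[ℝ] T p) : Prop :=
  ContMDiff 𝓘(ℝ, Model s) (𝓘(ℝ, Model s).prod 𝓘(ℝ, Model s →L[ℝ] Model s)) ∞
    (fun p => TotalSpace.mk' (Model s →L[ℝ] Model s)
      (E := fun p : K s => T p →L[ℝ] T p) p (J p))

/-- The derivative of the real function `f` at `p` in the direction `v`. -/
def dirDeriv (f : K s → ℝ) (p : K s) (v : T p) : ℝ :=
  mfderiv 𝓘(ℝ, Model s) 𝓘(ℝ, ℝ) f p v

/-- The Lie bracket of vector fields. -/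
abbrev bracket (X Y : ∀ p : K s, T p) : ∀ p : K s, T p :=
  VectorField.mlieBracket 𝓘(ℝ, Model s) X Y

/-- The exterior derivative `dω(X, Y, Z)` of a `2`-form. -/
def extDerivTwo (w : ∀ p : K s, T p →L[ℝ] T p →L[ℝ] ℝ) (X Y Z : ∀ p : K s, T p) (p : K s) : ℝ :=
  dirDeriv (fun q => w q (Y q) (Z q)) p (X p) - dirDeriv (fun q => w q (X q) (Z q)) p (Y p)
    + dirDeriv (fun q => w q (X q) (Y q)) p (Z p)
    - w p (bracket X Y p) (Z p) + w p (bracket X Z p) (Y p) - w p (bracket Y Z p) (X p)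

/-- The Nijenhuis tensor `N^J(X, Y) = [X, Y] + J[JX, Y] + J[X, JY] - [JX, JY]`. -/
def nijenhuis (J : ∀ p : K s, T p →L[ℝ] T p) (X Y : ∀ p : K s, T p) (p : K s) : T p :=
  bracket X Y p + J p (bracket (fun q => J q (X q)) Y p)
    + J p (bracket X (fun q => J q (Y q)) p)
    - bracket (fun q => J q (X q)) (fun q => J q (Y q)) p

variable (s) in
/-- Connections on the tangent bundle of `K^s`. In Mathlib's order of arguments, `(∇_X Y)(p)` is
`D Y p (X p)`. -/
abbrev Connection : Type :=
  CovariantDerivative 𝓘(ℝ, Model s) (Model s) (fun p : K s => T p)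

/-- The derivative `DY(p) · v` of the vector field `Y`, regarded as a map into the model space. -/
def fieldDeriv (Y : ∀ p : K s, T p) (p : K s) (v : T p) : Model s :=
  let Y' : K s → Model s := fun q => Y q
  mfderiv 𝓘(ℝ, Model s) 𝓘(ℝ, Model s) Y' p v

/-- `∇_X Y = DY · X - Γ(Y, X)`. -/
def IsTheConnection (Γ : K s → Model s →L[ℝ] Model s →L[ℝ] Model s) (D : Connection s) : Prop :=
  ∀ Y : ∀ p : K s, T p, IsSmoothField Y → ∀ (p : K s) (v : T p),
    D Y p v = fieldDeriv Y p v - Γ p (Y p) v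

/-- `∇ b = 0`, that is `X (b(Y, Z)) = b(∇_X Y, Z) + b(Y, ∇_X Z)`. -/
def IsParallelForm (D : Connection s) (b : ∀ p : K s, T p →L[ℝ] T p →L[ℝ] ℝ) : Prop :=
  ∀ X Y Z : ∀ p : K s, T p, IsSmoothField X → IsSmoothField Y → IsSmoothField Z → ∀ p : K s,
    dirDeriv (fun q => b q (Y q) (Z q)) p (X p) =
      b p (D Y p (X p)) (Z p) + b p (Y p) (D Z p (X p))

/-- `∇ J = 0`, that is `∇_X (J Y) = J (∇_X Y)`. -/
def IsParallelEndo (D : Connection s) (J : ∀ p : K s, T p →L[ℝ] T p) : Prop :=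
  ∀ X Y : ∀ p : K s, T p, IsSmoothField X → IsSmoothField Y → ∀ p : K s,
    D (fun q => J q (Y q)) p (X p) = J p (D Y p (X p))

end Structures

end HunterSaxton

end

open HunterSaxton HunterSaxton.K

/-!
Put `φ = id + h`, `m = φ_x`, and for a tangent vector `U = u ∘ φ` write `a = U₁ₓ/m = u_{1x} ∘ φ`
(`strain`) and `c = U₂ - ∫ U₂ m = π(u₂) ∘ φ` (`charge`). The change of variables `y = φ(x)` turns
the right-invariant definitions into
`g(U, V) = 1/4 ∫ m (a_U a_V + c_U c_V)`, `J U = (-∫₀ˣ m c_U, [a_U])`,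
`Γ(U, V) = 1/2 (∫₀ˣ m (F - ∫ m F), -[a_U c_V + c_U a_V])` with `F = a_U a_V + c_U c_V`,
while `ω(U, V) = 1/4 ∫ (U₁ₓ V₂ - U₂ V₁ₓ)` does not depend on the point. So `J` exchanges `a` and `c`
up to sign, `(a, c) ↦ (-c, a)`, which gives `J² = -1`, `g(J·, J·) = g` and `ω = g(J·, ·)`.

The composition `u ↦ u ∘ φ` has disappeared: the expressions are built from `m`, `1/m` and bounded
multilinear maps. Hence they are smooth in `h` once `H^{s-1}` is a Banach algebra in which positive
functions have a reciprocal, and reciprocals depend smoothly on the function. The product estimate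
`Sobolev.norm_mul_sq_le` has one factor in the Wiener norm `∑ |f̂(n)|`; it implies
`‖f²‖ ≲ ‖f‖ ‖f‖_W`, and from this that some power of the operator of multiplication by `f` is a
contraction when `|f| < 1` (`Sobolev.exists_norm_mulL_pow_lt_one`). A Neumann series then inverts
multiplication by any positive function (`Sobolev.isUnit_mulL`).

The derivative of `1/m` in the direction `W` is `-W₁ₓ/m²`. With this, `∇g = 0` and `∇J = 0` become
identities between functions on the circle, up to terms of integral zero (`Model.fderiv_metric`,
`Model.fderiv_complexStructure`). The rest is formal: `∇ω = 0` because `ω = g(J·, ·)`, and since the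
connection is torsion-free, `∇ω = 0` gives `dω = 0` and `∇J = 0` gives `N^J = 0`.

The charts with different winding numbers have disjoint domains, so no nontrivial coordinate change
occurs. Vector fields and tensors are therefore smooth exactly when they are smooth as maps into
fixed Banach spaces (`K.contMDiffAt_field_iff`, `K.contMDiff_endo`, `K.contMDiff_form`), and the Lie
bracket is the one of the chart (`K.bracket_eq`).
-/

noncomputable section

namespace HunterSaxton

open scoped ENNReal

/-! ### Fourier coefficients of products and derivatives -/

/-- Young's inequality `ℓ¹ * ℓ² ⊆ ℓ²` on `ℤ`. -/
theorem tsum_convolution_sq_le (a b : ℤ → ℝ≥0∞) :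
    ∑' n, (∑' k, a k * b (n - k)) ^ 2 ≤ (∑' k, a k) ^ 2 * ∑' k, b k ^ 2 := by
  have cs : ∀ x : ℤ → ℝ≥0∞, (∑' k, a k * x k) ^ 2 ≤ (∑' k, a k) * ∑' k, a k * x k ^ 2 := by
    intro x
    have h1 : ∑' k, a k * x k ≤
        (∑' k, a k) ^ (1 / 2 : ℝ) * (∑' k, a k * x k ^ 2) ^ (1 / 2 : ℝ) := by
      rw [ENNReal.tsum_eq_iSup_sum]
      refine iSup_le fun t => ?_
      have h := ENNReal.inner_le_weight_mul_Lp_of_nonneg t (p := 2) (by norm_num) a x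
      have e : (1 - (2 : ℝ)⁻¹) = 1 / 2 := by norm_num
      rw [e, ← one_div] at h
      refine h.trans (mul_le_mul' ?_ ?_)
      · exact ENNReal.rpow_le_rpow (ENNReal.sum_le_tsum t) (by norm_num)
      · refine ENNReal.rpow_le_rpow ?_ (by norm_num)
        simp only [ENNReal.rpow_ofNat]
        exact ENNReal.sum_le_tsum t
    have sq : ∀ y : ℝ≥0∞, (y ^ (1 / 2 : ℝ)) ^ 2 = y := by
      intro y
      rw [← ENNReal.rpow_natCast, ← ENNReal.rpow_mul]
      norm_num
    calc (∑' k, a k * x k) ^ 2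
        ≤ ((∑' k, a k) ^ (1 / 2 : ℝ) * (∑' k, a k * x k ^ 2) ^ (1 / 2 : ℝ)) ^ 2 := by gcongr
      _ = _ := by rw [mul_pow, sq, sq]
  calc ∑' n, (∑' k, a k * b (n - k)) ^ 2
      ≤ ∑' n, (∑' k, a k) * ∑' k, a k * b (n - k) ^ 2 :=
        ENNReal.tsum_le_tsum fun n => cs fun k => b (n - k)
    _ = (∑' k, a k) * ∑' k, ∑' n, a k * b (n - k) ^ 2 := by
        rw [ENNReal.tsum_mul_left, ENNReal.tsum_comm]
    _ = (∑' k, a k) * ∑' k, a k * ∑' n, b n ^ 2 := by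
        congr 1
        refine tsum_congr fun k => ?_
        rw [ENNReal.tsum_mul_left]
        congr 1
        exact (Equiv.subRight k).tsum_eq fun n => b n ^ 2
    _ = _ := by rw [ENNReal.tsum_mul_right, sq, mul_assoc]

/-- If the Fourier series of `F` converges absolutely, the Fourier coefficients of `F G` are the
convolution of those of `F` and `G`. -/
theorem hasSum_fourierCoeff_mul (F G : C(UnitAddCircle, ℂ)) (hF : Summable (fourierCoeff F))
    (n : ℤ) : HasSum (fun k => fourierCoeff F k * fourierCoeff G (n - k))
      (fourierCoeff (F * G) n) := by
  have hint : ∀ H : C(UnitAddCircle, ℂ), MeasureTheory.Integrable H AddCircle.haarAddCircle :=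
    fun H => H.continuous.integrable_of_hasCompactSupport (HasCompactSupport.of_compactSpace _)
  let Φ : ℤ → C(UnitAddCircle, ℂ) := fun k =>
    fourierCoeff F k • (fourier (-n) * (fourier k * G))
  have hn : ∀ k, ‖Φ k‖ ≤ ‖fourierCoeff F k‖ * ‖G‖ := by
    intro k
    rw [norm_smul]
    refine mul_le_mul_of_nonneg_left ?_ (norm_nonneg _)
    refine (norm_mul_le _ _).trans ?_
    rw [fourier_norm, one_mul]
    refine (norm_mul_le _ _).trans ?_
    rw [fourier_norm, one_mul]
  have h1 := MeasureTheory.hasSum_integral_of_summable_integral_norm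
    (μ := AddCircle.haarAddCircle) (F := fun k x => Φ k x) (fun k => hint (Φ k)) ?_
  · have e1 : (fun k => fourierCoeff F k * fourierCoeff G (n - k)) =
        fun k => ∫ x, Φ k x ∂AddCircle.haarAddCircle := by
      funext k
      simp only [Φ]
      rw [show fourierCoeff G (n - k) =
        ∫ t, fourier (-(n - k)) t • G t ∂AddCircle.haarAddCircle from rfl]
      rw [← MeasureTheory.integral_const_mul]
      refine MeasureTheory.integral_congr_ae (Filter.Eventually.of_forall fun x => ?_)
      simp only [ContinuousMap.smul_apply, ContinuousMap.mul_apply, smul_eq_mul]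
      rw [neg_sub, sub_eq_add_neg, fourier_add]
      ring
    have e2 : fourierCoeff (F * G) n =
        ∫ x, ∑' k, Φ k x ∂AddCircle.haarAddCircle := by
      rw [show fourierCoeff (F * G) n =
        ∫ t, fourier (-n) t • (F * G) t ∂AddCircle.haarAddCircle from rfl]
      refine MeasureTheory.integral_congr_ae (Filter.Eventually.of_forall fun x => ?_)
      have h2 := (has_pointwise_sum_fourier_series_of_summable hF x).mul_right
        (G x * fourier (-n) x)
      have h3 : HasSum (fun k => Φ k x) (F x * (G x * fourier (-n) x)) := by
        have e3 : (fun k => Φ k x) =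
            fun k => fourierCoeff F k • fourier k x * (G x * fourier (-n) x) := by
          funext k
          simp only [Φ, ContinuousMap.smul_apply, ContinuousMap.mul_apply, smul_eq_mul]
          ring
        rw [e3]
        exact h2
      simp only [h3.tsum_eq]
      simp only [ContinuousMap.mul_apply, smul_eq_mul]
      ring
    rw [e1, e2]
    exact h1
  · refine Summable.of_nonneg_of_le (fun k => by positivity) (fun k => ?_)
      (hF.norm.mul_right ‖G‖)
    refine le_trans ?_ (hn k)
    have := MeasureTheory.norm_integral_le_of_norm_le_const (μ := AddCircle.haarAddCircle)
      (f := fun x => ‖Φ k x‖) (C := ‖Φ k‖)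
      (Filter.Eventually.of_forall fun x => by simpa using (Φ k).norm_coe_le_norm x)
    refine (Real.le_norm_self _).trans (this.trans ?_)
    simp

/-- A real function on the circle, regarded as a complex one. -/
def complexify (f : C(UnitAddCircle, ℝ)) : C(UnitAddCircle, ℂ) :=
  ⟨fun x => (f x : ℂ), Complex.continuous_ofReal.comp f.continuous⟩

theorem norm_complexify (f : C(UnitAddCircle, ℝ)) (x : UnitAddCircle) :
    ‖complexify f x‖ = |f x| := by
  simp [complexify]

theorem weightedCoeff_eq (r : ℝ) (f : C(UnitAddCircle, ℝ)) (n : ℤ) :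
    weightedCoeff r f n =
      ((1 + (n : ℝ) ^ 2) ^ (r / 2) : ℝ) • fourierCoeff (complexify f) n := rfl

theorem complexify_mul (f g : C(UnitAddCircle, ℝ)) :
    complexify (f * g) = complexify f * complexify g := by
  ext x; simp [complexify]

/-- The Fourier coefficients of the derivative, by integration by parts. -/
theorem fourierCoeff_deriv (f f' : C(UnitAddCircle, ℝ))
    (h : ∀ x : ℝ, HasDerivAt (fun y : ℝ => f (y : UnitAddCircle)) (f' (x : UnitAddCircle)) x)
    (n : ℤ) :
    fourierCoeff (complexify f') n =
      2 * Real.pi * Complex.I * n * fourierCoeff (complexify f) n := by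
  rw [fourierCoeff_eq_intervalIntegral _ _ 0, fourierCoeff_eq_intervalIntegral _ _ 0]
  have hc : ∀ H : C(UnitAddCircle, ℂ), Continuous fun x : ℝ => H (x : UnitAddCircle) := fun H =>
    H.continuous.comp (AddCircle.continuous_mk' 1)
  have hp := intervalIntegral.integral_mul_deriv_eq_deriv_mul (a := 0) (b := 1)
    (u := fun x : ℝ => fourier (-n) (x : UnitAddCircle))
    (v := fun x : ℝ => complexify f (x : UnitAddCircle))
    (u' := fun x : ℝ => -2 * Real.pi * Complex.I * n / (1 : ℝ) * fourier (-n) (x : UnitAddCircle))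
    (v' := fun x : ℝ => complexify f' (x : UnitAddCircle))
    (fun x _ => hasDerivAt_fourier_neg 1 n x)
    (fun x _ => (h x).ofReal_comp)
    ((continuous_const.mul (hc _)).intervalIntegrable _ _)
    ((hc _).intervalIntegrable _ _)
  have e0 : ((1 : ℝ) : UnitAddCircle) = ((0 : ℝ) : UnitAddCircle) := by simp
  simp only [e0, sub_self, zero_sub] at hp
  simp only [smul_eq_mul, zero_add, div_one, one_smul]
  refine hp.trans ?_
  rw [← intervalIntegral.integral_neg, ← intervalIntegral.integral_const_mul]
  refine intervalIntegral.integral_congr fun x _ => ?_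
  simp only [Complex.ofReal_one, div_one]
  ring

/-- The continuous function on the circle given by a continuous `1`-periodic function. -/
def ofPeriodic (f : ℝ → ℝ) (hp : Function.Periodic f 1) (hc : Continuous f) :
    C(UnitAddCircle, ℝ) :=
  ⟨hp.lift, continuous_coinduced_dom.mpr hc⟩

theorem ofPeriodic_coe (f : ℝ → ℝ) (hp : Function.Periodic f 1) (hc : Continuous f) (x : ℝ) :
    ofPeriodic f hp hc (x : UnitAddCircle) = f x := hp.lift_coe x

/-- Bessel's equality for continuous functions gives a bound by the supremum norm. -/
theorem tsum_fourierCoeff_sq_le (F : C(UnitAddCircle, ℂ)) :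
    Summable (fun n => ‖fourierCoeff F n‖ ^ 2) ∧ ∑' n, ‖fourierCoeff F n‖ ^ 2 ≤ ‖F‖ ^ 2 := by
  have h := hasSum_sq_fourierCoeff (ContinuousMap.toLp 2 AddCircle.haarAddCircle ℂ F)
  simp only [fourierCoeff_toLp] at h
  refine ⟨h.summable, ?_⟩
  rw [h.tsum_eq]
  have e : ∫ t, ‖(ContinuousMap.toLp 2 AddCircle.haarAddCircle ℂ F :
      UnitAddCircle → ℂ) t‖ ^ 2 ∂AddCircle.haarAddCircle =
      ∫ t, ‖F t‖ ^ 2 ∂(AddCircle.haarAddCircle (T := 1)) := by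
    refine MeasureTheory.integral_congr_ae ?_
    filter_upwards [ContinuousMap.coeFn_toLp (p := 2) (𝕜 := ℂ)
      (AddCircle.haarAddCircle (T := 1)) F] with t ht
    rw [ht]
  rw [e]
  have := MeasureTheory.norm_integral_le_of_norm_le_const (μ := AddCircle.haarAddCircle (T := 1))
      (f := fun x => ‖F x‖ ^ 2) (C := ‖F‖ ^ 2)
      (Filter.Eventually.of_forall fun x => by
        simpa using pow_le_pow_left₀ (norm_nonneg _) (F.norm_coe_le_norm x) 2)
  refine (Real.le_norm_self _).trans (this.trans ?_)
  simp

end HunterSaxton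

namespace HunterSaxton

open scoped ENNReal

/-! ### `H^r(S¹)` as a Banach algebra -/

instance fact_three_halves (s : ℝ) [h : Fact (5 / 2 < s)] : Fact (3 / 2 < s) :=
  ⟨by linarith [h.out]⟩

instance fact_three_halves_sub_one (s : ℝ) [h : Fact (5 / 2 < s)] : Fact (3 / 2 < s - 1) :=
  ⟨by linarith [h.out]⟩

/-- The norm `∑ |f̂(n)|` of the Wiener algebra. -/
def wienerNorm (f : C(UnitAddCircle, ℝ)) : ℝ := ∑' n, ‖fourierCoeff (complexify f) n‖

theorem wienerNorm_nonneg (f : C(UnitAddCircle, ℝ)) : 0 ≤ wienerNorm f :=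
  tsum_nonneg fun _ => norm_nonneg _

theorem mem_sobolevSubmodule_iff_summable {r : ℝ} {f : C(UnitAddCircle, ℝ)} :
    f ∈ sobolevSubmodule r ↔ Summable fun n => ‖weightedCoeff r f n‖ ^ 2 := by
  change Memℓp (weightedCoeff r f) 2 ↔ _
  rw [memℓp_gen_iff (by norm_num)]
  simp

theorem mem_sobolevSubmodule_iff_tsum {r : ℝ} {f : C(UnitAddCircle, ℝ)} :
    f ∈ sobolevSubmodule r ↔ ∑' n, ‖weightedCoeff r f n‖ₑ ^ 2 ≠ ⊤ := by
  rw [mem_sobolevSubmodule_iff_summable]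
  have e : ∀ n, ‖weightedCoeff r f n‖ₑ ^ 2 = ((‖weightedCoeff r f n‖₊ ^ 2 : NNReal) : ℝ≥0∞) := by
    intro n; rw [ENNReal.coe_pow]; rfl
  simp_rw [e]
  rw [ENNReal.tsum_coe_ne_top_iff_summable, ← NNReal.summable_coe]
  simp

namespace Sobolev

variable {r : ℝ}

theorem norm_sq_eq_tsum (f : Sobolev r) :
    ‖f‖ ^ 2 = ∑' n, ‖weightedCoeff r (toMap f) n‖ ^ 2 := by
  have h := lp.norm_rpow_eq_tsum (p := 2) (by norm_num) (toSeq f)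
  simp only [ENNReal.toReal_ofNat, Real.rpow_ofNat] at h
  exact h

theorem enorm_sq_eq_tsum (f : Sobolev r) :
    ENNReal.ofReal (‖f‖ ^ 2) = ∑' n, ‖weightedCoeff r (toMap f) n‖ₑ ^ 2 := by
  have hs : Summable fun n => ‖weightedCoeff r (toMap f) n‖ ^ 2 :=
    mem_sobolevSubmodule_iff_summable.1 f.2
  rw [norm_sq_eq_tsum, ENNReal.ofReal_tsum_of_nonneg (fun n => by positivity) hs]
  refine tsum_congr fun n => ?_
  rw [ENNReal.ofReal_pow (norm_nonneg _), ofReal_norm]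

/-- A function whose Fourier coefficients are dominated, with the weights, by those of an element
of a Sobolev space. -/
theorem mem_of_weightedCoeff_le {r' : ℝ} (f : C(UnitAddCircle, ℝ)) (g : Sobolev r') (c : ℝ)
    (h : ∀ n ≠ 0, ‖weightedCoeff r f n‖ ≤ c * ‖weightedCoeff r' (toMap g) n‖) :
    f ∈ sobolevSubmodule r := by
  rw [mem_sobolevSubmodule_iff_summable]
  have hg := (mem_sobolevSubmodule_iff_summable.1 g.2).mul_left (c ^ 2)
  refine Summable.of_norm_bounded_eventually hg ?_
  rw [Filter.eventually_cofinite]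
  refine (Set.finite_singleton (0 : ℤ)).subset fun n hn => ?_
  by_contra hne
  apply hn
  rw [Real.norm_of_nonneg (by positivity)]
  calc ‖weightedCoeff r f n‖ ^ 2 ≤ (c * ‖weightedCoeff r' (toMap g) n‖) ^ 2 :=
        pow_le_pow_left₀ (norm_nonneg _) (h n hne) 2
    _ = _ := mul_pow _ _ _

theorem norm_fourierCoeff_zero_le (f : Sobolev r) :
    ‖fourierCoeff (complexify (toMap f)) 0‖ ≤ ‖f‖ := by
  have h := lp.norm_apply_le_norm (p := 2) (by norm_num) (toSeq f) 0
  have e : toSeq f 0 = fourierCoeff (complexify (toMap f)) 0 := by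
    change weightedCoeff r (toMap f) 0 = _
    rw [weightedCoeff_eq]
    simp
  rw [e] at h
  exact h

theorem summable_fourierCoeff [hr : Fact (3 / 2 < r)] : ∃ C : ℝ, 0 < C ∧ ∀ f : Sobolev r,
    Summable (fun n => ‖fourierCoeff (complexify (toMap f)) n‖) ∧
      wienerNorm (toMap f) ≤ C * ‖f‖ := by
  obtain ⟨C, hC, h⟩ := summable_deriv hr.out
  refine ⟨C + 1, by linarith, fun f => ?_⟩
  obtain ⟨hs, hle⟩ := h f
  change Summable (fun n : ℤ => 2 * Real.pi * |(n : ℝ)| *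
    ‖fourierCoeff (complexify (toMap f)) n‖) at hs
  change ∑' n : ℤ, 2 * Real.pi * |(n : ℝ)| *
    ‖fourierCoeff (complexify (toMap f)) n‖ ≤ _ at hle
  have hdelta : HasSum (fun n : ℤ => if n = 0 then ‖f‖ else 0) ‖f‖ := hasSum_ite_eq 0 ‖f‖
  have hle' : ∀ n : ℤ, ‖fourierCoeff (complexify (toMap f)) n‖ ≤
      2 * Real.pi * |(n : ℝ)| * ‖fourierCoeff (complexify (toMap f)) n‖ +
        if n = 0 then ‖f‖ else 0 := by
    intro n
    by_cases hn : n = 0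
    · subst hn
      simpa using norm_fourierCoeff_zero_le f
    · rw [if_neg hn, add_zero]
      have h1 : (1 : ℝ) ≤ |(n : ℝ)| := by exact_mod_cast Int.one_le_abs hn
      have h2 : (1 : ℝ) ≤ 2 * Real.pi * |(n : ℝ)| := by nlinarith [Real.pi_gt_three]
      exact le_mul_of_one_le_left (norm_nonneg _) h2
  have hS := hs.add hdelta.summable
  have hsum : Summable (fun n => ‖fourierCoeff (complexify (toMap f)) n‖) :=
    Summable.of_nonneg_of_le (fun _ => norm_nonneg _) hle' hS
  refine ⟨hsum, (hsum.tsum_le_tsum hle' hS).trans ?_⟩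
  rw [hs.tsum_add hdelta.summable, hdelta.tsum_eq]
  linarith

theorem abs_le_wienerNorm [Fact (3 / 2 < r)] (f : Sobolev r) (x : UnitAddCircle) :
    |toMap f x| ≤ wienerNorm (toMap f) := by
  obtain ⟨C, -, h⟩ := summable_fourierCoeff (r := r)
  have hs := (h f).1
  have h1 := has_pointwise_sum_fourier_series_of_summable (f := complexify (toMap f)) hs.of_norm x
  have h2 := tsum_of_norm_bounded hs.hasSum
    (f := fun n => fourierCoeff (complexify (toMap f)) n • fourier n x) (fun n => by
      rw [norm_smul, fourier_apply, Circle.norm_coe, mul_one])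
  rw [h1.tsum_eq] at h2
  rwa [norm_complexify] at h2

variable (r) in
theorem exists_norm_toMap_le [Fact (3 / 2 < r)] : ∃ C : ℝ, 0 < C ∧ ∀ f : Sobolev r,
    ‖toMap f‖ ≤ C * ‖f‖ := by
  obtain ⟨C, hC, h⟩ := summable_fourierCoeff (r := r)
  refine ⟨C, hC, fun f => ?_⟩
  rw [ContinuousMap.norm_le _ (by positivity)]
  exact fun x => (abs_le_wienerNorm f x).trans (h f).2

/-- The embedding `H^r(S¹; ℝ) ⊆ C(S¹; ℝ)`. -/
def toMapL [Fact (3 / 2 < r)] : Sobolev r →L[ℝ] C(UnitAddCircle, ℝ) :=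
  toMap.mkContinuousOfExistsBound
    (let ⟨C, _, h⟩ := exists_norm_toMap_le r; ⟨C, h⟩)

theorem tendsto_fn [Fact (3 / 2 < r)] {ι : Type*} {l : Filter ι} {u : ι → Sobolev r}
    {f : Sobolev r} (h : Filter.Tendsto u l (𝓝 f)) (x : ℝ) :
    Filter.Tendsto (fun i => (u i).fn x) l (𝓝 (f.fn x)) :=
  ((continuous_eval_const (x : UnitAddCircle)).tendsto _).comp
    ((toMapL.continuous.tendsto f).comp h)

theorem isometry_toSeq : Isometry (toSeq (r := r)) :=
  AddMonoidHomClass.isometry_of_norm toSeq fun _ => rfl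

/-- The weighted Fourier coefficients of a Cauchy sequence converge in `ℓ²`, and the functions
converge uniformly; the first limit is the sequence of weighted coefficients of the second. -/
instance [Fact (3 / 2 < r)] : CompleteSpace (Sobolev r) := by
  refine Metric.complete_of_cauchySeq_tendsto fun u hu => ?_
  obtain ⟨f, hf⟩ := cauchySeq_tendsto_of_complete
    ((toMapL (r := r)).uniformContinuous.comp_cauchySeq hu)
  obtain ⟨a, ha⟩ := cauchySeq_tendsto_of_complete
    ((isometry_toSeq (r := r)).uniformContinuous.comp_cauchySeq hu)
  have hcoef : ∀ n, weightedCoeff r f n = a n := by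
    intro n
    have h1 : Filter.Tendsto (fun i => weightedCoeff r (toMap (u i)) n) Filter.atTop
        (𝓝 (a n)) := by
      have hc : Filter.Tendsto (fun i => (toSeq (u i) : ℤ → ℂ)) Filter.atTop
          (𝓝 (a : ℤ → ℂ)) := ((lp.uniformContinuous_coe).continuous.tendsto a).comp ha
      exact (tendsto_pi_nhds.1 hc) n
    have h2 : Filter.Tendsto (fun i => weightedCoeff r (toMap (u i)) n) Filter.atTop
        (𝓝 (weightedCoeff r f n)) := by
      simp only [weightedCoeff_eq]
      refine Filter.Tendsto.const_smul ?_ _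
      rw [tendsto_iff_norm_sub_tendsto_zero]
      have h3 : Filter.Tendsto (fun i => ‖toMap (u i) - f‖) Filter.atTop (𝓝 0) :=
        tendsto_iff_norm_sub_tendsto_zero.1 hf
      refine squeeze_zero (fun _ => norm_nonneg _) (fun i => ?_) h3
      have hint : ∀ H : C(UnitAddCircle, ℂ),
          MeasureTheory.Integrable H AddCircle.haarAddCircle := fun H =>
        H.continuous.integrable_of_hasCompactSupport (HasCompactSupport.of_compactSpace _)
      have e : fourierCoeff (complexify (toMap (u i))) n - fourierCoeff (complexify f) n =
          fourierCoeff (complexify (toMap (u i) - f)) n := by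
        have e1 : complexify (toMap (u i)) = complexify (toMap (u i) - f) + complexify f := by
          ext x; simp [complexify]
        have e2 := congrFun (fourierCoeff.add (hint (complexify (toMap (u i) - f)))
          (hint (complexify f))) n
        rw [e1]
        rw [ContinuousMap.coe_add, e2, Pi.add_apply, add_sub_cancel_right]
      rw [e]
      have := MeasureTheory.norm_integral_le_of_norm_le_const
        (μ := AddCircle.haarAddCircle (T := 1))
        (f := fun x => fourier (-n) x • complexify (toMap (u i) - f) x) (C := ‖toMap (u i) - f‖)
        (Filter.Eventually.of_forall fun x => by
          rw [norm_smul, fourier_apply, Circle.norm_coe, one_mul, norm_complexify]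
          exact (toMap (u i) - f).norm_coe_le_norm x)
      refine this.trans ?_
      simp
    exact tendsto_nhds_unique h2 h1
  have hmem : f ∈ sobolevSubmodule r := by
    change Memℓp (weightedCoeff r f) 2
    rw [show weightedCoeff r f = a from funext hcoef]
    exact a.2
  let F : Sobolev r := (⟨f, hmem⟩ : sobolevSubmodule r)
  have e : toSeq F = a := Subtype.ext (funext hcoef)
  refine ⟨F, ?_⟩
  rw [(isometry_toSeq (r := r)).isEmbedding.tendsto_nhds_iff, e]
  exact ha

/-- Peetre's inequality. -/
theorem weight_le (hr : 0 ≤ r) (a b : ℝ) :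
    (1 + (a + b) ^ 2) ^ (r / 2) ≤
      4 ^ (r / 2) * ((1 + a ^ 2) ^ (r / 2) + (1 + b ^ 2) ^ (r / 2)) := by
  have h0 : 0 ≤ r / 2 := by linarith
  have key : ∀ a b : ℝ, b ^ 2 ≤ a ^ 2 → (1 + (a + b) ^ 2) ^ (r / 2) ≤
      4 ^ (r / 2) * (1 + a ^ 2) ^ (r / 2) := by
    intro a b hab
    rw [← Real.mul_rpow (by norm_num) (by positivity)]
    refine Real.rpow_le_rpow (by positivity) ?_ h0
    nlinarith [sq_nonneg (a - b)]
  have p1 : 0 ≤ (1 + a ^ 2) ^ (r / 2) := by positivity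
  have p2 : 0 ≤ (1 + b ^ 2) ^ (r / 2) := by positivity
  have p3 : (0 : ℝ) ≤ 4 ^ (r / 2) := by positivity
  rcases le_total (b ^ 2) (a ^ 2) with h | h
  · refine (key a b h).trans (mul_le_mul_of_nonneg_left (by linarith) p3)
  · rw [add_comm a b]
    refine (key b a h).trans (mul_le_mul_of_nonneg_left (by linarith) p3)

/-- Peetre's inequality distributes the weight over the two factors of a convolution, and Young's
inequality bounds each of the two terms. -/
theorem tsum_weightedCoeff_mul_le [Fact (3 / 2 < r)] (f g : Sobolev r) :
    ∑' n, ‖weightedCoeff r (toMap f * toMap g) n‖ₑ ^ 2 ≤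
      ENNReal.ofReal (2 * (4 ^ (r / 2)) ^ 2 *
        (wienerNorm (toMap g) ^ 2 * ‖f‖ ^ 2 + wienerNorm (toMap f) ^ 2 * ‖g‖ ^ 2)) := by
  obtain ⟨_, -, hsum⟩ := summable_fourierCoeff (r := r)
  have hr : 0 ≤ r := by linarith [(Fact.out : 3 / 2 < r)]
  let W : ℤ → ℝ≥0∞ := fun n => ENNReal.ofReal ((1 + (n : ℝ) ^ 2) ^ (r / 2))
  let K : ℝ≥0∞ := ENNReal.ofReal (4 ^ (r / 2))
  let c : Sobolev r → ℤ → ℝ≥0∞ := fun f n => ‖fourierCoeff (complexify (toMap f)) n‖ₑ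
  let w : Sobolev r → ℤ → ℝ≥0∞ := fun f n => ‖weightedCoeff r (toMap f) n‖ₑ
  have hwW : ∀ (f : C(UnitAddCircle, ℝ)) n,
      ‖weightedCoeff r f n‖ₑ = W n * ‖fourierCoeff (complexify f) n‖ₑ := by
    intro f n
    rw [weightedCoeff_eq, enorm_smul, Real.enorm_of_nonneg (by positivity)]
  have hW : ∀ n k, W n ≤ K * (W k + W (n - k)) := by
    intro n k
    simp only [W, K]
    rw [← ENNReal.ofReal_add (by positivity) (by positivity),
      ← ENNReal.ofReal_mul (by positivity)]
    refine ENNReal.ofReal_le_ofReal ?_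
    have := weight_le hr (k : ℝ) (n - k : ℝ)
    rw [add_sub_cancel] at this
    push_cast
    exact this
  have hA : ∀ f : Sobolev r, ∑' k, c f k = ENNReal.ofReal (wienerNorm (toMap f)) := by
    intro f
    rw [wienerNorm, ENNReal.ofReal_tsum_of_nonneg (fun n => norm_nonneg _) (hsum f).1]
    exact tsum_congr fun n => (ofReal_norm _).symm
  have hpt : ∀ n, ‖weightedCoeff r (toMap f * toMap g) n‖ₑ ≤
      K * ((∑' k, c g k * w f (n - k)) + ∑' k, c f k * w g (n - k)) := by
    intro n
    have h1 := hasSum_fourierCoeff_mul (complexify (toMap f)) (complexify (toMap g))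
      (hsum f).1.of_norm n
    have h2 : ∑' k, c g k * w f (n - k) = ∑' k, w f k * c g (n - k) := by
      rw [← (Equiv.subLeft n).tsum_eq]
      refine tsum_congr fun k => ?_
      simp [mul_comm]
    rw [hwW, complexify_mul, ← h1.tsum_eq, h2, ← ENNReal.tsum_add, ← ENNReal.tsum_mul_left]
    refine (mul_le_mul' le_rfl enorm_tsum_le_tsum_enorm).trans ?_
    rw [← ENNReal.tsum_mul_left]
    refine ENNReal.tsum_le_tsum fun k => ?_
    rw [enorm_mul]
    simp only [w, hwW]
    calc W n * (c f k * c g (n - k)) ≤ K * (W k + W (n - k)) * (c f k * c g (n - k)) :=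
          mul_le_mul' (hW n k) le_rfl
      _ = _ := by simp only [c]; ring
  calc ∑' n, ‖weightedCoeff r (toMap f * toMap g) n‖ₑ ^ 2
      ≤ ∑' n, 2 * K ^ 2 * ((∑' k, c g k * w f (n - k)) ^ 2 +
          (∑' k, c f k * w g (n - k)) ^ 2) := by
        refine ENNReal.tsum_le_tsum fun n => ?_
        refine (pow_le_pow_left' (hpt n) 2).trans ?_
        have h2 : ∀ x y : ℝ≥0∞, (x + y) ^ 2 ≤ 2 * (x ^ 2 + y ^ 2) := fun x y => by
          have := ENNReal.rpow_add_le_mul_rpow_add_rpow x y (p := 2) (by norm_num)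
          rw [show (2 - 1 : ℝ) = 1 by norm_num] at this
          simpa using this
        rw [mul_pow]
        calc _ ≤ K ^ 2 * (2 * _) := mul_le_mul' le_rfl (h2 _ _)
          _ = _ := by ring
    _ ≤ 2 * K ^ 2 * ((∑' k, c g k) ^ 2 * (∑' k, w f k ^ 2) +
          (∑' k, c f k) ^ 2 * ∑' k, w g k ^ 2) := by
        rw [ENNReal.tsum_mul_left, ENNReal.tsum_add]
        exact mul_le_mul' le_rfl
          (add_le_add (tsum_convolution_sq_le _ _) (tsum_convolution_sq_le _ _))
    _ = _ := by
        have n1 := wienerNorm_nonneg (toMap f)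
        have n2 := wienerNorm_nonneg (toMap g)
        rw [hA, hA, ← enorm_sq_eq_tsum, ← enorm_sq_eq_tsum, ← ENNReal.ofReal_pow n1,
          ← ENNReal.ofReal_pow n2, ← ENNReal.ofReal_mul (by positivity),
          ← ENNReal.ofReal_mul (by positivity), ← ENNReal.ofReal_add (by positivity)
          (by positivity), ← ENNReal.ofReal_pow (by positivity),
          show (2 : ℝ≥0∞) = ENNReal.ofReal 2 by simp, ← ENNReal.ofReal_mul (by positivity),
          ← ENNReal.ofReal_mul (by positivity)]

theorem mul_mem [Fact (3 / 2 < r)] (f g : Sobolev r) : toMap f * toMap g ∈ sobolevSubmodule r :=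
  mem_sobolevSubmodule_iff_tsum.2
    (ne_top_of_le_ne_top ENNReal.ofReal_ne_top (tsum_weightedCoeff_mul_le f g))

/-- The pointwise product. -/
def mul [Fact (3 / 2 < r)] (f g : Sobolev r) : Sobolev r :=
  (⟨toMap f * toMap g, mul_mem f g⟩ : sobolevSubmodule r)

theorem fn_mul [Fact (3 / 2 < r)] (f g : Sobolev r) (x : ℝ) :
    (mul f g).fn x = f.fn x * g.fn x := rfl

theorem toMap_mul [Fact (3 / 2 < r)] (f g : Sobolev r) :
    toMap (mul f g) = toMap f * toMap g := rfl

/-- Only one of the two factors is measured in the strong norm. -/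
theorem norm_mul_sq_le [Fact (3 / 2 < r)] (f g : Sobolev r) :
    ‖mul f g‖ ^ 2 ≤ 2 * (4 ^ (r / 2)) ^ 2 *
      (wienerNorm (toMap g) ^ 2 * ‖f‖ ^ 2 + wienerNorm (toMap f) ^ 2 * ‖g‖ ^ 2) := by
  have h := tsum_weightedCoeff_mul_le f g
  rw [← toMap_mul, ← enorm_sq_eq_tsum] at h
  exact (ENNReal.ofReal_le_ofReal_iff (by positivity)).1 h

variable (r) in
theorem exists_norm_mul_le [Fact (3 / 2 < r)] : ∃ C : ℝ, 0 < C ∧ ∀ f g : Sobolev r,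
    ‖mul f g‖ ≤ C * ‖f‖ * ‖g‖ := by
  obtain ⟨C, hC, h⟩ := summable_fourierCoeff (r := r)
  refine ⟨2 * 4 ^ (r / 2) * C, by positivity, fun f g => ?_⟩
  refine abs_le_of_sq_le_sq' ?_ (by positivity) |>.2
  refine (norm_mul_sq_le f g).trans ?_
  have hf : wienerNorm (toMap f) ^ 2 ≤ (C * ‖f‖) ^ 2 :=
    pow_le_pow_left₀ (wienerNorm_nonneg _) (h f).2 2
  have hg : wienerNorm (toMap g) ^ 2 ≤ (C * ‖g‖) ^ 2 :=
    pow_le_pow_left₀ (wienerNorm_nonneg _) (h g).2 2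
  calc _ ≤ 2 * ((4 : ℝ) ^ (r / 2)) ^ 2 * ((C * ‖g‖) ^ 2 * ‖f‖ ^ 2 + (C * ‖f‖) ^ 2 * ‖g‖ ^ 2) := by
        gcongr
    _ = _ := by ring

/-- Multiplication as a bounded bilinear map. -/
def mulL [Fact (3 / 2 < r)] : Sobolev r →L[ℝ] Sobolev r →L[ℝ] Sobolev r :=
  LinearMap.mkContinuous₂
    (LinearMap.mk₂ ℝ mul
      (fun f f' g => fn_injective (funext fun x => by simp only [fn_mul, fn_add]; ring))
      (fun c f g => fn_injective (funext fun x => by simp only [fn_mul, fn_smul]; ring))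
      (fun f g g' => fn_injective (funext fun x => by simp only [fn_mul, fn_add]; ring))
      (fun c f g => fn_injective (funext fun x => by simp only [fn_mul, fn_smul]; ring)))
    (exists_norm_mul_le r).choose (exists_norm_mul_le r).choose_spec.2

theorem mulL_apply [Fact (3 / 2 < r)] (f g : Sobolev r) : mulL f g = mul f g := rfl

theorem const_mem (c : ℝ) : ContinuousMap.const UnitAddCircle c ∈ sobolevSubmodule r := by
  refine mem_of_weightedCoeff_le _ (0 : Sobolev r) 0 fun n hn => ?_
  have h := fourierCoeff_deriv (ContinuousMap.const UnitAddCircle c) 0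
    (fun x => by simpa using hasDerivAt_const x c) n
  have h0 : fourierCoeff (complexify 0) n = 0 := by simp [fourierCoeff, complexify]
  have hne : (2 * Real.pi * Complex.I * n : ℂ) ≠ 0 := by
    simp [Real.pi_ne_zero, hn]
  rw [h0, eq_comm, mul_eq_zero] at h
  rw [weightedCoeff_eq, h.resolve_left hne]
  simp

variable (r) in
/-- The constant functions. -/
def const (c : ℝ) : Sobolev r :=
  (⟨ContinuousMap.const UnitAddCircle c, const_mem c⟩ : sobolevSubmodule r)

theorem fn_const (c x : ℝ) : (const r c).fn x = c := rfl

end Sobolev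

end HunterSaxton

namespace HunterSaxton

namespace Sobolev

variable {r : ℝ}

/-! ### Inversion of positive functions -/

theorem continuous_deriv_fn [hr : Fact (3 / 2 < r)] (f : Sobolev r) : Continuous (deriv f.fn) := by
  obtain ⟨C, -, h⟩ := exists_deriv_bound hr.out
  exact (h f).2.1

theorem differentiable_fn [hr : Fact (3 / 2 < r)] (f : Sobolev r) : Differentiable ℝ f.fn := by
  obtain ⟨C, -, h⟩ := exists_deriv_bound hr.out
  exact (h f).1

theorem periodic_deriv_fn (f : Sobolev r) : Function.Periodic (deriv f.fn) 1 := by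
  intro x
  have e : (fun y => f.fn (y + 1)) = f.fn := funext f.fn_periodic
  rw [← deriv_comp_add_const, e]

/-- The derivative, as a continuous function on the circle. -/
def derivMap [Fact (3 / 2 < r)] (f : Sobolev r) : C(UnitAddCircle, ℝ) :=
  ofPeriodic (deriv f.fn) f.periodic_deriv_fn f.continuous_deriv_fn

theorem derivMap_coe [Fact (3 / 2 < r)] (f : Sobolev r) (x : ℝ) :
    derivMap f (x : UnitAddCircle) = deriv f.fn x := ofPeriodic_coe _ _ _ x

theorem hasDerivAt_derivMap [Fact (3 / 2 < r)] (f : Sobolev r) (x : ℝ) :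
    HasDerivAt (fun y : ℝ => toMap f (y : UnitAddCircle)) (derivMap f (x : UnitAddCircle)) x := by
  rw [derivMap_coe]
  exact (f.differentiable_fn x).hasDerivAt

/-- The Wiener norm is controlled by the `C¹` norm. -/
theorem exists_wienerNorm_le : ∃ C : ℝ, 0 < C ∧ ∀ f f' : C(UnitAddCircle, ℝ),
    (∀ x : ℝ, HasDerivAt (fun y : ℝ => f (y : UnitAddCircle)) (f' (x : UnitAddCircle)) x) →
      wienerNorm f ≤ ‖f‖ + C * ‖f'‖ := by
  let w : ℤ → ℝ := fun n => (2 * Real.pi * |(n : ℝ)|)⁻¹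
  have hw0 : ∀ n, 0 ≤ w n := fun n => by positivity
  have hw : Summable fun n => w n ^ (2 : ℝ) := by
    have h1 : Summable fun n : ℤ => ((2 * Real.pi) ^ 2)⁻¹ * |(n : ℝ)| ^ (-(2 : ℝ)) :=
      (Real.summable_abs_int_rpow (b := 2) (by norm_num)).mul_left _
    convert h1 using 2 with n
    simp only [w, Real.rpow_ofNat]
    rw [Real.rpow_neg (abs_nonneg _), Real.rpow_ofNat, inv_pow, mul_pow, mul_inv]
  let C : ℝ := (∑' n, w n ^ (2 : ℝ)) ^ (1 / (2 : ℝ)) + 1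
  have hC0 : 0 ≤ ∑' n, w n ^ (2 : ℝ) := tsum_nonneg fun n => by positivity
  refine ⟨C, by positivity, fun f f' hf => ?_⟩
  have nrm : ∀ f : C(UnitAddCircle, ℝ), ‖complexify f‖ ≤ ‖f‖ := fun f => by
    rw [ContinuousMap.norm_le _ (norm_nonneg _)]
    exact fun x => (norm_complexify f x).trans_le (f.norm_coe_le_norm x)
  obtain ⟨hs, hle⟩ := tsum_fourierCoeff_sq_le (complexify f')
  have hs' : Summable fun n => ‖fourierCoeff (complexify f') n‖ ^ (2 : ℝ) := by simpa using hs
  obtain ⟨k1, k2⟩ := Real.summable_and_inner_le_Lp_mul_Lq_tsum_of_nonneg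
    Real.HolderConjugate.two_two hw0
    (fun n => norm_nonneg (fourierCoeff (complexify f') n)) hw hs'
  have hdelta : HasSum (fun n : ℤ => if n = 0 then ‖f‖ else 0) ‖f‖ := hasSum_ite_eq 0 ‖f‖
  have hpt : ∀ n : ℤ, ‖fourierCoeff (complexify f) n‖ ≤ (if n = 0 then ‖f‖ else 0) +
      w n * ‖fourierCoeff (complexify f') n‖ := by
    intro n
    by_cases hn : n = 0
    · subst hn
      have := MeasureTheory.norm_integral_le_of_norm_le_const
        (μ := AddCircle.haarAddCircle (T := 1))
        (f := fun x => fourier (-0) x • complexify f x) (C := ‖f‖)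
        (Filter.Eventually.of_forall fun x => by
          rw [norm_smul, fourier_apply, Circle.norm_coe, one_mul, norm_complexify]
          exact f.norm_coe_le_norm x)
      have h2 : ‖fourierCoeff (complexify f) 0‖ ≤ ‖f‖ := this.trans (by simp)
      simpa [w] using h2
    · have hn' : 0 < |(n : ℝ)| := by positivity
      rw [if_neg hn, zero_add, fourierCoeff_deriv f f' hf]
      simp only [w, norm_mul, Complex.norm_I, Complex.norm_intCast, Complex.norm_ofNat, mul_one,
        Complex.norm_real, Real.norm_of_nonneg Real.pi_pos.le]
      rw [inv_mul_cancel_left₀ (by positivity)]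
  have hS := hdelta.summable.add k1
  have h3 : wienerNorm f ≤ _ :=
    (Summable.of_nonneg_of_le (fun _ => norm_nonneg _) hpt hS).tsum_le_tsum hpt hS
  rw [hdelta.summable.tsum_add k1, hdelta.tsum_eq] at h3
  refine h3.trans (add_le_add le_rfl (k2.trans ?_))
  refine mul_le_mul (by simp [C]) ?_ (by positivity) (by positivity)
  have h4 : ∑' n, ‖fourierCoeff (complexify f') n‖ ^ (2 : ℝ) ≤ ‖f'‖ ^ 2 := by
    simp only [Real.rpow_ofNat]
    exact hle.trans (pow_le_pow_left₀ (norm_nonneg _) (nrm f') 2)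
  calc _ ≤ (‖f'‖ ^ 2) ^ (1 / (2 : ℝ)) :=
        Real.rpow_le_rpow (tsum_nonneg fun n => by positivity) h4 (by norm_num)
    _ = ‖f'‖ := by rw [← Real.sqrt_eq_rpow, Real.sqrt_sq (norm_nonneg _)]

/-- The powers `fⁿ` in `H^r(S¹)`. -/
def power [Fact (3 / 2 < r)] (f : Sobolev r) (n : ℕ) : Sobolev r := (mulL f ^ n) (const r 1)

theorem fn_power [Fact (3 / 2 < r)] (f : Sobolev r) (n : ℕ) (x : ℝ) :
    (power f n).fn x = f.fn x ^ n := by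
  induction n with
  | zero => simp [power, fn_const]
  | succ n ih =>
    rw [power, pow_succ', pow_succ', ← ih]
    rfl

theorem mulL_power [Fact (3 / 2 < r)] (f : Sobolev r) (n : ℕ) : mulL (power f n) = mulL f ^ n := by
  induction n with
  | zero =>
    ext1 g
    exact fn_injective (funext fun x => by simp [mulL_apply, fn_mul, fn_power])
  | succ n ih =>
    rw [pow_succ', ← ih]
    ext1 g
    exact fn_injective (funext fun x => by
      simp [mulL_apply, fn_mul, fn_power, pow_succ', mul_assoc])

theorem norm_toMap_le_of (f : Sobolev r) {c : ℝ} (hc : 0 ≤ c) (h : ∀ x, |f.fn x| ≤ c) :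
    ‖toMap f‖ ≤ c := by
  rw [ContinuousMap.norm_le _ hc]
  intro x
  obtain ⟨y, rfl⟩ := QuotientAddGroup.mk_surjective x
  exact h y

theorem tendsto_wienerNorm_power [Fact (3 / 2 < r)] (f : Sobolev r) (hf : ‖toMap f‖ < 1) :
    Filter.Tendsto (fun n => wienerNorm (toMap (power f n))) Filter.atTop (𝓝 0) := by
  obtain ⟨C, hC, hle⟩ := exists_wienerNorm_le
  rw [← Filter.tendsto_add_atTop_iff_nat 1]
  set θ := ‖toMap f‖ with hθ
  have hθ0 : 0 ≤ θ := norm_nonneg _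
  have hb : ∀ n, wienerNorm (toMap (power f (n + 1))) ≤
      θ ^ n + C * ‖derivMap f‖ * (n * θ ^ n + θ ^ n) := by
    intro n
    have h1 : ‖toMap (power f (n + 1))‖ ≤ θ ^ n := by
      refine norm_toMap_le_of _ (by positivity) fun x => ?_
      rw [fn_power, abs_pow]
      refine (pow_le_pow_left₀ (abs_nonneg _) (f.fn_bounded x) _).trans ?_
      exact pow_le_pow_of_le_one hθ0 hf.le (Nat.le_succ n)
    have h2 : ‖derivMap (power f (n + 1))‖ ≤ ‖derivMap f‖ * (n * θ ^ n + θ ^ n) := by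
      rw [ContinuousMap.norm_le _ (by positivity)]
      intro x
      obtain ⟨y, rfl⟩ := QuotientAddGroup.mk_surjective x
      have e : (power f (n + 1)).fn = fun z => f.fn z ^ (n + 1) := funext (fn_power f _)
      have e2 : derivMap (power f (n + 1)) (y : UnitAddCircle) =
          ((n + 1 : ℕ) : ℝ) * f.fn y ^ n * derivMap f (y : UnitAddCircle) := by
        rw [derivMap_coe, derivMap_coe, e]
        have := ((f.differentiable_fn y).hasDerivAt.pow (n + 1)).deriv
        rw [show (fun z => f.fn z ^ (n + 1)) = f.fn ^ (n + 1) from rfl]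
        simpa using this
      change ‖derivMap (power f (n + 1)) (y : UnitAddCircle)‖ ≤ _
      rw [e2, norm_mul, norm_mul, mul_comm]
      refine mul_le_mul ((derivMap f).norm_coe_le_norm _) ?_ (by positivity) (norm_nonneg _)
      rw [norm_pow, Real.norm_of_nonneg (by positivity)]
      have := pow_le_pow_left₀ (abs_nonneg _) (f.fn_bounded y) n
      push_cast
      rw [Real.norm_eq_abs]
      nlinarith [(Nat.cast_nonneg n : (0 : ℝ) ≤ n)]
    refine (hle _ _ (hasDerivAt_derivMap (power f (n + 1)))).trans ?_
    rw [mul_assoc]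
    exact add_le_add h1 (mul_le_mul_of_nonneg_left h2 hC.le)
  refine squeeze_zero (fun n => wienerNorm_nonneg _) hb ?_
  have t1 := tendsto_pow_atTop_nhds_zero_of_lt_one hθ0 hf
  have t2 := tendsto_self_mul_const_pow_of_lt_one hθ0 hf
  simpa using t1.add ((t2.add t1).const_mul (C * ‖derivMap f‖))

/-- As `‖g²‖_r` is bounded by `‖g‖_r` times the Wiener norm of `g`, the norms of the powers of `f`
in `H^r` tend to zero along the exponents `2^k N` once `|f| < 1`. -/
theorem exists_norm_mulL_pow_lt_one [Fact (3 / 2 < r)] (f : Sobolev r) (hf : ‖toMap f‖ < 1) :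
    ∃ n : ℕ, ‖mulL f ^ n‖ < 1 := by
  set K : ℝ := 4 * 4 ^ (r / 2)
  have hK : 0 < K := by positivity
  obtain ⟨N, hN⟩ := Filter.eventually_atTop.1
    ((tendsto_order.1 (tendsto_wienerNorm_power f hf)).2 (1 / (2 * K)) (by positivity))
  have hstep : ∀ n ≥ N, ‖power f (2 * n)‖ ≤ 1 / 2 * ‖power f n‖ := by
    intro n hn
    have e : power f (2 * n) = mul (power f n) (power f n) :=
      fn_injective (funext fun x => by rw [fn_mul, fn_power, fn_power]; ring)
    refine abs_le_of_sq_le_sq' ?_ (by positivity) |>.2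
    rw [e]
    refine (norm_mul_sq_le _ _).trans ?_
    have h1 : K * wienerNorm (toMap (power f n)) ≤ 1 / 2 := by
      have := (hN n hn).le
      calc _ ≤ K * (1 / (2 * K)) := mul_le_mul_of_nonneg_left this hK.le
        _ = 1 / 2 := by field_simp
    have h0 : 0 ≤ K * wienerNorm (toMap (power f n)) :=
      mul_nonneg hK.le (wienerNorm_nonneg _)
    have h2 : (K * wienerNorm (toMap (power f n))) ^ 2 ≤ (1 / 2) ^ 2 := pow_le_pow_left₀ h0 h1 2
    calc _ = 1 / 4 * (K * wienerNorm (toMap (power f n))) ^ 2 * ‖power f n‖ ^ 2 := by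
          simp only [K]; ring
      _ ≤ (1 / 2) ^ 2 * ‖power f n‖ ^ 2 := by
          refine mul_le_mul_of_nonneg_right ?_ (by positivity)
          nlinarith [sq_nonneg (K * wienerNorm (toMap (power f n)))]
      _ = _ := by ring
  have hgeom : ∀ k : ℕ, ‖power f (2 ^ k * N)‖ ≤ (1 / 2) ^ k * ‖power f N‖ := by
    intro k
    induction k with
    | zero => simp
    | succ k ih =>
      have := hstep (2 ^ k * N) (Nat.le_mul_of_pos_left N (by positivity))
      rw [← mul_assoc, ← pow_succ'] at this
      refine this.trans ?_
      rw [pow_succ', mul_assoc]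
      exact mul_le_mul_of_nonneg_left ih (by norm_num)
  have ht : Filter.Tendsto
      (fun k : ℕ => ‖(mulL : Sobolev r →L[ℝ] _)‖ * ((1 / 2) ^ k * ‖power f N‖))
      Filter.atTop (𝓝 0) := by
    have := (tendsto_pow_atTop_nhds_zero_of_lt_one (r := (1 / 2 : ℝ)) (by norm_num)
      (by norm_num)).mul_const ‖power f N‖
    simpa using this.const_mul ‖(mulL : Sobolev r →L[ℝ] _)‖
  obtain ⟨k, hk⟩ := ((tendsto_order.1 ht).2 1 one_pos).exists
  refine ⟨2 ^ k * N, ?_⟩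
  rw [← mulL_power]
  refine (ContinuousLinearMap.le_opNorm _ _).trans_lt (lt_of_le_of_lt ?_ hk)
  exact mul_le_mul_of_nonneg_left (hgeom k) (norm_nonneg _)

/-- A positive `f` is `M (1 - g)` with `|g| < 1`, and `1 - g` divides `1 - gⁿ`, which is invertible
for a suitable `n`. -/
theorem isUnit_mulL [Fact (3 / 2 < r)] (f : Sobolev r) (hf : ∀ x, 0 < f.fn x) :
    IsUnit (mulL f) := by
  set M : ℝ := ‖toMap f‖ + 1
  have hM : 0 < M := by positivity
  let g : Sobolev r := const r 1 - M⁻¹ • f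
  have hg : ‖toMap g‖ < 1 := by
    rw [ContinuousMap.norm_lt_iff _ one_pos]
    intro x
    obtain ⟨y, rfl⟩ := QuotientAddGroup.mk_surjective x
    change |g.fn y| < 1
    have h1 : M⁻¹ * f.fn y < 1 := by
      rw [inv_mul_lt_iff₀ hM, mul_one]
      have := (le_abs_self _).trans (f.fn_bounded y)
      simp only [M]
      linarith
    have h2 : 0 < M⁻¹ * f.fn y := mul_pos (inv_pos.2 hM) (hf y)
    simp only [g, fn_sub, fn_const, fn_smul]
    rw [abs_lt]
    constructor <;> linarith
  obtain ⟨n, hn⟩ := exists_norm_mulL_pow_lt_one g hg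
  have h1 : IsUnit (1 - mulL g ^ n) := isUnit_one_sub_of_norm_lt_one hn
  have h2 : IsUnit (1 - mulL g) := by
    have e := mul_neg_geom_sum (mulL g) n
    have hc : Commute (1 - mulL g) (∑ i ∈ Finset.range n, mulL g ^ i) :=
      (mul_neg_geom_sum (mulL g) n).trans (geom_sum_mul_neg (mulL g) n).symm
    rw [← e, hc.isUnit_mul_iff] at h1
    exact h1.1
  have e : mulL f = (Units.mk0 M hM.ne') • (1 - mulL g) := by
    ext1 u
    refine fn_injective (funext fun x => ?_)
    change _ = (M • (u - mul g u)).fn x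
    simp only [mulL_apply, fn_mul, fn_smul, fn_sub, g, fn_const]
    field_simp
    ring
  rw [e]
  exact h2.smul _

/-- The reciprocal `1/f`, as the image of `1` under the inverse of multiplication by `f`. It is `0`
if this operator is not invertible. -/
def recip [Fact (3 / 2 < r)] (f : Sobolev r) : Sobolev r := Ring.inverse (mulL f) (const r 1)

theorem fn_recip [Fact (3 / 2 < r)] (f : Sobolev r) (hf : ∀ x, 0 < f.fn x) (x : ℝ) :
    (recip f).fn x = (f.fn x)⁻¹ := by
  have h := congrArg (fun A : Sobolev r →L[ℝ] Sobolev r => (A (const r 1)).fn x)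
    (Ring.mul_inverse_cancel _ (isUnit_mulL f hf))
  have h' : f.fn x * (recip f).fn x = 1 := h
  exact eq_inv_of_mul_eq_one_right h'

theorem contDiffAt_recip [Fact (3 / 2 < r)] (f : Sobolev r) (hf : ∀ x, 0 < f.fn x) {n : ℕ∞ω} :
    ContDiffAt ℝ n (recip (r := r)) f := by
  obtain ⟨u, hu⟩ := isUnit_mulL f hf
  have h1 : ContDiffAt ℝ n (fun g : Sobolev r => Ring.inverse (mulL g)) f := by
    have h0 : ContDiffAt ℝ n (fun g : Sobolev r => mulL g) f :=
      (ContinuousLinearMap.contDiff _).contDiffAt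
    refine ContDiffAt.comp (g := Ring.inverse) f ?_ h0
    rw [← hu]
    exact contDiffAt_ringInverse ℝ u
  exact h1.clm_apply contDiffAt_const

end Sobolev

end HunterSaxton

namespace HunterSaxton

namespace Sobolev

variable {r : ℝ}

/-! ### Integration and differentiation as bounded operators -/

theorem intervalIntegrable_fn (f : Sobolev r) (a b : ℝ) :
    IntervalIntegrable f.fn MeasureTheory.volume a b := f.fn_continuous.intervalIntegrable a b

/-- The mean value `∫ f dx`. -/
def intL [Fact (3 / 2 < r)] : Sobolev r →L[ℝ] ℝ :=
  LinearMap.mkContinuousOfExistsBound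
    { toFun := fun f => ∫ x in (0 : ℝ)..1, f.fn x
      map_add' := fun f g => by
        simp only [fn_add]
        exact intervalIntegral.integral_add (f.intervalIntegrable_fn 0 1)
          (g.intervalIntegrable_fn 0 1)
      map_smul' := fun c f => by
        simp only [fn_smul, RingHom.id_apply, smul_eq_mul]
        exact intervalIntegral.integral_const_mul _ _ }
    (by
      obtain ⟨C, -, h⟩ := exists_norm_toMap_le r
      refine ⟨C, fun f => ?_⟩
      have := intervalIntegral.norm_integral_le_of_norm_le_const (a := 0) (b := 1) (f := f.fn)
        (C := ‖toMap f‖) (fun x _ => f.fn_bounded x)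
      refine (this.trans (by simp)).trans (h f))

theorem intL_apply [Fact (3 / 2 < r)] (f : Sobolev r) : intL f = ∫ x in (0 : ℝ)..1, f.fn x := rfl

theorem intL_const [Fact (3 / 2 < r)] (c : ℝ) : intL (const r c) = c := by
  simp [intL_apply, fn_const]

theorem derivMap_mem {s : ℝ} [Fact (5 / 2 < s)] (f : Sobolev s) :
    derivMap f ∈ sobolevSubmodule (s - 1) := by
  refine mem_of_weightedCoeff_le _ f (2 * Real.pi) fun n hn => ?_
  have hp : (0 : ℝ) < 1 + (n : ℝ) ^ 2 := by positivity
  rw [weightedCoeff_eq, weightedCoeff_eq, fourierCoeff_deriv (toMap f) _ (hasDerivAt_derivMap f),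
    norm_smul, norm_smul, Real.norm_of_nonneg (Real.rpow_nonneg hp.le _),
    Real.norm_of_nonneg (Real.rpow_nonneg hp.le _)]
  simp only [norm_mul, Complex.norm_I, Complex.norm_intCast, Complex.norm_ofNat, mul_one,
    Complex.norm_real, Real.norm_of_nonneg Real.pi_pos.le]
  have e : (1 + (n : ℝ) ^ 2) ^ (s / 2) =
      (1 + (n : ℝ) ^ 2) ^ ((s - 1) / 2) * Real.sqrt (1 + (n : ℝ) ^ 2) := by
    rw [Real.sqrt_eq_rpow, ← Real.rpow_add hp]
    congr 1; ring
  have h1 : |(n : ℝ)| ≤ Real.sqrt (1 + (n : ℝ) ^ 2) :=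
    Real.abs_le_sqrt (by linarith)
  rw [e]
  calc _ = 2 * Real.pi * ((1 + (n : ℝ) ^ 2) ^ ((s - 1) / 2) * |(n : ℝ)| *
        ‖fourierCoeff (complexify (toMap f)) n‖) := by ring
    _ ≤ _ := by gcongr

/-- The derivative `H^s(S¹) → H^{s-1}(S¹)`; it is bounded by the closed graph theorem. -/
def derivL {s : ℝ} [Fact (5 / 2 < s)] : Sobolev s →L[ℝ] Sobolev (s - 1) :=
  ContinuousLinearMap.ofSeqClosedGraph
    (g :=
      { toFun := fun f => (⟨derivMap f, derivMap_mem f⟩ : sobolevSubmodule (s - 1))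
        map_add' := fun f g => fn_injective (funext fun x => by
          change derivMap (f + g) (x : UnitAddCircle) =
            derivMap f (x : UnitAddCircle) + derivMap g (x : UnitAddCircle)
          simp only [derivMap_coe]
          rw [show (f + g).fn = f.fn + g.fn from rfl]
          exact deriv_add (f.differentiable_fn x) (g.differentiable_fn x))
        map_smul' := fun c f => fn_injective (funext fun x => by
          change derivMap (c • f) (x : UnitAddCircle) = c * derivMap f (x : UnitAddCircle)
          simp only [derivMap_coe]
          rw [show (c • f).fn = fun y => c * f.fn y from rfl]
          exact deriv_const_mul_field c) })
    (by
      intro u f g hu hg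
      obtain ⟨C, -, h⟩ := exists_deriv_bound (r := s) Fact.out
      refine fn_injective (funext fun x => ?_)
      have t1 := tendsto_fn hg x
      refine tendsto_nhds_unique t1 ?_
      change Filter.Tendsto (fun i => derivMap (u i) (x : UnitAddCircle)) Filter.atTop
        (𝓝 (derivMap f (x : UnitAddCircle)))
      simp only [derivMap_coe]
      rw [tendsto_iff_norm_sub_tendsto_zero]
      have t2 := (tendsto_iff_norm_sub_tendsto_zero.1 hu).const_mul C
      rw [mul_zero] at t2
      refine squeeze_zero (fun _ => norm_nonneg _) (fun i => ?_) t2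
      have := (h (u i - f)).2.2 x
      rwa [show (u i - f).fn = (u i).fn - f.fn from funext fun y => fn_sub _ _ y,
        deriv_sub ((u i).differentiable_fn x) (f.differentiable_fn x)] at this)

theorem fn_derivL {s : ℝ} [Fact (5 / 2 < s)] (f : Sobolev s) (x : ℝ) :
    (derivL f).fn x = deriv f.fn x := derivMap_coe f x

theorem hasDerivAt_fn {s : ℝ} [Fact (5 / 2 < s)] (f : Sobolev s) (x : ℝ) :
    HasDerivAt f.fn ((derivL f).fn x) x := by
  rw [fn_derivL]
  exact (f.differentiable_fn x).hasDerivAt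

theorem intL_derivL {s : ℝ} [Fact (5 / 2 < s)] (f : Sobolev s) : intL (derivL f) = 0 := by
  rw [intL_apply, intervalIntegral.integral_eq_sub_of_hasDerivAt
    (fun x _ => hasDerivAt_fn f x) ((derivL f).intervalIntegrable_fn 0 1)]
  have := f.fn_periodic 0
  rw [zero_add] at this
  rw [this, sub_self]

/-- The part of mean value zero of a function, `π(f) = f - ∫ f dx`. -/
def center [Fact (3 / 2 < r)] (f : Sobolev r) : Sobolev r := f - const r (intL f)

theorem fn_center [Fact (3 / 2 < r)] (f : Sobolev r) (x : ℝ) :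
    (center f).fn x = f.fn x - intL f := by rw [center, fn_sub, fn_const]

theorem intL_center [Fact (3 / 2 < r)] (f : Sobolev r) : intL (center f) = 0 := by
  rw [center, map_sub, intL_const, sub_self]

theorem hasDerivAt_primitive [Fact (3 / 2 < r)] (f : Sobolev r) (x : ℝ) :
    HasDerivAt (fun x => ∫ y in (0 : ℝ)..x, (center f).fn y) ((center f).fn x) x :=
  intervalIntegral.integral_hasDerivAt_right ((center f).intervalIntegrable_fn 0 x)
    (center f).fn_continuous.stronglyMeasurable.stronglyMeasurableAtFilter
    (center f).fn_continuous.continuousAt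

theorem periodic_primitive [Fact (3 / 2 < r)] (f : Sobolev r) :
    Function.Periodic (fun x => ∫ y in (0 : ℝ)..x, (center f).fn y) 1 := by
  intro x
  have h1 := intervalIntegral.integral_add_adjacent_intervals
    ((center f).intervalIntegrable_fn 0 x) ((center f).intervalIntegrable_fn x (x + 1))
  have h2 := (center f).fn_periodic.intervalIntegral_add_eq x 0
  rw [zero_add, ← intL_apply, intL_center] at h2
  simp only [← h1, h2, add_zero]

/-- The periodic function `x ↦ ∫₀ˣ (f - ∫ f)`. -/
def primitiveMap [Fact (3 / 2 < r)] (f : Sobolev r) : C(UnitAddCircle, ℝ) :=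
  ofPeriodic (fun x => ∫ y in (0 : ℝ)..x, (center f).fn y) (periodic_primitive f)
    (continuous_iff_continuousAt.2 fun x => (hasDerivAt_primitive f x).continuousAt)

theorem primitiveMap_coe [Fact (3 / 2 < r)] (f : Sobolev r) (x : ℝ) :
    primitiveMap f (x : UnitAddCircle) = ∫ y in (0 : ℝ)..x, (center f).fn y :=
  ofPeriodic_coe _ _ _ x

theorem primitiveMap_mem {s : ℝ} [Fact (5 / 2 < s)] (f : Sobolev (s - 1)) :
    primitiveMap f ∈ sobolevSubmodule s := by
  refine mem_of_weightedCoeff_le _ (center f) 1 fun n hn => ?_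
  have hp : (0 : ℝ) < 1 + (n : ℝ) ^ 2 := by positivity
  have h := fourierCoeff_deriv (primitiveMap f) (toMap (center f)) (fun x => by
    simp only [primitiveMap_coe]
    exact hasDerivAt_primitive f x) n
  rw [weightedCoeff_eq, weightedCoeff_eq, h, norm_smul, norm_smul,
    Real.norm_of_nonneg (Real.rpow_nonneg hp.le _),
    Real.norm_of_nonneg (Real.rpow_nonneg hp.le _)]
  simp only [norm_mul, Complex.norm_I, Complex.norm_intCast, Complex.norm_ofNat, mul_one,
    Complex.norm_real, Real.norm_of_nonneg Real.pi_pos.le, one_mul]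
  have e : (1 + (n : ℝ) ^ 2) ^ (s / 2) =
      (1 + (n : ℝ) ^ 2) ^ ((s - 1) / 2) * Real.sqrt (1 + (n : ℝ) ^ 2) := by
    rw [Real.sqrt_eq_rpow, ← Real.rpow_add hp]
    congr 1; ring
  have h1 : (1 : ℝ) ≤ |(n : ℝ)| := by exact_mod_cast Int.one_le_abs hn
  have h2 : Real.sqrt (1 + (n : ℝ) ^ 2) ≤ 2 * Real.pi * |(n : ℝ)| := by
    rw [Real.sqrt_le_left (by positivity), ← sq_abs (n : ℝ)]
    have h3 : 2 * |(n : ℝ)| ≤ 2 * Real.pi * |(n : ℝ)| := by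
      nlinarith [Real.pi_gt_three]
    nlinarith [pow_le_pow_left₀ (by positivity) h3 2]
  rw [e]
  calc _ = (1 + (n : ℝ) ^ 2) ^ ((s - 1) / 2) * (Real.sqrt (1 + (n : ℝ) ^ 2) *
        ‖fourierCoeff (complexify (primitiveMap f)) n‖) := by ring
    _ ≤ _ := by gcongr

theorem isClosed_vanishing [Fact (3 / 2 < r)] : IsClosed (vanishing r : Set (Sobolev r)) :=
  isClosed_singleton.preimage
    ((continuous_eval_const ((0 : ℝ) : UnitAddCircle)).comp (toMapL (r := r)).continuous)

instance [Fact (3 / 2 < r)] : CompleteSpace (SobolevZero r) :=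
  isClosed_vanishing.completeSpace_coe

/-- The bounded operator `f ↦ ∫₀ˣ (f - ∫ f)` from `H^{s-1}` to `H_0^s`; it is bounded by the closed
graph theorem. -/
def primitiveL {s : ℝ} [Fact (5 / 2 < s)] : Sobolev (s - 1) →L[ℝ] SobolevZero s :=
  ContinuousLinearMap.ofSeqClosedGraph
    (g :=
      { toFun := fun f => ⟨(⟨primitiveMap f, primitiveMap_mem f⟩ : sobolevSubmodule s), by
          change primitiveMap f ((0 : ℝ) : UnitAddCircle) = 0
          rw [primitiveMap_coe, intervalIntegral.integral_same]⟩
        map_add' := fun f g => Subtype.ext (fn_injective (funext fun x => by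
          change primitiveMap (f + g) (x : UnitAddCircle) =
            primitiveMap f (x : UnitAddCircle) + primitiveMap g (x : UnitAddCircle)
          simp only [primitiveMap_coe]
          rw [← intervalIntegral.integral_add ((center f).intervalIntegrable_fn 0 x)
            ((center g).intervalIntegrable_fn 0 x)]
          refine intervalIntegral.integral_congr fun y _ => ?_
          simp only [fn_center, fn_add, map_add]
          ring))
        map_smul' := fun c f => Subtype.ext (fn_injective (funext fun x => by
          change primitiveMap (c • f) (x : UnitAddCircle) = c * primitiveMap f (x : UnitAddCircle)
          simp only [primitiveMap_coe]
          rw [← intervalIntegral.integral_const_mul]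
          refine intervalIntegral.integral_congr fun y _ => ?_
          simp only [fn_center, fn_smul, map_smul, smul_eq_mul]
          ring)) })
    (by
      intro u f g hu hg
      refine Subtype.ext (fn_injective (funext fun x => ?_))
      have t1 : Filter.Tendsto (fun i => primitiveMap (u i) (x : UnitAddCircle)) Filter.atTop
          (𝓝 (g.1.fn x)) := tendsto_fn ((continuous_subtype_val.tendsto g).comp hg) x
      refine tendsto_nhds_unique t1 ?_
      change Filter.Tendsto (fun i => primitiveMap (u i) (x : UnitAddCircle)) Filter.atTop
        (𝓝 (primitiveMap f (x : UnitAddCircle)))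
      have e : ∀ f : Sobolev (s - 1), primitiveMap f (x : UnitAddCircle) =
          (∫ y in (0 : ℝ)..x, f.fn y) - x * intL f := by
        intro f
        rw [primitiveMap_coe]
        simp only [fn_center]
        rw [intervalIntegral.integral_sub (f.intervalIntegrable_fn 0 x) (by simp)]
        simp
      simp only [e]
      refine Filter.Tendsto.sub ?_ (((intL.continuous.tendsto f).comp hu).const_mul x)
      rw [tendsto_iff_norm_sub_tendsto_zero]
      have t2 : Filter.Tendsto (fun i => ‖toMap (u i) - toMap f‖ * |x - 0|) Filter.atTop
          (𝓝 0) := by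
        have := (tendsto_iff_norm_sub_tendsto_zero.1
          ((toMapL.continuous.tendsto f).comp hu)).mul_const |x - 0|
        rwa [zero_mul] at this
      refine squeeze_zero (fun _ => norm_nonneg _) (fun i => ?_) t2
      rw [← intervalIntegral.integral_sub ((u i).intervalIntegrable_fn 0 x)
        (f.intervalIntegrable_fn 0 x)]
      refine intervalIntegral.norm_integral_le_of_norm_le_const fun y _ => ?_
      rw [← fn_sub, ← map_sub]
      exact (u i - f).fn_bounded y)

theorem derivL_primitiveL {s : ℝ} [Fact (5 / 2 < s)] (f : Sobolev (s - 1)) (x : ℝ) :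
    (derivL (primitiveL f).1).fn x = f.fn x - intL f := by
  rw [fn_derivL, ← fn_center]
  have e : (primitiveL f).1.fn = fun x => ∫ y in (0 : ℝ)..x, (center f).fn y :=
    funext fun x => primitiveMap_coe f x
  rw [e]
  exact (hasDerivAt_primitive f x).deriv

/-- An element of `H_0^s` is determined by its derivative. -/
theorem ext_derivL {s : ℝ} [Fact (5 / 2 < s)] {f g : SobolevZero s}
    (h : ∀ x, (derivL f.1).fn x = (derivL g.1).fn x) : f = g := by
  refine Subtype.ext (fn_injective (funext fun x => ?_))
  have hc : ∀ f : SobolevZero s, f.1.fn x = ∫ y in (0 : ℝ)..x, (derivL f.1).fn y := by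
    intro f
    rw [intervalIntegral.integral_eq_sub_of_hasDerivAt
      (fun y _ => hasDerivAt_fn f.1 y) ((derivL f.1).intervalIntegrable_fn 0 x),
      show f.1.fn 0 = 0 from f.2, sub_zero]
  rw [hc, hc]
  exact intervalIntegral.integral_congr fun y _ => h y

end Sobolev

end HunterSaxton

namespace HunterSaxton

open Sobolev

/-! ### Operators on the model space -/

theorem ContDiffOn.clm_bilinearComp {X E F G : Type*} [NormedAddCommGroup X] [NormedSpace ℝ X]
    [NormedAddCommGroup E] [NormedSpace ℝ E] [NormedAddCommGroup F] [NormedSpace ℝ F]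
    [NormedAddCommGroup G] [NormedSpace ℝ G] {n : ℕ∞ω} {t : Set X} {A B : X → E →L[ℝ] F}
    (M : F →L[ℝ] F →L[ℝ] G) (hA : ContDiffOn ℝ n A t) (hB : ContDiffOn ℝ n B t) :
    ContDiffOn ℝ n (fun x => M.bilinearComp (A x) (B x)) t := by
  have h1 : ContDiffOn ℝ n (fun x => M.comp (A x)) t := contDiffOn_const.clm_comp hA
  have h2 : ContDiffOn ℝ n (fun x => (ContinuousLinearMap.compL ℝ E F G).flip (B x)) t :=
    (ContinuousLinearMap.contDiff _).comp_contDiffOn hB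
  exact h2.clm_comp h1

variable {s : ℝ} [Fact (5 / 2 < s)]

namespace SobolevMod

/-- The class `[f]`, as a bounded operator. -/
def mkL : Sobolev (s - 1) →L[ℝ] SobolevMod (s - 1) := (constants (s - 1)).mkQL

/-- The representative of mean value zero of a class of functions modulo constants. -/
def centerL : SobolevMod (s - 1) →L[ℝ] Sobolev (s - 1) :=
  (constants (s - 1)).liftQL
    (ContinuousLinearMap.id ℝ _ - (intL (r := s - 1)).smulRight (Sobolev.const (s - 1) 1)) (by
      rintro f ⟨c, hc⟩
      refine fn_injective (funext fun x => ?_)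
      change (f - intL f • Sobolev.const (s - 1) 1).fn x = 0
      simp [fn_sub, fn_smul, fn_const, intL_apply, hc])

theorem centerL_mk (f : Sobolev (s - 1)) : centerL (mk f) = center f :=
  fn_injective (funext fun x => by
    change (f - intL f • Sobolev.const (s - 1) 1).fn x = _
    simp [fn_sub, fn_smul, fn_const, fn_center])

theorem mk_eq_mk {f g : Sobolev (s - 1)} : mk f = mk g ↔ center f = center g := by
  constructor
  · intro h
    rw [← centerL_mk, h, centerL_mk]
  · intro h
    refine (Submodule.Quotient.eq (constants (s - 1))).2 ⟨intL f - intL g, fun x => ?_⟩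
    have hx := congrArg (fun u : Sobolev (s - 1) => u.fn x) h
    simp only [fn_center] at hx
    rw [fn_sub]
    linarith

theorem mk_centerL (q : SobolevMod (s - 1)) : mk (centerL q) = q := by
  obtain ⟨f, rfl⟩ := mk_surjective q
  rw [centerL_mk, mk_eq_mk]
  refine fn_injective (funext fun x => ?_)
  rw [fn_center (center f), intL_center, sub_zero]

instance : CompleteSpace (SobolevMod (s - 1)) :=
  inferInstanceAs (CompleteSpace (Sobolev (s - 1) ⧸ constants (s - 1)))

end SobolevMod

namespace Model

instance : CompleteSpace (Model s) :=
  inferInstanceAs (CompleteSpace (SobolevZero s × SobolevMod (s - 1)))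

/-- The derivative `U₁ₓ` of the first component. -/
def slope : Model s →L[ℝ] Sobolev (s - 1) :=
  (derivL.comp (vanishing s).subtypeL).comp
    (ContinuousLinearMap.fst ℝ (SobolevZero s) (SobolevMod (s - 1)))

/-- The representative of mean value zero of the second component. -/
def density : Model s →L[ℝ] Sobolev (s - 1) :=
  SobolevMod.centerL.comp (ContinuousLinearMap.snd ℝ (SobolevZero s) (SobolevMod (s - 1)))

/-- `f ↦ (∫₀ˣ (f - ∫ f), 0)`. -/
def inl : Sobolev (s - 1) →L[ℝ] Model s :=
  (ContinuousLinearMap.inl ℝ (SobolevZero s) (SobolevMod (s - 1))).comp primitiveL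

/-- `f ↦ (0, [f])`. -/
def inr : Sobolev (s - 1) →L[ℝ] Model s :=
  (ContinuousLinearMap.inr ℝ (SobolevZero s) (SobolevMod (s - 1))).comp SobolevMod.mkL

theorem slope_inl (f : Sobolev (s - 1)) : slope (inl f) = center f :=
  fn_injective (funext fun x => by
    rw [fn_center]
    exact derivL_primitiveL f x)

theorem density_inl (f : Sobolev (s - 1)) : density (inl f) = 0 :=
  map_zero SobolevMod.centerL

theorem slope_inr (f : Sobolev (s - 1)) : slope (inr f) = 0 :=
  map_zero derivL

theorem density_inr (f : Sobolev (s - 1)) : density (inr f) = center f :=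
  SobolevMod.centerL_mk f

theorem intL_slope (U : Model s) : intL (slope U) = 0 := intL_derivL U.1.1

theorem intL_density (U : Model s) : intL (density U) = 0 := by
  obtain ⟨f, hf⟩ := SobolevMod.mk_surjective U.2
  change intL (SobolevMod.centerL U.2) = 0
  rw [← hf, SobolevMod.centerL_mk, intL_center]

/-- A tangent vector is determined by the functions `slope` and `density`, so that identities in the
model space reduce to pointwise identities of functions. -/
theorem ext_slope_density {U V : Model s} (h₁ : ∀ x, (slope U).fn x = (slope V).fn x)
    (h₂ : ∀ x, (density U).fn x = (density V).fn x) : U = V := by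
  refine Prod.ext (ext_derivL h₁) ?_
  have h3 : SobolevMod.centerL U.2 = SobolevMod.centerL V.2 := fn_injective (funext h₂)
  rw [← SobolevMod.mk_centerL U.2, h3, SobolevMod.mk_centerL]

/-- The common domain of coordinates: the pairs `(h, q)` with `h_x > -1`. -/
def domain (s : ℝ) : Set (Model s) := {e | e.1 ∈ diffSet s}

theorem isOpen_domain : IsOpen (domain s) := (isOpen_diffSet s).preimage continuous_fst

/-- The derivative `φ_x = 1 + h_x`. -/
def jac (e : Model s) : Sobolev (s - 1) := Sobolev.const (s - 1) 1 + slope e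

theorem fn_jac (e : Model s) (x : ℝ) : (jac e).fn x = 1 + (slope e).fn x := by
  rw [jac, fn_add, fn_const]

theorem intL_jac (e : Model s) : intL (jac e) = 1 := by
  rw [jac, map_add, intL_slope, intL_const, add_zero]

theorem jac_pos {e : Model s} (he : e ∈ domain s) (x : ℝ) : 0 < (jac e).fn x := by
  have h1 : -1 < deriv e.1.1.fn x := he x
  have h2 : (slope e).fn x = deriv e.1.1.fn x := fn_derivL _ _
  rw [fn_jac, h2]
  linarith

theorem hasFDerivAt_jac (e : Model s) : HasFDerivAt jac (slope (s := s)) e :=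
  (slope (s := s)).hasFDerivAt.const_add _

theorem contDiff_jac {n : ℕ∞ω} : ContDiff ℝ n (jac (s := s)) :=
  contDiff_const.add slope.contDiff

/-- The reciprocal `1/φ_x`. -/
def rjac (e : Model s) : Sobolev (s - 1) := recip (jac e)

theorem jac_mul_rjac {e : Model s} (he : e ∈ domain s) (x : ℝ) :
    (jac e).fn x * (rjac e).fn x = 1 := by
  rw [rjac, fn_recip _ (jac_pos he)]
  exact mul_inv_cancel₀ (jac_pos he x).ne'

theorem contDiffOn_rjac {n : ℕ∞ω} : ContDiffOn ℝ n (rjac (s := s)) (domain s) := fun e he =>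
  ((contDiffAt_recip (jac e) (jac_pos he)).comp e contDiff_jac.contDiffAt).contDiffWithinAt

/-- The derivative of `1/φ_x`, found by differentiating `φ_x · (1/φ_x) = 1`. -/
theorem hasFDerivAt_rjac {e : Model s} (he : e ∈ domain s) :
    HasFDerivAt rjac (-(mulL (mul (rjac e) (rjac e))).comp slope) e := by
  have hd : HasFDerivAt (rjac (s := s)) (fderiv ℝ rjac e) e :=
    ((contDiffOn_rjac (n := 1)).differentiableOn one_ne_zero
      |>.differentiableAt (isOpen_domain.mem_nhds he)).hasFDerivAt
  have h1 : HasFDerivAt (fun e' : Model s => mulL (jac e') (rjac e')) _ e :=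
    (mulL (r := s - 1)).hasFDerivAt_of_bilinear (hasFDerivAt_jac e) hd
  have h2 : HasFDerivAt (fun e' : Model s => mulL (jac e') (rjac e'))
      (0 : Model s →L[ℝ] Sobolev (s - 1)) e := by
    refine (hasFDerivAt_const (Sobolev.const (s - 1) 1) e).congr_of_eventuallyEq ?_
    filter_upwards [isOpen_domain.mem_nhds he] with e' he'
    exact fn_injective (funext fun x => jac_mul_rjac he' x)
  have h3 := h1.unique h2
  have h4 : fderiv ℝ rjac e = -(mulL (mul (rjac e) (rjac e))).comp slope := by
    ext1 W
    refine fn_injective (funext fun x => ?_)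
    have h5 := congrArg (fun A : Model s →L[ℝ] Sobolev (s - 1) => (A W).fn x) h3
    have h6 : (jac e).fn x * (fderiv ℝ rjac e W).fn x + (slope W).fn x * (rjac e).fn x = 0 := h5
    have h7 := jac_mul_rjac he x
    change (fderiv ℝ rjac e W).fn x = (-(mul (mul (rjac e) (rjac e)) (slope W))).fn x
    rw [fn_neg, fn_mul, fn_mul]
    linear_combination (rjac e).fn x * h6 - (fderiv ℝ rjac e W).fn x * h7
  rwa [h4] at hd

end Model

end HunterSaxton

namespace HunterSaxton

open Sobolev

namespace Model

variable {s : ℝ} [Fact (5 / 2 < s)]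

/-! ### The structures in coordinates -/

/-- The projection `P f = f - ∫ f φ_x dx`. -/
def proj (e : Model s) : Sobolev (s - 1) →L[ℝ] Sobolev (s - 1) :=
  ContinuousLinearMap.id ℝ _ -
    ((intL (r := s - 1)).comp (mulL (jac e))).smulRight (Sobolev.const (s - 1) 1)

theorem fn_proj (e : Model s) (f : Sobolev (s - 1)) (x : ℝ) :
    (proj e f).fn x = f.fn x - intL (mul (jac e) f) := by
  change (f - intL (mul (jac e) f) • Sobolev.const (s - 1) 1).fn x = _
  rw [fn_sub, fn_smul, fn_const, mul_one]

/-- `U ↦ U₁ₓ/φ_x`, which is `u_{1x} ∘ φ` for `U = u ∘ φ`. -/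
def strain (e : Model s) : Model s →L[ℝ] Sobolev (s - 1) := (mulL (rjac e)).comp slope

/-- `U ↦ P U₂`, which is `π(u₂) ∘ φ` for `U = u ∘ φ`. -/
def charge (e : Model s) : Model s →L[ℝ] Sobolev (s - 1) := (proj e).comp density

/-- `U ↦ φ_x P U₂`. -/
def flow (e : Model s) : Model s →L[ℝ] Sobolev (s - 1) := (mulL (jac e)).comp (charge e)

theorem fn_strain (e U : Model s) (x : ℝ) :
    (strain e U).fn x = (rjac e).fn x * (slope U).fn x := rfl

theorem fn_charge (e U : Model s) (x : ℝ) :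
    (charge e U).fn x = (density U).fn x - intL (mul (jac e) (density U)) := fn_proj _ _ _

theorem fn_flow (e U : Model s) (x : ℝ) :
    (flow e U).fn x = (jac e).fn x * (charge e U).fn x := rfl

/-- `(f, g) ↦ ∫ f g dx`. -/
def intMul : Sobolev (s - 1) →L[ℝ] Sobolev (s - 1) →L[ℝ] ℝ :=
  (ContinuousLinearMap.compL ℝ _ _ _ intL).comp mulL

/-- `f ↦ (∫₀ˣ (P f) φ_x, 0)`. -/
def lift (e : Model s) : Sobolev (s - 1) →L[ℝ] Model s := (inl.comp (mulL (jac e))).comp (proj e)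

/-- `(f, g) ↦ (0, [f g])`. -/
def inrMul : Sobolev (s - 1) →L[ℝ] Sobolev (s - 1) →L[ℝ] Model s :=
  (ContinuousLinearMap.compL ℝ _ _ _ inr).comp mulL

/-- The metric in coordinates. -/
def metric (e : Model s) : Model s →L[ℝ] Model s →L[ℝ] ℝ :=
  (1 / 4 : ℝ) • (intMul.bilinearComp (strain e) slope + intMul.bilinearComp (flow e) (charge e))

/-- The Christoffel map in coordinates. -/
def christoffel (e : Model s) : Model s →L[ℝ] Model s →L[ℝ] Model s :=
  (1 / 2 : ℝ) • (ContinuousLinearMap.compL ℝ _ _ _ (lift e)).comp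
      (mulL.bilinearComp (strain e) (strain e) + mulL.bilinearComp (charge e) (charge e)) -
    (1 / 2 : ℝ) •
      (inrMul.bilinearComp (strain e) (charge e) + inrMul.bilinearComp (charge e) (strain e))

/-- The complex structure in coordinates. -/
def complexStructure (e : Model s) : Model s →L[ℝ] Model s :=
  inr.comp (strain e) - inl.comp (flow e)

variable (s) in
/-- The symplectic form; it does not depend on the point. -/
def symplectic : Model s →L[ℝ] Model s →L[ℝ] ℝ :=
  (1 / 4 : ℝ) • (intMul.bilinearComp slope density - intMul.bilinearComp density slope)

theorem metric_apply (e U V : Model s) : metric e U V = 1 / 4 *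
    (intL (mul (strain e U) (slope V)) + intL (mul (flow e U) (charge e V))) := rfl

theorem christoffel_apply (e U V : Model s) : christoffel e U V =
    (1 / 2 : ℝ) • lift e (mul (strain e U) (strain e V) + mul (charge e U) (charge e V)) -
    (1 / 2 : ℝ) • (inr (mul (strain e U) (charge e V)) + inr (mul (charge e U) (strain e V))) := rfl

theorem complexStructure_apply (e U : Model s) :
    complexStructure e U = inr (strain e U) - inl (flow e U) := rfl

theorem symplectic_apply (U V : Model s) : symplectic s U V = 1 / 4 *
    (intL (mul (slope U) (density V)) - intL (mul (density U) (slope V))) := rfl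

/-! ### Smoothness of the coordinate expressions -/

theorem contDiff_mulL_comp {n : ℕ∞ω} {t : Set (Model s)} {f : Model s → Sobolev (s - 1)}
    (hf : ContDiffOn ℝ n f t) : ContDiffOn ℝ n (fun e => mulL (f e)) t :=
  (ContinuousLinearMap.contDiff _).comp_contDiffOn hf

theorem contDiffOn_strain {n : ℕ∞ω} : ContDiffOn ℝ n (strain (s := s)) (domain s) :=
  (contDiff_mulL_comp contDiffOn_rjac).clm_comp contDiffOn_const

theorem contDiffOn_proj {n : ℕ∞ω} {t : Set (Model s)} : ContDiffOn ℝ n (proj (s := s)) t := by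
  refine contDiffOn_const.sub ?_
  have h : ContDiffOn ℝ n (fun e : Model s => (intL (r := s - 1)).comp (mulL (jac e))) t :=
    contDiffOn_const.clm_comp (contDiff_mulL_comp contDiff_jac.contDiffOn)
  exact (ContinuousLinearMap.contDiff ((ContinuousLinearMap.smulRightL ℝ _ _).flip
    (Sobolev.const (s - 1) 1))).comp_contDiffOn h

theorem contDiffOn_charge {n : ℕ∞ω} {t : Set (Model s)} : ContDiffOn ℝ n (charge (s := s)) t :=
  contDiffOn_proj.clm_comp contDiffOn_const

theorem contDiffOn_flow {n : ℕ∞ω} {t : Set (Model s)} : ContDiffOn ℝ n (flow (s := s)) t :=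
  (contDiff_mulL_comp contDiff_jac.contDiffOn).clm_comp contDiffOn_charge

theorem contDiffOn_metric {n : ℕ∞ω} : ContDiffOn ℝ n (metric (s := s)) (domain s) :=
  ((ContDiffOn.clm_bilinearComp _ contDiffOn_strain contDiffOn_const).add
    (ContDiffOn.clm_bilinearComp _ contDiffOn_flow contDiffOn_charge)).const_smul _

theorem contDiffOn_lift {n : ℕ∞ω} {t : Set (Model s)} : ContDiffOn ℝ n (lift (s := s)) t :=
  (contDiffOn_const.clm_comp (contDiff_mulL_comp contDiff_jac.contDiffOn)).clm_comp contDiffOn_proj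

set_option synthInstance.maxHeartbeats 200000 in
theorem contDiffOn_christoffel {n : ℕ∞ω} : ContDiffOn ℝ n (christoffel (s := s)) (domain s) := by
  have h1 : ContDiffOn ℝ n (fun e : Model s =>
      ContinuousLinearMap.compL ℝ (Model s) _ _ (lift e)) (domain s) :=
    (ContinuousLinearMap.contDiff _).comp_contDiffOn contDiffOn_lift
  have h2 := (ContDiffOn.clm_bilinearComp (mulL (r := s - 1)) (contDiffOn_strain (n := n))
    contDiffOn_strain).add (ContDiffOn.clm_bilinearComp mulL contDiffOn_charge contDiffOn_charge)
  have h3 := (ContDiffOn.clm_bilinearComp inrMul (contDiffOn_strain (s := s) (n := n))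
    contDiffOn_charge).add (ContDiffOn.clm_bilinearComp inrMul contDiffOn_charge contDiffOn_strain)
  exact ((h1.clm_comp h2).const_smul _).sub (h3.const_smul _)

theorem contDiffOn_complexStructure {n : ℕ∞ω} :
    ContDiffOn ℝ n (complexStructure (s := s)) (domain s) :=
  (contDiffOn_const.clm_comp contDiffOn_strain).sub (contDiffOn_const.clm_comp contDiffOn_flow)

/-! ### Pointwise algebraic identities -/

theorem slope_inl_apply (f : Sobolev (s - 1)) (x : ℝ) : (slope (inl f)).fn x = f.fn x - intL f := by
  rw [slope_inl, fn_center]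

theorem density_inr_apply (f : Sobolev (s - 1)) (x : ℝ) :
    (density (inr f)).fn x = f.fn x - intL f := by
  rw [density_inr, fn_center]

theorem intL_flow (e U : Model s) : intL (flow e U) = 0 := by
  have e1 : flow e U = mul (jac e) (density U) - intL (mul (jac e) (density U)) • jac e :=
    fn_injective (funext fun x => by
      rw [fn_flow, fn_charge, fn_sub, fn_mul, fn_smul]; ring)
  rw [e1, map_sub, map_smul, intL_jac, smul_eq_mul, mul_one, sub_self]

theorem slope_complexStructure (e U : Model s) (x : ℝ) :
    (slope (complexStructure e U)).fn x = -(flow e U).fn x := by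
  rw [complexStructure_apply, map_sub, fn_sub, slope_inr, slope_inl_apply, intL_flow,
    fn_zero]
  ring

theorem density_complexStructure (e U : Model s) (x : ℝ) :
    (density (complexStructure e U)).fn x = (strain e U).fn x - intL (strain e U) := by
  rw [complexStructure_apply, map_sub, fn_sub, density_inl, density_inr_apply, fn_zero]
  ring

theorem charge_complexStructure {e : Model s} (he : e ∈ domain s) (U : Model s) (x : ℝ) :
    (charge e (complexStructure e U)).fn x = (strain e U).fn x := by
  have h : mul (jac e) (density (complexStructure e U)) = slope U - intL (strain e U) • jac e :=
    fn_injective (funext fun x => by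
      rw [fn_mul, density_complexStructure, fn_sub, fn_smul, fn_strain]
      linear_combination (slope U).fn x * jac_mul_rjac he x)
  rw [fn_charge, density_complexStructure, h, map_sub, map_smul, intL_slope, intL_jac, smul_eq_mul]
  ring

theorem strain_complexStructure {e : Model s} (he : e ∈ domain s) (U : Model s) (x : ℝ) :
    (strain e (complexStructure e U)).fn x = -(charge e U).fn x := by
  rw [fn_strain, slope_complexStructure, fn_flow]
  linear_combination -(charge e U).fn x * jac_mul_rjac he x

theorem complexStructure_complexStructure {e : Model s} (he : e ∈ domain s) (U : Model s) :
    complexStructure e (complexStructure e U) = -U := by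
  refine ext_slope_density (fun x => ?_) fun x => ?_
  · rw [slope_complexStructure, fn_flow, charge_complexStructure he, fn_strain, map_neg, fn_neg]
    linear_combination -(slope U).fn x * jac_mul_rjac he x
  · have h : strain e (complexStructure e U) =
        Sobolev.const (s - 1) (intL (mul (jac e) (density U))) - density U :=
      fn_injective (funext fun x => by
        rw [strain_complexStructure he, fn_charge, fn_sub, fn_const]; ring)
    rw [density_complexStructure, strain_complexStructure he, h, map_sub, intL_const, intL_density,
      fn_charge, map_neg, fn_neg]
    ring

theorem metric_symm (e U V : Model s) : metric e U V = metric e V U := by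
  rw [metric_apply, metric_apply]
  congr 3
  · exact fn_injective (funext fun x => by simp only [fn_mul, fn_strain]; ring)
  · exact fn_injective (funext fun x => by simp only [fn_mul, fn_flow]; ring)

theorem mul_comm' (f g : Sobolev (s - 1)) : mul f g = mul g f :=
  fn_injective (funext fun x => by simp only [fn_mul]; ring)

theorem christoffel_symm (e U V : Model s) : christoffel e U V = christoffel e V U := by
  rw [christoffel_apply, christoffel_apply, mul_comm' (strain e U), mul_comm' (charge e U),
    mul_comm' (strain e U), mul_comm' (charge e U), add_comm (inr _)]

theorem symplectic_antisymm (U V : Model s) : symplectic s U V = -symplectic s V U := by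
  rw [symplectic_apply, symplectic_apply, mul_comm' (slope U), mul_comm' (density U)]
  ring

theorem symplectic_eq_metric {e : Model s} (he : e ∈ domain s) (U V : Model s) :
    symplectic s U V = metric e (complexStructure e U) V := by
  have e1 : mul (strain e (complexStructure e U)) (slope V) =
      intL (mul (jac e) (density U)) • slope V - mul (density U) (slope V) :=
    fn_injective (funext fun x => by
      rw [fn_mul, strain_complexStructure he, fn_charge, fn_sub, fn_smul, fn_mul]; ring)
  have e2 : mul (flow e (complexStructure e U)) (charge e V) =
      mul (slope U) (density V) - intL (mul (jac e) (density V)) • slope U :=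
    fn_injective (funext fun x => by
      rw [fn_mul, fn_flow, charge_complexStructure he, fn_strain, fn_charge, fn_sub, fn_mul,
        fn_smul]
      linear_combination (slope U).fn x * ((density V).fn x - intL (mul (jac e) (density V))) *
        jac_mul_rjac he x)
  rw [symplectic_apply, metric_apply, e1, e2, map_sub, map_sub, map_smul, map_smul, intL_slope,
    intL_slope, smul_zero, smul_zero]
  ring

/-- A nonnegative function with integral zero vanishes. -/
theorem eq_zero_of_intL_nonpos {f : Sobolev (s - 1)} (h0 : ∀ x, 0 ≤ f.fn x) (h : intL f ≤ 0) :
    ∀ x, f.fn x = 0 := by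
  have h1 : ∀ x ∈ Set.Icc (0 : ℝ) 1, f.fn x = 0 := by
    by_contra hne
    push Not at hne
    obtain ⟨c, hc, hfc⟩ := hne
    have := intervalIntegral.integral_pos (f := f.fn) (a := 0) (b := 1) one_pos
      f.fn_continuous.continuousOn (fun x _ => h0 x) ⟨c, hc, (h0 c).lt_of_ne (Ne.symm hfc)⟩
    rw [intL_apply] at h
    linarith
  intro x
  obtain ⟨y, hy, hxy⟩ := f.fn_periodic.exists_mem_Ico₀ one_pos x
  rw [hxy]
  exact h1 y ⟨hy.1, hy.2.le⟩

theorem metric_pos {e : Model s} (he : e ∈ domain s) {U : Model s} (hU : U ≠ 0) :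
    0 < metric e U U := by
  by_contra hn
  have hj := jac_pos he
  have hr : ∀ x, 0 < (rjac e).fn x := fun x => by
    rw [rjac, fn_recip _ hj]
    exact inv_pos.2 (hj x)
  have p1 : ∀ x, 0 ≤ (mul (strain e U) (slope U)).fn x := fun x => by
    rw [fn_mul, fn_strain, mul_assoc]
    exact mul_nonneg (hr x).le (mul_self_nonneg _)
  have p2 : ∀ x, 0 ≤ (mul (flow e U) (charge e U)).fn x := fun x => by
    rw [fn_mul, fn_flow, mul_assoc]
    exact mul_nonneg (hj x).le (mul_self_nonneg _)
  have i1 : 0 ≤ intL (mul (strain e U) (slope U)) :=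
    intervalIntegral.integral_nonneg zero_le_one fun x _ => p1 x
  have i2 : 0 ≤ intL (mul (flow e U) (charge e U)) :=
    intervalIntegral.integral_nonneg zero_le_one fun x _ => p2 x
  rw [metric_apply] at hn
  have z1 := eq_zero_of_intL_nonpos p1 (by linarith)
  have z2 := eq_zero_of_intL_nonpos p2 (by linarith)
  have s0 : ∀ x, (slope U).fn x = 0 := fun x => by
    have := z1 x
    rw [fn_mul, fn_strain, mul_assoc] at this
    exact mul_self_eq_zero.1 ((mul_eq_zero.1 this).resolve_left (hr x).ne')
  have c0 : ∀ x, (charge e U).fn x = 0 := fun x => by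
    have := z2 x
    rw [fn_mul, fn_flow, mul_assoc] at this
    exact mul_self_eq_zero.1 ((mul_eq_zero.1 this).resolve_left (hj x).ne')
  have d0 : density U = Sobolev.const (s - 1) (intL (mul (jac e) (density U))) :=
    fn_injective (funext fun x => by
      have := c0 x
      rw [fn_charge] at this
      rw [fn_const]
      linarith)
  have d1 := intL_density U
  rw [d0, intL_const] at d1
  rw [d1] at d0
  apply hU
  refine ext_slope_density (fun x => by rw [s0, map_zero, fn_zero]) fun x => ?_
  rw [d0, map_zero, fn_const, fn_zero]

end Model

end HunterSaxton

namespace HunterSaxton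

open Sobolev

namespace Model

variable {s : ℝ} [Fact (5 / 2 < s)]

/-! ### The structures are parallel -/

/-- The function `(u_{1x} v_{1x} + π(u₂) π(v₂)) ∘ φ`, where `U = u ∘ φ` and `V = v ∘ φ`; it
determines the first component of `Γ`. -/
def stress (e U V : Model s) : Sobolev (s - 1) :=
  mul (strain e U) (strain e V) + mul (charge e U) (charge e V)

/-- The function `(u_{1x} π(v₂) + v_{1x} π(u₂)) ∘ φ`, where `U = u ∘ φ` and `V = v ∘ φ`; it
determines the second component of `Γ`. -/
def shear (e U V : Model s) : Sobolev (s - 1) :=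
  mul (strain e U) (charge e V) + mul (charge e U) (strain e V)

theorem fn_stress (e U V : Model s) (x : ℝ) : (stress e U V).fn x =
    (strain e U).fn x * (strain e V).fn x + (charge e U).fn x * (charge e V).fn x := rfl

theorem fn_shear (e U V : Model s) (x : ℝ) : (shear e U V).fn x =
    (strain e U).fn x * (charge e V).fn x + (charge e U).fn x * (strain e V).fn x := rfl

theorem christoffel_eq (e U V : Model s) : christoffel e U V =
    (1 / 2 : ℝ) • lift e (stress e U V) - (1 / 2 : ℝ) • inr (shear e U V) := by
  rw [christoffel_apply, shear, map_add inr]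
  rfl

theorem slope_lift (e : Model s) (f : Sobolev (s - 1)) (x : ℝ) :
    (slope (lift e f)).fn x = (jac e).fn x * (f.fn x - intL (mul (jac e) f)) := by
  have h : intL (mul (jac e) (proj e f)) = 0 := by
    have e1 : mul (jac e) (proj e f) = mul (jac e) f - intL (mul (jac e) f) • jac e :=
      fn_injective (funext fun x => by rw [fn_mul, fn_proj, fn_sub, fn_mul, fn_smul]; ring)
    rw [e1, map_sub, map_smul, intL_jac, smul_eq_mul, mul_one, sub_self]
  change (slope (inl (mul (jac e) (proj e f)))).fn x = _
  rw [slope_inl_apply, h, sub_zero, fn_mul, fn_proj]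

theorem density_lift (e : Model s) (f : Sobolev (s - 1)) : density (lift e f) = 0 :=
  density_inl _

theorem slope_christoffel (e U V : Model s) (x : ℝ) : (slope (christoffel e U V)).fn x =
    1 / 2 * ((jac e).fn x * ((stress e U V).fn x - intL (mul (jac e) (stress e U V)))) := by
  rw [christoffel_eq, map_sub, map_smul, map_smul, slope_inr, smul_zero, sub_zero, fn_smul,
    slope_lift]

theorem density_christoffel (e U V : Model s) (x : ℝ) : (density (christoffel e U V)).fn x =
    -(1 / 2) * ((shear e U V).fn x - intL (shear e U V)) := by
  rw [christoffel_eq, map_sub, map_smul, map_smul, density_lift, smul_zero, zero_sub, fn_neg,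
    fn_smul, density_inr_apply]
  ring

theorem strain_christoffel {e : Model s} (he : e ∈ domain s) (U V : Model s) (x : ℝ) :
    (strain e (christoffel e U V)).fn x =
      1 / 2 * ((stress e U V).fn x - intL (mul (jac e) (stress e U V))) := by
  rw [fn_strain, slope_christoffel]
  linear_combination (1 / 2 * ((stress e U V).fn x - intL (mul (jac e) (stress e U V)))) *
    jac_mul_rjac he x

theorem charge_christoffel (e U V : Model s) (x : ℝ) : (charge e (christoffel e U V)).fn x =
    -(1 / 2) * ((shear e U V).fn x - intL (mul (jac e) (shear e U V))) := by
  have h : mul (jac e) (density (christoffel e U V)) =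
      (-(1 / 2) : ℝ) • (mul (jac e) (shear e U V) - intL (shear e U V) • jac e) :=
    fn_injective (funext fun x => by
      rw [fn_mul, density_christoffel, fn_smul, fn_sub, fn_smul, fn_mul]; ring)
  rw [fn_charge, density_christoffel, h, map_smul, map_sub, map_smul, intL_jac, smul_eq_mul,
    smul_eq_mul]
  ring

theorem metric_christoffel {e : Model s} (he : e ∈ domain s) (U V W : Model s) :
    metric e (christoffel e U W) V =
      1 / 8 * intL (mul (stress e U W) (slope V) - mul (shear e U W) (flow e V)) := by
  have e1 : mul (strain e (christoffel e U W)) (slope V) = (1 / 2 : ℝ) •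
      (mul (stress e U W) (slope V) - intL (mul (jac e) (stress e U W)) • slope V) :=
    fn_injective (funext fun x => by
      rw [fn_mul, strain_christoffel he, fn_smul, fn_sub, fn_smul, fn_mul]; ring)
  have e2 : mul (flow e (christoffel e U W)) (charge e V) = (-(1 / 2) : ℝ) •
      (mul (shear e U W) (flow e V) - intL (mul (jac e) (shear e U W)) • flow e V) :=
    fn_injective (funext fun x => by
      rw [fn_mul, fn_flow, charge_christoffel, fn_smul, fn_sub, fn_smul, fn_mul, fn_flow]; ring)
  rw [metric_apply, e1, e2, map_sub]
  simp only [map_smul, map_sub, intL_slope, intL_flow, smul_eq_mul]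
  ring

theorem metric_eq (U V e : Model s) : metric e U V = 1 / 4 *
    (intL (mul (rjac e) (mul (slope U) (slope V)))
      + intL (mul (jac e) (mul (density U) (density V)))
      - intL (mul (jac e) (density U)) * intL (mul (jac e) (density V))) := by
  have e1 : mul (strain e U) (slope V) = mul (rjac e) (mul (slope U) (slope V)) :=
    fn_injective (funext fun x => by simp only [fn_mul, fn_strain]; ring)
  have e2 : mul (flow e U) (charge e V) = mul (jac e) (mul (density U) (density V))
      - intL (mul (jac e) (density U)) • mul (jac e) (density V)
      - intL (mul (jac e) (density V)) • mul (jac e) (density U)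
      + (intL (mul (jac e) (density U)) * intL (mul (jac e) (density V))) • jac e :=
    fn_injective (funext fun x => by
      simp only [fn_mul, fn_flow, fn_charge, fn_add, fn_sub, fn_smul]; ring)
  rw [metric_apply, e1, e2]
  simp only [map_add, map_sub, map_smul, intL_jac, smul_eq_mul]
  ring

theorem hasFDerivAt_intL_jac (e : Model s) (f : Sobolev (s - 1)) :
    HasFDerivAt (fun e => intL (mul (jac e) f)) ((intMul.flip f).comp slope) e :=
  (intMul.flip f).hasFDerivAt.comp e (hasFDerivAt_jac e)

theorem hasFDerivAt_intL_rjac {e : Model s} (he : e ∈ domain s) (f : Sobolev (s - 1)) :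
    HasFDerivAt (fun e => intL (mul (rjac e) f))
      ((intMul.flip f).comp (-(mulL (mul (rjac e) (rjac e))).comp slope)) e :=
  (intMul.flip f).hasFDerivAt.comp e (hasFDerivAt_rjac he)

/-- The coordinate form of `∇g = 0`. -/
theorem fderiv_metric {e : Model s} (he : e ∈ domain s) (U V W : Model s) :
    fderiv ℝ (fun e => metric e U V) e W =
      -metric e (christoffel e U W) V - metric e U (christoffel e V W) := by
  have hd := (((hasFDerivAt_intL_rjac he (mul (slope U) (slope V))).add
    (hasFDerivAt_intL_jac e (mul (density U) (density V)))).sub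
    ((hasFDerivAt_intL_jac e (density U)).mul (hasFDerivAt_intL_jac e (density V)))).const_mul
      (1 / 4 : ℝ)
  have hd' := hd.congr_of_eventuallyEq (Filter.Eventually.of_forall fun e => metric_eq U V e)
  rw [hd'.fderiv, metric_symm e U, metric_christoffel he, metric_christoffel he]
  -- Both sides are integrals; the integrands agree up to multiples of `slope W`, `slope U` and
  -- `slope V`, whose integrals vanish.
  have key : mul (stress e U W) (slope V) - mul (shear e U W) (flow e V) +
      (mul (stress e V W) (slope U) - mul (shear e V W) (flow e U)) = (2 : ℝ) •
      (mul (mul (mul (rjac e) (rjac e)) (slope W)) (mul (slope U) (slope V)) -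
        mul (slope W) (mul (density U) (density V)) +
        intL (mul (jac e) (density U)) • mul (slope W) (density V) +
        intL (mul (jac e) (density V)) • mul (slope W) (density U) -
        (intL (mul (jac e) (density U)) * intL (mul (jac e) (density V))) • slope W) :=
    fn_injective (funext fun x => by
      simp only [fn_mul, fn_stress, fn_shear, fn_flow, fn_add, fn_sub, fn_smul, fn_strain,
        fn_charge]
      have h := jac_mul_rjac he x
      set m := (jac e).fn x
      set n := (rjac e).fn x
      set a := intL (mul (jac e) (density U))
      set b := intL (mul (jac e) (density V))
      set c := intL (mul (jac e) (density W))
      linear_combination (-((slope U).fn x * ((density W).fn x - c) * ((density V).fn x - b)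
        + (slope V).fn x * ((density W).fn x - c) * ((density U).fn x - a)
        + 2 * (slope W).fn x * ((density U).fn x - a) * ((density V).fn x - b))) * h)
  have key2 := congrArg (intL (r := s - 1)) key
  simp only [map_add, map_sub, map_smul, intL_slope, smul_eq_mul] at key2
  change 1 / 4 * (intL (mul (-(mul (mul (rjac e) (rjac e)) (slope W))) (mul (slope U) (slope V))) +
    intL (mul (slope W) (mul (density U) (density V))) -
    (intL (mul (jac e) (density U)) * intL (mul (slope W) (density V)) +
      intL (mul (jac e) (density V)) * intL (mul (slope W) (density U)))) = _
  have e3 : mul (-(mul (mul (rjac e) (rjac e)) (slope W))) (mul (slope U) (slope V)) =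
      -mul (mul (mul (rjac e) (rjac e)) (slope W)) (mul (slope U) (slope V)) :=
    fn_injective (funext fun x => by simp only [fn_mul, fn_neg]; ring)
  rw [e3, map_neg, map_sub, map_sub]
  linarith

theorem complexStructure_eq (U e : Model s) : complexStructure e U =
    inr (mul (rjac e) (slope U)) -
      inl (mul (jac e) (density U) - intL (mul (jac e) (density U)) • jac e) := by
  rw [complexStructure_apply]
  congr 2
  exact fn_injective (funext fun x => by
    rw [fn_flow, fn_charge, fn_sub, fn_mul, fn_smul]; ring)

/-- The coordinate form of `∇J = 0`. -/
theorem fderiv_complexStructure {e : Model s} (he : e ∈ domain s) (U W : Model s) :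
    fderiv ℝ (fun e => complexStructure e U) e W =
      christoffel e (complexStructure e U) W - complexStructure e (christoffel e U W) := by
  have d1 := inr.hasFDerivAt.comp e
    (((mulL (r := s - 1)).flip (slope U)).hasFDerivAt.comp e (hasFDerivAt_rjac he))
  have d2 := ((mulL (r := s - 1)).flip (density U)).hasFDerivAt.comp e (hasFDerivAt_jac e)
  have d3 := (hasFDerivAt_intL_jac e (density U)).smul (hasFDerivAt_jac e)
  have hd := d1.sub (inl.hasFDerivAt.comp e (d2.sub d3))
  have hd' := hd.congr_of_eventuallyEq (f₁ := fun e => complexStructure e U)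
    (Filter.Eventually.of_forall fun e => complexStructure_eq U e)
  rw [hd'.fderiv]
  change inr (mul (-(mul (mul (rjac e) (rjac e)) (slope W))) (slope U)) -
    inl (mul (slope W) (density U) - (intL (mul (jac e) (density U)) • slope W +
      intL (mul (slope W) (density U)) • jac e)) = _
  refine ext_slope_density (fun x => ?_) fun x => ?_
  · have hi : intL (mul (slope W) (density U) - (intL (mul (jac e) (density U)) • slope W +
        intL (mul (slope W) (density U)) • jac e)) = 0 := by
      simp only [map_sub, map_add, map_smul, intL_slope, intL_jac, smul_eq_mul]
      ring
    -- The means subtracted in `christoffel e (J U) W` and `J (christoffel e U W)` are compared by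
    -- integrating this pointwise identity.
    have hj : mul (jac e) (stress e (complexStructure e U) W) - mul (jac e) (shear e U W) =
        (2 * intL (mul (jac e) (density U))) • slope W - (2 : ℝ) • mul (slope W) (density U) :=
      fn_injective (funext fun x => by
        simp only [fn_mul, fn_sub, fn_smul, fn_stress, fn_shear, strain_complexStructure he,
          charge_complexStructure he, fn_strain, fn_charge e U]
        linear_combination (-2 * (slope W).fn x * ((density U).fn x -
          intL (mul (jac e) (density U)))) * jac_mul_rjac he x)
    have hj' := congrArg (intL (r := s - 1)) hj
    simp only [map_sub, map_smul, intL_slope, smul_eq_mul] at hj'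
    have hjx := congrArg (fun f : Sobolev (s - 1) => f.fn x) hj
    simp only [fn_sub, fn_smul, fn_mul] at hjx
    rw [map_sub slope, map_sub slope, fn_sub, fn_sub, slope_inr, slope_inl_apply, hi,
      slope_christoffel, slope_complexStructure, fn_flow, charge_christoffel]
    simp only [fn_sub, fn_add, fn_smul, fn_mul, fn_zero]
    linear_combination (-1 / 2) * hjx + 1 / 2 * (jac e).fn x * hj'
  · have h1 : mul (-(mul (mul (rjac e) (rjac e)) (slope W))) (slope U) =
        -mul (strain e U) (strain e W) :=
      fn_injective (funext fun x => by simp only [fn_mul, fn_neg, fn_strain]; ring)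
    have h2 : shear e (complexStructure e U) W =
        mul (strain e U) (strain e W) - mul (charge e U) (charge e W) :=
      fn_injective (funext fun x => by
        rw [fn_shear, strain_complexStructure he, charge_complexStructure he, fn_sub, fn_mul,
          fn_mul]
        ring)
    have h3 : strain e (christoffel e U W) = (1 / 2 : ℝ) • (stress e U W -
        Sobolev.const (s - 1) (intL (mul (jac e) (stress e U W)))) :=
      fn_injective (funext fun x => by
        rw [strain_christoffel he, fn_smul, fn_sub, fn_const])
    rw [map_sub density, map_sub density, fn_sub, fn_sub, density_inl, density_inr_apply,
      density_christoffel, density_complexStructure, h1, h2, h3]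
    simp only [stress, map_sub, map_smul, map_add, map_neg, intL_const, fn_sub, fn_smul, fn_add,
      fn_neg, fn_zero, fn_const, smul_eq_mul]
    ring

end Model

end HunterSaxton

namespace HunterSaxton

open Sobolev

variable {s : ℝ}

/-! ### Change of variables and the right-invariant formulas -/

/-- The operator `A⁻¹ ∂ₓ` is integration of the centred function, with the opposite sign. -/
theorem invA_deriv {F F' : ℝ → ℝ} (h : ∀ x, HasDerivAt F (F' x) x) (hc : Continuous F') (x : ℝ) :
    invA (deriv F) x = -(∫ y in (0 : ℝ)..x, F y) + x * ∫ y in (0 : ℝ)..1, F y := by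
  have hF : Continuous F := continuous_iff_continuousAt.2 fun x => (h x).continuousAt
  have e : deriv F = F' := funext fun x => (h x).deriv
  have h1 : ∀ y, ∫ z in (0 : ℝ)..y, F' z = F y - F 0 := fun y =>
    intervalIntegral.integral_eq_sub_of_hasDerivAt (fun z _ => h z) (hc.intervalIntegrable 0 y)
  have h2 : ∀ y, ∫ z in (0 : ℝ)..y, (F z - F 0) = (∫ z in (0 : ℝ)..y, F z) - y * F 0 := fun y => by
    rw [intervalIntegral.integral_sub (hF.intervalIntegrable 0 y) (by simp)]
    simp
  rw [invA, e]
  simp only [h1, h2]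
  ring

/-- The element `(U₁, [U₂])` of the model space. -/
def Model.pairOf (U₁ : SobolevZero s) (U₂ : Sobolev (s - 1)) : Model s := (U₁, SobolevMod.mk U₂)

namespace K

open Model

/-- The coordinates `(h, [k])` of `(id + h, [4πnx + k])`. -/
def coord (p : K s) : Model s := ((coordsHomeo p).1.1, (coordsHomeo p).2.2)

theorem coord_mem_domain (p : K s) : coord p ∈ domain s := p.diffeo.2

theorem map_zero' (p : K s) : p.diffeo.map 0 = 0 := by
  have : p.diffeo.1.1.fn 0 = 0 := p.diffeo.1.2
  rw [Diff.map, this, add_zero]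

theorem map_one' (p : K s) : p.diffeo.map 1 = 1 := by
  have h : p.diffeo.1.1.fn 0 = 0 := p.diffeo.1.2
  have h2 := p.diffeo.1.1.fn_periodic 0
  rw [zero_add, h] at h2
  rw [Diff.map, h2, add_zero]

variable [Fact (5 / 2 < s)] (p : K s)

theorem hasDerivAt_map (x : ℝ) : HasDerivAt p.diffeo.map ((jac (coord p)).fn x) x := by
  rw [fn_jac]
  exact (hasDerivAt_id x).add (hasDerivAt_fn p.diffeo.1.1 x)

theorem deriv_map (x : ℝ) : deriv p.diffeo.map x = (jac (coord p)).fn x :=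
  (hasDerivAt_map p x).deriv

theorem map_inv (y : ℝ) : p.diffeo.map (p.diffeo.inv y) = y :=
  (Equiv.ofBijective p.diffeo.map p.diffeo.map_bijective).apply_symm_apply y

theorem inv_map (x : ℝ) : p.diffeo.inv (p.diffeo.map x) = x :=
  (Equiv.ofBijective p.diffeo.map p.diffeo.map_bijective).symm_apply_apply x

theorem continuous_inv : Continuous p.diffeo.inv := by
  have hm : StrictMono p.diffeo.map := strictMono_of_deriv_pos fun x => by
    rw [deriv_map]
    exact jac_pos (coord_mem_domain p) x
  let o := hm.orderIsoOfSurjective _ p.diffeo.map_bijective.2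
  have e : p.diffeo.inv = o.symm := funext fun y => by
    apply hm.injective
    rw [map_inv]
    exact (o.apply_symm_apply y).symm
  rw [e]
  exact o.symm.continuous

theorem hasDerivAt_inv (y : ℝ) :
    HasDerivAt p.diffeo.inv ((rjac (coord p)).fn (p.diffeo.inv y)) y := by
  have h := jac_mul_rjac (coord_mem_domain p) (p.diffeo.inv y)
  have hpos := jac_pos (coord_mem_domain p) (p.diffeo.inv y)
  rw [← eq_inv_of_mul_eq_one_right h |>.symm]
  exact HasDerivAt.of_local_left_inverse (continuous_inv p).continuousAt
    (hasDerivAt_map p (p.diffeo.inv y)) hpos.ne' (Filter.Eventually.of_forall (map_inv p))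

theorem integral_comp_inv (f : Sobolev (s - 1)) (x : ℝ) :
    ∫ y in (0 : ℝ)..p.diffeo.map x, (f.fn ∘ p.diffeo.inv) y =
      ∫ y in (0 : ℝ)..x, (mul (jac (coord p)) f).fn y := by
  have h := intervalIntegral.integral_comp_mul_deriv (a := 0) (b := x) (f := p.diffeo.map)
    (g := f.fn ∘ p.diffeo.inv) (fun x _ => hasDerivAt_map p x)
    (jac (coord p)).fn_continuous.continuousOn (f.fn_continuous.comp (continuous_inv p))
  rw [map_zero'] at h
  rw [← h]
  refine intervalIntegral.integral_congr fun y _ => ?_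
  simp only [Function.comp_apply, inv_map, fn_mul]
  ring

theorem integral_comp_inv_one (f : Sobolev (s - 1)) :
    ∫ y in (0 : ℝ)..1, (f.fn ∘ p.diffeo.inv) y = intL (mul (jac (coord p)) f) := by
  have h := integral_comp_inv p f 1
  rw [map_one'] at h
  exact h

theorem slope_pairOf (U₁ : SobolevZero s) (U₂ : Sobolev (s - 1)) :
    slope (pairOf U₁ U₂) = derivL U₁.1 := rfl

theorem density_pairOf (U₁ : SobolevZero s) (U₂ : Sobolev (s - 1)) :
    density (pairOf U₁ U₂) = center U₂ := SobolevMod.centerL_mk U₂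

theorem charge_pairOf (U₁ : SobolevZero s) (U₂ : Sobolev (s - 1)) (x : ℝ) :
    (charge (coord p) (pairOf U₁ U₂)).fn x = U₂.fn x - intL (mul (jac (coord p)) U₂) := by
  have h : mul (jac (coord p)) (center U₂) = mul (jac (coord p)) U₂ - intL U₂ • jac (coord p) :=
    fn_injective (funext fun x => by rw [fn_mul, fn_center, fn_sub, fn_mul, fn_smul]; ring)
  rw [fn_charge, density_pairOf, h, map_sub, map_smul, intL_jac, fn_center, smul_eq_mul]
  ring

theorem deriv_comp_inv (U₁ : SobolevZero s) (U₂ : Sobolev (s - 1)) :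
    deriv (U₁.1.fn ∘ p.diffeo.inv) = (strain (coord p) (pairOf U₁ U₂)).fn ∘ p.diffeo.inv := by
  funext y
  rw [((hasDerivAt_fn U₁.1 _).comp y (hasDerivAt_inv p y)).deriv, Function.comp_apply, fn_strain,
    slope_pairOf, mul_comm]

theorem proj_comp_inv (U₁ : SobolevZero s) (U₂ : Sobolev (s - 1)) :
    HunterSaxton.proj (U₂.fn ∘ p.diffeo.inv) =
      (charge (coord p) (pairOf U₁ U₂)).fn ∘ p.diffeo.inv := by
  funext y
  rw [HunterSaxton.proj, integral_comp_inv_one, Function.comp_apply, Function.comp_apply,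
    charge_pairOf]

theorem metric_eq_intL_stress {e : Model s} (he : e ∈ domain s) (U V : Model s) :
    metric e U V = 1 / 4 * intL (mul (jac e) (stress e U V)) := by
  rw [metric_apply, ← map_add]
  congr 2
  refine fn_injective (funext fun x => ?_)
  simp only [fn_add, fn_mul, fn_strain, fn_stress, fn_flow]
  linear_combination -((rjac e).fn x * (slope U).fn x * (slope V).fn x) * jac_mul_rjac he x

theorem stress_comp_inv (U₁ V₁ : SobolevZero s) (U₂ V₂ : Sobolev (s - 1)) (y : ℝ) :
    deriv (U₁.1.fn ∘ p.diffeo.inv) y * deriv (V₁.1.fn ∘ p.diffeo.inv) y +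
      HunterSaxton.proj (U₂.fn ∘ p.diffeo.inv) y * HunterSaxton.proj (V₂.fn ∘ p.diffeo.inv) y =
    ((stress (coord p) (pairOf U₁ U₂) (pairOf V₁ V₂)).fn ∘ p.diffeo.inv) y := by
  rw [deriv_comp_inv p U₁ U₂, deriv_comp_inv p V₁ V₂, proj_comp_inv p U₁ U₂,
    proj_comp_inv p V₁ V₂]
  rfl

theorem metric_coord (U₁ V₁ : SobolevZero s) (U₂ V₂ : Sobolev (s - 1)) :
    metric (coord p) (pairOf U₁ U₂) (pairOf V₁ V₂) =
      metricId (U₁.1.fn ∘ p.diffeo.inv) (U₂.fn ∘ p.diffeo.inv)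
        (V₁.1.fn ∘ p.diffeo.inv) (V₂.fn ∘ p.diffeo.inv) := by
  rw [metric_eq_intL_stress (coord_mem_domain p), metricId, ← integral_comp_inv_one]
  simp only [stress_comp_inv]

theorem fn_eq_integral_slope (U : Model s) (x : ℝ) :
    U.1.1.fn x = ∫ y in (0 : ℝ)..x, (slope U).fn y := by
  have h : ∫ y in (0 : ℝ)..x, (slope U).fn y = U.1.1.fn x - U.1.1.fn 0 :=
    intervalIntegral.integral_eq_sub_of_hasDerivAt (fun y _ => hasDerivAt_fn U.1.1 y)
      ((slope U).intervalIntegrable_fn 0 x)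
  have h0 : U.1.1.fn 0 = 0 := U.1.2
  rw [h, h0, sub_zero]

theorem christoffelId₁_coord (U₁ V₁ : SobolevZero s) (U₂ V₂ : Sobolev (s - 1)) (x : ℝ) :
    (christoffel (coord p) (pairOf U₁ U₂) (pairOf V₁ V₂)).1.1.fn x =
      christoffelId₁ (U₁.1.fn ∘ p.diffeo.inv) (U₂.fn ∘ p.diffeo.inv)
        (V₁.1.fn ∘ p.diffeo.inv) (V₂.fn ∘ p.diffeo.inv) (p.diffeo.map x) := by
  set S := stress (coord p) (pairOf U₁ U₂) (pairOf V₁ V₂) with hS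
  have hd : ∀ y, HasDerivAt (S.fn ∘ p.diffeo.inv)
      (deriv S.fn (p.diffeo.inv y) * (rjac (coord p)).fn (p.diffeo.inv y)) y := fun y =>
    ((S.differentiable_fn _).hasDerivAt).comp y (hasDerivAt_inv p y)
  have hc : Continuous fun y =>
      deriv S.fn (p.diffeo.inv y) * (rjac (coord p)).fn (p.diffeo.inv y) :=
    (S.continuous_deriv_fn.comp (continuous_inv p)).mul
      ((rjac (coord p)).fn_continuous.comp (continuous_inv p))
  have hm : ∫ y in (0 : ℝ)..x, (jac (coord p)).fn y = p.diffeo.map x := by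
    rw [intervalIntegral.integral_eq_sub_of_hasDerivAt (fun y _ => hasDerivAt_map p y)
      ((jac (coord p)).intervalIntegrable_fn 0 x), map_zero', sub_zero]
  rw [christoffelId₁, funext (stress_comp_inv p U₁ V₁ U₂ V₂), ← hS, invA_deriv hd hc,
    integral_comp_inv, integral_comp_inv_one, fn_eq_integral_slope]
  simp only [slope_christoffel, ← hS]
  rw [intervalIntegral.integral_const_mul]
  have e : ∀ y, (jac (coord p)).fn y * (S.fn y - intL (mul (jac (coord p)) S)) =
      (mul (jac (coord p)) S).fn y - intL (mul (jac (coord p)) S) * (jac (coord p)).fn y := by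
    intro y
    rw [fn_mul]
    ring
  simp only [e]
  rw [intervalIntegral.integral_sub ((mul _ _).intervalIntegrable_fn 0 x)
    (((jac (coord p)).intervalIntegrable_fn 0 x).const_mul _),
    intervalIntegral.integral_const_mul, hm]
  ring

theorem christoffelId₂_coord (U₁ V₁ : SobolevZero s) (U₂ V₂ : Sobolev (s - 1)) (x : ℝ) :
    (-(1 / 2 : ℝ) • shear (coord p) (pairOf U₁ U₂) (pairOf V₁ V₂)).fn x =
      christoffelId₂ (U₁.1.fn ∘ p.diffeo.inv) (U₂.fn ∘ p.diffeo.inv)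
        (V₁.1.fn ∘ p.diffeo.inv) (V₂.fn ∘ p.diffeo.inv) (p.diffeo.map x) := by
  rw [christoffelId₂, deriv_comp_inv p U₁ U₂, deriv_comp_inv p V₁ V₂, proj_comp_inv p U₁ U₂,
    proj_comp_inv p V₁ V₂, fn_smul, fn_shear]
  simp only [Function.comp_apply, inv_map]
  ring

theorem christoffel_pairOf (U₁ V₁ : SobolevZero s) (U₂ V₂ : Sobolev (s - 1)) :
    christoffel (coord p) (pairOf U₁ U₂) (pairOf V₁ V₂) =
      pairOf (christoffel (coord p) (pairOf U₁ U₂) (pairOf V₁ V₂)).1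
        (-(1 / 2 : ℝ) • shear (coord p) (pairOf U₁ U₂) (pairOf V₁ V₂)) := by
  refine ext_slope_density (fun x => rfl) fun x => ?_
  rw [density_christoffel, density_pairOf, fn_center, fn_smul, map_smul, smul_eq_mul]
  ring

theorem fn_complexStructure_coord (U₁ : SobolevZero s) (U₂ : Sobolev (s - 1)) (x : ℝ) :
    (complexStructure (coord p) (pairOf U₁ U₂)).1.1.fn x = -∫ y in (0 : ℝ)..x,
      (U₂.fn y - ∫ z in (0 : ℝ)..1, U₂.fn z * deriv p.diffeo.map z) * deriv p.diffeo.map y := by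
  have h : intL (mul (jac (coord p)) U₂) = ∫ z in (0 : ℝ)..1, U₂.fn z * deriv p.diffeo.map z := by
    refine intervalIntegral.integral_congr fun z _ => ?_
    simp only [fn_mul, deriv_map, mul_comm]
  rw [fn_eq_integral_slope, ← h]
  simp only [slope_complexStructure, fn_flow, charge_pairOf, deriv_map]
  rw [intervalIntegral.integral_neg]
  simp only [mul_comm]

theorem complexStructure_pairOf (U₁ : SobolevZero s) (U₂ : Sobolev (s - 1)) :
    complexStructure (coord p) (pairOf U₁ U₂) =
      pairOf (complexStructure (coord p) (pairOf U₁ U₂)).1 (strain (coord p) (pairOf U₁ U₂)) := by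
  refine ext_slope_density (fun x => rfl) fun x => ?_
  rw [density_complexStructure, density_pairOf, fn_center]

theorem fn_strain_coord (U₁ : SobolevZero s) (U₂ : Sobolev (s - 1)) (x : ℝ) :
    (strain (coord p) (pairOf U₁ U₂)).fn x = deriv U₁.1.fn x / deriv p.diffeo.map x := by
  rw [fn_strain, slope_pairOf, fn_derivL, deriv_map, rjac,
    fn_recip _ (jac_pos (coord_mem_domain p))]
  ring

/-- The form `ω` is first order in `U₂`; integration by parts moves the derivative to `U₁`. -/
theorem symplectic_pairOf (U₁ V₁ : SobolevZero s) (U₂ V₂ : Sobolev (s - 1)) :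
    symplectic s (pairOf U₁ U₂) (pairOf V₁ V₂) =
      1 / 4 * ∫ x in (0 : ℝ)..1, (deriv U₂.fn x * V₁.1.fn x - deriv V₂.fn x * U₁.1.fn x) := by
  have key : ∀ (U₁ : SobolevZero s) (V₂ : Sobolev (s - 1)),
      intL (mul (derivL U₁.1) (center V₂)) = -∫ x in (0 : ℝ)..1, deriv V₂.fn x * U₁.1.fn x := by
    intro U₁ V₂
    have h0 : U₁.1.fn 0 = 0 := U₁.2
    have h1 : U₁.1.fn 1 = 0 := by
      have := U₁.1.fn_periodic 0
      rwa [zero_add, h0] at this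
    have e : mul (derivL U₁.1) (center V₂) = mul (derivL U₁.1) V₂ - intL V₂ • derivL U₁.1 :=
      fn_injective (funext fun x => by rw [fn_mul, fn_center, fn_sub, fn_mul, fn_smul]; ring)
    have hp := intervalIntegral.integral_mul_deriv_eq_deriv_mul (a := 0) (b := 1)
      (u := V₂.fn) (v := U₁.1.fn) (u' := deriv V₂.fn) (v' := (derivL U₁.1).fn)
      (fun x _ => (V₂.differentiable_fn x).hasDerivAt) (fun x _ => hasDerivAt_fn U₁.1 x)
      (V₂.continuous_deriv_fn.intervalIntegrable 0 1) ((derivL U₁.1).intervalIntegrable_fn 0 1)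
    rw [h0, h1, mul_zero, mul_zero, sub_zero, zero_sub] at hp
    rw [e, map_sub, map_smul, intL_derivL, smul_zero, sub_zero, ← hp, intL_apply]
    simp only [fn_mul, mul_comm]
  have hi : ∀ (U₁ : SobolevZero s) (V₂ : Sobolev (s - 1)), IntervalIntegrable
      (fun x => deriv V₂.fn x * U₁.1.fn x) MeasureTheory.volume 0 1 := fun U₁ V₂ =>
    (V₂.continuous_deriv_fn.mul U₁.1.fn_continuous).intervalIntegrable 0 1
  rw [symplectic_apply, slope_pairOf, slope_pairOf, density_pairOf, density_pairOf,
    mul_comm' (center U₂), key, key, intervalIntegral.integral_sub (hi V₁ U₂) (hi U₁ V₂)]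
  ring

end K

end HunterSaxton

namespace HunterSaxton

variable {s : ℝ} [Fact (5 / 2 < s)]

namespace K

open Model

/-! ### Vector fields and tensors as maps into fixed Banach spaces -/

/-- Points with the same winding number have the same preferred chart, so on such points the
trivializations of the tangent bundle are the identity. -/
theorem achart_eq {p q : K s} (h : q.winding = p.winding) :
    achart (Model s) q = achart (Model s) p :=
  Subtype.ext (congrArg chart h)

theorem eventually_winding (p : K s) : ∀ᶠ q in 𝓝 p, q.winding = p.winding :=
  (chart p.winding).open_source.mem_nhds (show p.winding = p.winding from rfl)

theorem continuousLinearMapAt_eq_id {p q : K s} (h : q.winding = p.winding) :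
    (trivializationAt (Model s) (TangentSpace 𝓘(ℝ, Model s)) p).continuousLinearMapAt ℝ q =
      ContinuousLinearMap.id ℝ (Model s) := by
  have hq : q ∈ (chartAt (Model s) p).source := h
  rw [TangentBundle.continuousLinearMapAt_trivializationAt_eq_core hq, achart_eq h]
  exact ContinuousLinearMap.ext fun v =>
    (tangentBundleCore 𝓘(ℝ, Model s) (K s)).coordChange_self (achart (Model s) p) q hq v

theorem symmL_eq_id {p q : K s} (h : q.winding = p.winding) :
    (trivializationAt (Model s) (TangentSpace 𝓘(ℝ, Model s)) p).symmL ℝ q =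
      ContinuousLinearMap.id ℝ (Model s) := by
  have hq : q ∈ (chartAt (Model s) p).source := h
  rw [TangentBundle.symmL_trivializationAt_eq_core hq, achart_eq h]
  exact ContinuousLinearMap.ext fun v =>
    (tangentBundleCore 𝓘(ℝ, Model s) (K s)).coordChange_self (achart (Model s) p) q hq v

theorem trivializationAt_snd {p q : K s} (h : q.winding = p.winding) (v : Model s) :
    (trivializationAt (Model s) (TangentSpace 𝓘(ℝ, Model s)) p
      (⟨q, v⟩ : TangentBundle 𝓘(ℝ, Model s) (K s))).2 = v := by
  have hq : q ∈ (trivializationAt (Model s) (TangentSpace 𝓘(ℝ, Model s)) p).baseSet := h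
  have := congrArg (fun L : Model s →L[ℝ] Model s => L v) (continuousLinearMapAt_eq_id h)
  exact (congrFun (Trivialization.coe_linearMapAt_of_mem _ hq) v).symm.trans this

theorem contMDiffAt_field_iff {n : ℕ∞ω} {X : K s → Model s} {p : K s} :
    ContMDiffAt 𝓘(ℝ, Model s) 𝓘(ℝ, Model s).tangent n
      (fun p => (⟨p, X p⟩ : TangentBundle 𝓘(ℝ, Model s) (K s))) p ↔
    ContMDiffAt 𝓘(ℝ, Model s) 𝓘(ℝ, Model s) n X p := by
  refine (contMDiffAt_section p).trans (Filter.EventuallyEq.contMDiffAt_iff ?_)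
  filter_upwards [eventually_winding p] with q hq
  exact trivializationAt_snd hq _

theorem mdifferentiableAt_field_iff {X : K s → Model s} {p : K s} :
    MDifferentiableAt 𝓘(ℝ, Model s) 𝓘(ℝ, Model s).tangent
      (fun p => (⟨p, X p⟩ : TangentBundle 𝓘(ℝ, Model s) (K s))) p ↔
    MDifferentiableAt 𝓘(ℝ, Model s) 𝓘(ℝ, Model s) X p := by
  refine (mdifferentiableAt_section _ _).trans (Filter.EventuallyEq.mdifferentiableAt_iff ?_)
  filter_upwards [eventually_winding p] with q hq
  exact trivializationAt_snd hq _

/-- A smooth map into the endomorphisms of the model space is a smooth section of the bundle of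
endomorphisms. -/
theorem contMDiff_endo {n : ℕ∞ω} {J : K s → Model s →L[ℝ] Model s}
    (h : ContMDiff 𝓘(ℝ, Model s) 𝓘(ℝ, Model s →L[ℝ] Model s) n J) :
    ContMDiff 𝓘(ℝ, Model s) (𝓘(ℝ, Model s).prod 𝓘(ℝ, Model s →L[ℝ] Model s)) n
      (fun p => TotalSpace.mk' (Model s →L[ℝ] Model s)
        (E := fun p : K s => T p →L[ℝ] T p) p (J p)) := by
  intro p
  refine (contMDiffAt_hom_bundle _).2 ⟨contMDiffAt_id, (h p).congr_of_eventuallyEq ?_⟩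
  filter_upwards [eventually_winding p] with q hq
  exact congrArg₂ (fun A B : Model s →L[ℝ] Model s => A.comp ((J q).comp B))
    (continuousLinearMapAt_eq_id hq) (symmL_eq_id hq)

theorem contMDiff_form {n : ℕ∞ω} {b : K s → Model s →L[ℝ] Model s →L[ℝ] ℝ}
    (h : ContMDiff 𝓘(ℝ, Model s) 𝓘(ℝ, Model s →L[ℝ] Model s →L[ℝ] ℝ) n b) :
    ContMDiff 𝓘(ℝ, Model s) (𝓘(ℝ, Model s).prod 𝓘(ℝ, Model s →L[ℝ] Model s →L[ℝ] ℝ)) n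
      (fun p => TotalSpace.mk' (Model s →L[ℝ] Model s →L[ℝ] ℝ)
        (E := fun p : K s => T p →L[ℝ] T p →L[ℝ] ℝ) p (b p)) := by
  intro p
  refine (contMDiffAt_hom_bundle _).2 ⟨contMDiffAt_id, (h p).congr_of_eventuallyEq ?_⟩
  filter_upwards [eventually_winding p] with q hq
  refine ContinuousLinearMap.ext fun v => ContinuousLinearMap.ext fun w => ?_
  have e := inCoordinates_apply_eq₂ (𝕜 := ℝ) (F₁ := Model s) (F₂ := Model s) (F₃ := ℝ)
    (E₁ := fun p : K s => T p) (E₂ := fun p : K s => T p) (E₃ := Bundle.Trivial (K s) ℝ)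
    (x₀ := p) (x := q) (ϕ := b q) (v := v) (w := w) hq hq trivial
  refine e.trans ?_
  have h1 : ∀ v : Model s, (trivializationAt (Model s) (fun p : K s => T p) p).symm q v = v :=
    fun v => (Trivialization.symmL_apply (R := ℝ)
      (trivializationAt (Model s) (fun p : K s => T p) p) hq v).symm.trans
      (congrArg (fun L : Model s →L[ℝ] Model s => L v) (symmL_eq_id hq))
  rw [h1, h1]
  exact congrFun (Trivialization.coe_linearMapAt_of_mem (R := ℝ)
    (trivializationAt ℝ (Bundle.Trivial (K s) ℝ) p) (b := q) trivial) (b q v w)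

end K

end HunterSaxton

namespace HunterSaxton

variable {s : ℝ} [Fact (5 / 2 < s)]

namespace K

open Model

/-! ### Calculus in the charts -/

variable {F : Type*} [NormedAddCommGroup F] [NormedSpace ℝ F]

theorem coord_chart_symm {n : ℤ} {e : Model s} (he : e ∈ domain s) :
    coord ((chart n).symm e) = e :=
  (chart n).right_inv he

theorem winding_chart_symm {n : ℤ} {e : Model s} (he : e ∈ domain s) :
    ((chart n).symm e).winding = n :=
  (chart n).map_target he

theorem chart_symm_coord {p q : K s} (h : q.winding = p.winding) :
    (chart p.winding).symm (coord q) = q :=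
  (chart p.winding).left_inv h

theorem domain_mem_nhds (p : K s) : domain s ∈ 𝓝 (coord p) :=
  (isOpen_domain).mem_nhds (coord_mem_domain p)

theorem contMDiff_coord {n : ℕ∞ω} : ContMDiff 𝓘(ℝ, Model s) 𝓘(ℝ, Model s) n (coord (s := s)) :=
  fun p => contMDiffAt_extChartAt (x := p)

theorem contMDiff_comp_coord {n : ℕ∞ω} {G : Model s → F} (hG : ContDiffOn ℝ n G (domain s)) :
    ContMDiff 𝓘(ℝ, Model s) 𝓘(ℝ, F) n (fun p => G (coord p)) := fun p =>
  (hG.contDiffAt (domain_mem_nhds p)).contMDiffAt.comp p (contMDiff_coord p)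

theorem contDiffOn_comp_chart_symm {n : ℕ∞ω} {f : K s → F}
    (hf : ContMDiff 𝓘(ℝ, Model s) 𝓘(ℝ, F) n f) (p : K s) :
    ContDiffOn ℝ n (f ∘ (chart p.winding).symm) (domain s) := by
  have h : ContMDiffOn 𝓘(ℝ, Model s) 𝓘(ℝ, Model s) n (extChartAt 𝓘(ℝ, Model s) p).symm
      (extChartAt 𝓘(ℝ, Model s) p).target := contMDiffOn_extChartAt_symm p
  rw [← contMDiffOn_iff_contDiffOn]
  refine hf.comp_contMDiffOn (h.mono fun e he => ?_)
  rw [extChartAt_target]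
  exact ⟨he, Set.mem_range_self _⟩

theorem hasMFDerivAt_iff {f : K s → F} {p : K s} {L : Model s →L[ℝ] F} :
    HasMFDerivAt 𝓘(ℝ, Model s) 𝓘(ℝ, F) f p L ↔
      HasFDerivAt (f ∘ (chart p.winding).symm) L (coord p) := by
  have key : HasFDerivWithinAt (writtenInExtChartAt 𝓘(ℝ, Model s) 𝓘(ℝ, F) p f) L
      (Set.range 𝓘(ℝ, Model s)) (extChartAt 𝓘(ℝ, Model s) p p) ↔
      HasFDerivAt (f ∘ (chart p.winding).symm) L (coord p) := by
    rw [modelWithCornersSelf_coe, Set.range_id, hasFDerivWithinAt_univ]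
    rfl
  refine ⟨fun h => key.1 h.2, fun h => ⟨?_, key.2 h⟩⟩
  have h1 : ContinuousAt ((f ∘ (chart p.winding).symm) ∘ coord) p :=
    h.continuousAt.comp (contMDiff_coord (n := 0) p).continuousAt
  refine h1.congr ?_
  filter_upwards [eventually_winding p] with q hq
  simp only [Function.comp_apply, chart_symm_coord hq]

/-- The derivative of a map from `K^s` into a normed space, in the chart at the point. -/
def totalDeriv (f : K s → F) (p : K s) : Model s →L[ℝ] F := mfderiv 𝓘(ℝ, Model s) 𝓘(ℝ, F) f p

theorem totalDeriv_eq {f : K s → F} {p : K s} {L : Model s →L[ℝ] F}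
    (h : HasFDerivAt (f ∘ (chart p.winding).symm) L (coord p)) : totalDeriv f p = L :=
  (hasMFDerivAt_iff.2 h).mfderiv

theorem hasFDerivAt_totalDeriv {f : K s → F} {p : K s}
    (hf : MDifferentiableAt 𝓘(ℝ, Model s) 𝓘(ℝ, F) f p) :
    HasFDerivAt (f ∘ (chart p.winding).symm) (totalDeriv f p) (coord p) :=
  hasMFDerivAt_iff.1 hf.hasMFDerivAt

theorem totalDeriv_eq_fderiv (f : K s → F) (p : K s) :
    totalDeriv f p = fderiv ℝ (f ∘ (chart p.winding).symm) (coord p) := by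
  by_cases h : DifferentiableAt ℝ (f ∘ (chart p.winding).symm) (coord p)
  · exact totalDeriv_eq h.hasFDerivAt
  · rw [fderiv_zero_of_not_differentiableAt h]
    exact mfderiv_zero_of_not_mdifferentiableAt fun hf =>
      h (hasFDerivAt_totalDeriv hf).differentiableAt

theorem contMDiff_totalDeriv {f : K s → F} (hf : ContMDiff 𝓘(ℝ, Model s) 𝓘(ℝ, F) ∞ f) :
    ContMDiff 𝓘(ℝ, Model s) 𝓘(ℝ, Model s →L[ℝ] F) ∞ (totalDeriv f) := by
  intro p
  have h := (contDiffOn_comp_chart_symm hf p).fderiv_of_isOpen (isOpen_domain) (m := ∞) le_rfl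
  refine (contMDiff_comp_coord h p).congr_of_eventuallyEq ?_
  filter_upwards [eventually_winding p] with q hq
  rw [totalDeriv_eq_fderiv, hq]

theorem totalDeriv_bilinear {G : Model s → Model s →L[ℝ] Model s →L[ℝ] F}
    (hG : ContDiffOn ℝ ∞ G (domain s)) {Y Z : K s → Model s} {p : K s}
    (hY : MDifferentiableAt 𝓘(ℝ, Model s) 𝓘(ℝ, Model s) Y p)
    (hZ : MDifferentiableAt 𝓘(ℝ, Model s) 𝓘(ℝ, Model s) Z p) (v : Model s) :
    totalDeriv (fun q => G (coord q) (Y q) (Z q)) p v =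
      fderiv ℝ (fun e => G e (Y p) (Z p)) (coord p) v +
        G (coord p) (totalDeriv Y p v) (Z p) + G (coord p) (Y p) (totalDeriv Z p v) := by
  have dG : HasFDerivAt G (fderiv ℝ G (coord p)) (coord p) :=
    ((hG.contDiffAt (domain_mem_nhds p)).differentiableAt (by simp)).hasFDerivAt
  have e0 : (chart p.winding).symm (coord p) = p := chart_symm_coord rfl
  have h1 := (dG.clm_apply (hasFDerivAt_totalDeriv hY)).clm_apply (hasFDerivAt_totalDeriv hZ)
  have h2 := (dG.clm_apply (hasFDerivAt_const (Y p) (coord p))).clm_apply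
    (hasFDerivAt_const (Z p) (coord p))
  rw [h2.fderiv, totalDeriv_eq (h1.congr_of_eventuallyEq ?_)]
  · simp [e0]
    abel
  · filter_upwards [domain_mem_nhds p] with e he
    simp only [Function.comp_apply, coord_chart_symm he]

theorem totalDeriv_endo {G : Model s → Model s →L[ℝ] F}
    (hG : ContDiffOn ℝ ∞ G (domain s)) {Y : K s → Model s} {p : K s}
    (hY : MDifferentiableAt 𝓘(ℝ, Model s) 𝓘(ℝ, Model s) Y p) (v : Model s) :
    totalDeriv (fun q => G (coord q) (Y q)) p v =
      fderiv ℝ (fun e => G e (Y p)) (coord p) v + G (coord p) (totalDeriv Y p v) := by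
  have dG : HasFDerivAt G (fderiv ℝ G (coord p)) (coord p) :=
    ((hG.contDiffAt (domain_mem_nhds p)).differentiableAt (by simp)).hasFDerivAt
  have e0 : (chart p.winding).symm (coord p) = p := chart_symm_coord rfl
  have h1 := dG.clm_apply (hasFDerivAt_totalDeriv hY)
  have h2 := dG.clm_apply (hasFDerivAt_const (Y p) (coord p))
  rw [h2.fderiv, totalDeriv_eq (h1.congr_of_eventuallyEq ?_)]
  · simp [e0]
    abel
  · filter_upwards [domain_mem_nhds p] with e he
    simp only [Function.comp_apply, coord_chart_symm he]

theorem mfderiv_extChartAt_eq_id (p : K s) :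
    mfderiv 𝓘(ℝ, Model s) 𝓘(ℝ, Model s) (extChartAt 𝓘(ℝ, Model s) p) p =
      ContinuousLinearMap.id ℝ (Model s) :=
  (TangentBundle.continuousLinearMapAt_trivializationAt (mem_chart_source _ p)).symm.trans
    (continuousLinearMapAt_eq_id rfl)

/-- The pullback of a vector field to the chart at `p`. -/
def chartField (p : K s) (X : ∀ q : K s, T q) : Model s → Model s :=
  VectorField.mpullbackWithin 𝓘(ℝ, Model s) 𝓘(ℝ, Model s) (extChartAt 𝓘(ℝ, Model s) p).symm
    X (Set.range 𝓘(ℝ, Model s))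

theorem mfderivWithin_extChartAt_symm_eq_id {p q : K s} (hq : q.winding = p.winding) :
    mfderivWithin 𝓘(ℝ, Model s) 𝓘(ℝ, Model s) (extChartAt 𝓘(ℝ, Model s) p).symm
      (Set.range 𝓘(ℝ, Model s)) (extChartAt 𝓘(ℝ, Model s) p q) =
      ContinuousLinearMap.id ℝ (Model s) := by
  have hq' : q ∈ (chartAt (Model s) p).source := hq
  rw [← TangentBundle.symmL_trivializationAt hq']
  exact symmL_eq_id hq

theorem chartField_apply (X : K s → Model s) (p : K s) {e : Model s} (he : e ∈ domain s) :
    chartField p X e = X ((chart p.winding).symm e) := by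
  have h := mfderivWithin_extChartAt_symm_eq_id (winding_chart_symm (n := p.winding) he)
  rw [show extChartAt 𝓘(ℝ, Model s) p ((chart p.winding).symm e) = e from coord_chart_symm he] at h
  have h2 : ∀ L : Model s →L[ℝ] Model s, L = ContinuousLinearMap.id ℝ (Model s) →
      L.inverse (X ((chart p.winding).symm e)) = X ((chart p.winding).symm e) := by
    rintro L rfl
    rw [ContinuousLinearMap.inverse_id, ContinuousLinearMap.id_apply]
  unfold chartField VectorField.mpullbackWithin
  exact h2 _ h

/-- In the chart at `p`, the Lie bracket is `DY · X - DX · Y`. -/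
theorem bracket_eq (X Y : K s → Model s) (p : K s) :
    bracket X Y p = totalDeriv Y p (X p) - totalDeriv X p (Y p) := by
  have e0 : (chart p.winding).symm (coord p) = p := chart_symm_coord rfl
  have hX : ∀ X : K s → Model s, chartField p X =ᶠ[𝓝 (coord p)] X ∘ (chart p.winding).symm :=
    fun X => by
      filter_upwards [domain_mem_nhds p] with e he
      exact chartField_apply X p he
  have h1 : VectorField.lieBracketWithin ℝ (chartField p X) (chartField p Y)
      ((extChartAt 𝓘(ℝ, Model s) p).symm ⁻¹' Set.univ ∩ Set.range 𝓘(ℝ, Model s)) (coord p) =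
      totalDeriv Y p (X p) - totalDeriv X p (Y p) := by
    rw [modelWithCornersSelf_coe, Set.range_id, Set.preimage_univ, Set.univ_inter,
      VectorField.lieBracketWithin_univ, (hX X).lieBracket_vectorField_eq (hX Y),
      VectorField.lieBracket, totalDeriv_eq_fderiv, totalDeriv_eq_fderiv]
    simp only [Function.comp_apply, e0]
  refine (congrArg₂ (fun (L : Model s →L[ℝ] Model s) (v : Model s) => L.inverse v)
    (mfderiv_extChartAt_eq_id p) h1).trans ?_
  rw [ContinuousLinearMap.inverse_id]
  rfl

end K

end HunterSaxton

namespace HunterSaxton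

variable {s : ℝ} [Fact (5 / 2 < s)]

namespace K

open Model

/-! ### The Kähler structure on `K^s` -/

theorem isSmoothField_iff {X : K s → Model s} :
    IsSmoothField X ↔ ContMDiff 𝓘(ℝ, Model s) 𝓘(ℝ, Model s) ∞ X :=
  forall_congr' fun _ => contMDiffAt_field_iff

/-- `∇Y` at `p`, for the connection `∇_X Y = DY · X - Γ(Y, X)`. -/
def nabla (Y : K s → Model s) (p : K s) : Model s →L[ℝ] Model s :=
  totalDeriv Y p - christoffel (coord p) (Y p)

theorem nabla_apply (Y : K s → Model s) (p : K s) (v : Model s) :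
    nabla Y p v = totalDeriv Y p v - christoffel (coord p) (Y p) v := rfl

theorem nabla_add {Y Z : K s → Model s} {p : K s}
    (hY : MDifferentiableAt 𝓘(ℝ, Model s) 𝓘(ℝ, Model s) Y p)
    (hZ : MDifferentiableAt 𝓘(ℝ, Model s) 𝓘(ℝ, Model s) Z p) :
    nabla (Y + Z) p = nabla Y p + nabla Z p := by
  have h : totalDeriv (Y + Z) p = totalDeriv Y p + totalDeriv Z p :=
    totalDeriv_eq ((hasFDerivAt_totalDeriv hY).add (hasFDerivAt_totalDeriv hZ))
  rw [nabla, h, Pi.add_apply, map_add, nabla, nabla]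
  abel

theorem nabla_smul {Y : K s → Model s} {f : K s → ℝ} {p : K s}
    (hY : MDifferentiableAt 𝓘(ℝ, Model s) 𝓘(ℝ, Model s) Y p)
    (hf : MDifferentiableAt 𝓘(ℝ, Model s) 𝓘(ℝ, ℝ) f p) :
    nabla (f • Y) p = f p • nabla Y p + (totalDeriv f p).smulRight (Y p) := by
  have e0 : (chart p.winding).symm (coord p) = p := chart_symm_coord rfl
  have h : totalDeriv (f • Y) p = f p • totalDeriv Y p + (totalDeriv f p).smulRight (Y p) := by
    have := (hasFDerivAt_totalDeriv hf).smul (hasFDerivAt_totalDeriv hY)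
    simp only [Function.comp_apply, e0] at this
    exact totalDeriv_eq this
  rw [nabla, h, Pi.smul_apply', map_smul, nabla, smul_sub]
  abel

/-- The Levi-Civita connection. -/
def connection : Connection s where
  toFun := nabla
  isCovariantDerivativeOnUniv :=
    { add := fun hσ hσ' _ =>
        nabla_add (mdifferentiableAt_field_iff.1 hσ) (mdifferentiableAt_field_iff.1 hσ')
      leibniz := fun hσ hg _ => nabla_smul (mdifferentiableAt_field_iff.1 hσ) hg }

theorem contMDiff_nabla {Y : K s → Model s} (hY : ContMDiff 𝓘(ℝ, Model s) 𝓘(ℝ, Model s) ∞ Y) :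
    ContMDiff 𝓘(ℝ, Model s) 𝓘(ℝ, Model s →L[ℝ] Model s) ∞ (nabla Y) :=
  (contDiff_fst.sub contDiff_snd).contMDiff.comp ((contMDiff_totalDeriv hY).prodMk_space
    ((contMDiff_comp_coord contDiffOn_christoffel).clm_apply hY))

theorem contMDiffCovariantDerivative_connection :
    CovariantDerivative.ContMDiffCovariantDerivative (connection (s := s)) ∞ where
  contMDiff :=
    { contMDiff := fun {σ} hσ => by
        rw [contMDiffOn_univ] at hσ ⊢
        exact contMDiff_endo (contMDiff_nabla (isSmoothField_iff.1 hσ)) }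

section Identities

variable {X Y Z : K s → Model s} (p : K s)

/-- The connection is torsion-free. -/
theorem bracket_eq_nabla : bracket X Y p = nabla Y p (X p) - nabla X p (Y p) := by
  rw [bracket_eq, nabla_apply, nabla_apply, christoffel_symm (coord p) (Y p)]
  abel

/-- `∇g = 0`. -/
theorem totalDeriv_metric (hY : MDifferentiableAt 𝓘(ℝ, Model s) 𝓘(ℝ, Model s) Y p)
    (hZ : MDifferentiableAt 𝓘(ℝ, Model s) 𝓘(ℝ, Model s) Z p) (v : Model s) :
    totalDeriv (fun q => metric (coord q) (Y q) (Z q)) p v =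
      metric (coord p) (nabla Y p v) (Z p) + metric (coord p) (Y p) (nabla Z p v) := by
  rw [totalDeriv_bilinear contDiffOn_metric hY hZ, fderiv_metric (coord_mem_domain p), nabla_apply,
    nabla_apply, map_sub, map_sub, sub_apply]
  ring

/-- `∇J = 0`. -/
theorem nabla_complexStructure (hY : MDifferentiableAt 𝓘(ℝ, Model s) 𝓘(ℝ, Model s) Y p)
    (v : Model s) :
    nabla (fun q => complexStructure (coord q) (Y q)) p v =
      complexStructure (coord p) (nabla Y p v) := by
  rw [nabla_apply, totalDeriv_endo contDiffOn_complexStructure hY,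
    fderiv_complexStructure (coord_mem_domain p), nabla_apply, map_sub]
  abel

theorem contMDiff_complexStructure (hY : ContMDiff 𝓘(ℝ, Model s) 𝓘(ℝ, Model s) ∞ Y) :
    ContMDiff 𝓘(ℝ, Model s) 𝓘(ℝ, Model s) ∞ fun q => complexStructure (coord q) (Y q) :=
  (contMDiff_comp_coord contDiffOn_complexStructure).clm_apply hY

/-- `∇ω = 0` follows from `∇g = 0` and `∇J = 0`, as `ω = g(J·, ·)`. -/
theorem totalDeriv_symplectic (hY : ContMDiff 𝓘(ℝ, Model s) 𝓘(ℝ, Model s) ∞ Y)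
    (hZ : ContMDiff 𝓘(ℝ, Model s) 𝓘(ℝ, Model s) ∞ Z) (v : Model s) :
    totalDeriv (fun q => symplectic s (Y q) (Z q)) p v =
      symplectic s (nabla Y p v) (Z p) + symplectic s (Y p) (nabla Z p v) := by
  have e : (fun q => symplectic s (Y q) (Z q)) =
      fun q => metric (coord q) (complexStructure (coord q) (Y q)) (Z q) :=
    funext fun q => symplectic_eq_metric (coord_mem_domain q) _ _
  rw [e, totalDeriv_metric p ((contMDiff_complexStructure hY).mdifferentiable (by simp) p)
    (hZ.mdifferentiable (by simp) p), nabla_complexStructure p (hY.mdifferentiable (by simp) p),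
    symplectic_eq_metric (coord_mem_domain p), symplectic_eq_metric (coord_mem_domain p)]

/-- A parallel two-form of a torsion-free connection is closed. -/
theorem extDerivTwo_symplectic (hX : ContMDiff 𝓘(ℝ, Model s) 𝓘(ℝ, Model s) ∞ X)
    (hY : ContMDiff 𝓘(ℝ, Model s) 𝓘(ℝ, Model s) ∞ Y)
    (hZ : ContMDiff 𝓘(ℝ, Model s) 𝓘(ℝ, Model s) ∞ Z) :
    extDerivTwo (fun _ => symplectic s) X Y Z p = 0 := by
  have e : extDerivTwo (fun _ => symplectic s) X Y Z p =
      totalDeriv (fun q => symplectic s (Y q) (Z q)) p (X p)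
        - totalDeriv (fun q => symplectic s (X q) (Z q)) p (Y p)
        + totalDeriv (fun q => symplectic s (X q) (Y q)) p (Z p)
        - symplectic s (nabla Y p (X p) - nabla X p (Y p)) (Z p)
        + symplectic s (nabla Z p (X p) - nabla X p (Z p)) (Y p)
        - symplectic s (nabla Z p (Y p) - nabla Y p (Z p)) (X p) := by
    rw [← bracket_eq_nabla, ← bracket_eq_nabla, ← bracket_eq_nabla]
    rfl
  rw [e, totalDeriv_symplectic p hY hZ, totalDeriv_symplectic p hX hZ,
    totalDeriv_symplectic p hX hY]
  simp only [map_sub, sub_apply]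
  linarith [symplectic_antisymm (Y p) (nabla Z p (X p)),
    symplectic_antisymm (X p) (nabla Z p (Y p)), symplectic_antisymm (X p) (nabla Y p (Z p))]

/-- A parallel complex structure of a torsion-free connection is integrable. -/
theorem nijenhuis_complexStructure (hX : ContMDiff 𝓘(ℝ, Model s) 𝓘(ℝ, Model s) ∞ X)
    (hY : ContMDiff 𝓘(ℝ, Model s) 𝓘(ℝ, Model s) ∞ Y) :
    nijenhuis (fun q => complexStructure (coord q)) X Y p = 0 := by
  set J : K s → Model s →L[ℝ] Model s := fun q => complexStructure (coord q) with hJ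
  have nJ : ∀ {Y : K s → Model s}, ContMDiff 𝓘(ℝ, Model s) 𝓘(ℝ, Model s) ∞ Y → ∀ v,
      nabla (fun q => J q (Y q)) p v = J p (nabla Y p v) := fun hY v =>
    nabla_complexStructure p (hY.mdifferentiable (by simp) p) v
  have JJ : ∀ v, J p (J p v) = -v := complexStructure_complexStructure (coord_mem_domain p)
  have e : nijenhuis J X Y p = (nabla Y p (X p) - nabla X p (Y p))
      + J p (nabla Y p (J p (X p)) - nabla (fun q => J q (X q)) p (Y p))
      + J p (nabla (fun q => J q (Y q)) p (X p) - nabla X p (J p (Y p)))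
      - (nabla (fun q => J q (Y q)) p (J p (X p)) -
          nabla (fun q => J q (X q)) p (J p (Y p))) := by
    have h : ∀ X Y : K s → Model s, nabla Y p (X p) - nabla X p (Y p) = bracket X Y p :=
      fun X Y => (bracket_eq_nabla p).symm
    rw [h, h (fun q => J q (X q)) Y, h X fun q => J q (Y q),
      h (fun q => J q (X q)) fun q => J q (Y q)]
    rfl
  rw [e, nJ hX, nJ hY, nJ hX, nJ hY, map_sub, map_sub, JJ, JJ]
  abel

theorem metric_complexStructure (U V : Model s) :
    metric (coord p) U V =
      metric (coord p) (complexStructure (coord p) U) (complexStructure (coord p) V) := by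
  have he := coord_mem_domain p
  rw [← symplectic_eq_metric he, symplectic_antisymm, symplectic_eq_metric he,
    complexStructure_complexStructure he, metric_symm _ (-V), map_neg, neg_neg]

theorem eq_zero_of_symplectic (p : K s) {U : Model s} (h : ∀ V, symplectic s U V = 0) : U = 0 := by
  have he := coord_mem_domain p
  by_contra hU
  have := metric_pos he hU
  rw [metric_complexStructure, ← symplectic_eq_metric he, h] at this
  exact lt_irrefl _ this

/-- If `r = p q`, then `ψ ∘ r⁻¹ = p⁻¹` for the diffeomorphisms, `ψ` being that of `q`. -/
theorem isRightInvariant_of_isTheMetric {g : ∀ p : K s, T p →L[ℝ] T p →L[ℝ] ℝ}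
    (hg : IsTheMetric g) : IsRightInvariant g := by
  intro p q r hpr U₁ V₁ U₁' V₁' U₂ V₂ U₂' V₂' hU₁ hU₂ hV₁ hV₂
  have hinv : q.diffeo.map ∘ r.diffeo.inv = p.diffeo.inv := funext fun y => by
    have h1 := hpr.1 (r.diffeo.inv y)
    rw [map_inv] at h1
    rw [Function.comp_apply]
    nth_rw 2 [h1]
    rw [inv_map]
  rw [hg, hg, hU₁, hU₂, hV₁, hV₂]
  simp only [Function.comp_assoc, hinv]

end Identities

end K

end HunterSaxton

end

theorem theorem5p1 (s : ℝ) [Fact (5 / 2 < s)] :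
    -- `K^s` is a Banach manifold, and the following objects are well defined on it
    CompleteSpace (Model s) ∧ IsManifold 𝓘(ℝ, Model s) ∞ (K s) ∧
    ∃ (g : ∀ p : K s, T p →L[ℝ] T p →L[ℝ] ℝ)
      (Γ : K s → Model s →L[ℝ] Model s →L[ℝ] Model s)
      (D : Connection s)
      (w : ∀ p : K s, T p →L[ℝ] T p →L[ℝ] ℝ)
      (J : ∀ p : K s, T p →L[ℝ] T p),
      (IsTheMetric g ∧ IsRightInvariant g ∧ IsTheChristoffelMap Γ ∧ IsTheConnection Γ D ∧
        IsTheTwoForm w ∧ IsTheComplexStructure J) ∧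
      -- (a) `g` is a smooth (weak) metric, `∇` is a smooth connection compatible with `g`
      (IsSmoothForm g ∧ (∀ p U V, g p U V = g p V U) ∧ (∀ p U, U ≠ 0 → 0 < g p U U) ∧
        ContMDiff 𝓘(ℝ, Model s) 𝓘(ℝ, Model s →L[ℝ] Model s →L[ℝ] Model s) ∞ Γ ∧
        (∀ p U V, Γ p U V = Γ p V U) ∧
        CovariantDerivative.ContMDiffCovariantDerivative D ∞ ∧
        (∀ X Y : ∀ p : K s, T p, IsSmoothField X → IsSmoothField Y → ∀ p,
          D Y p (X p) - D X p (Y p) = bracket X Y p) ∧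
        IsParallelForm D g) ∧
      -- (b) `ω` is a symplectic form compatible with `∇`
      (IsSmoothForm w ∧ (∀ p U V, w p U V = -w p V U) ∧
        (∀ p U, (∀ V, w p U V = 0) → U = 0) ∧
        (∀ X Y Z : ∀ p : K s, T p, IsSmoothField X → IsSmoothField Y → IsSmoothField Z →
          ∀ p, extDerivTwo w X Y Z p = 0) ∧
        IsParallelForm D w) ∧
      -- (c) `J` is an almost complex structure compatible with `∇`
      (IsSmoothEndo J ∧ (∀ p U, J p (J p U) = -U) ∧ IsParallelEndo D J) ∧
      -- (d)
      (∀ p U V, w p U V = g p (J p U) V) ∧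
      -- (e)
      (∀ p U V, g p U V = g p (J p U) (J p V)) ∧
      -- (f)
      (∀ X Y : ∀ p : K s, T p, IsSmoothField X → IsSmoothField Y → ∀ p, nijenhuis J X Y p = 0) := by
  refine ⟨inferInstance, inferInstance, fun p => Model.metric (coord p),
    fun p => Model.christoffel (coord p), connection, fun _ => Model.symplectic s,
    fun p => Model.complexStructure (coord p), ⟨?_, ?_, ?_, ?_, ?_, ?_⟩,
    ⟨?_, fun p => Model.metric_symm _, fun p _ => Model.metric_pos (coord_mem_domain p), ?_,
      fun p => Model.christoffel_symm _, contMDiffCovariantDerivative_connection, ?_, ?_⟩,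
    ⟨?_, fun p => Model.symplectic_antisymm, fun p _ => eq_zero_of_symplectic p, ?_, ?_⟩,
    ⟨?_, fun p => Model.complexStructure_complexStructure (coord_mem_domain p), ?_⟩,
    fun p => Model.symplectic_eq_metric (coord_mem_domain p), fun p => metric_complexStructure p,
    ?_⟩
  · exact metric_coord
  · exact isRightInvariant_of_isTheMetric metric_coord
  · exact fun p U₁ V₁ U₂ V₂ => ⟨_, _, christoffelId₁_coord p U₁ V₁ U₂ V₂,
      christoffelId₂_coord p U₁ V₁ U₂ V₂, christoffel_pairOf p U₁ V₁ U₂ V₂⟩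
  · exact fun Y _ p v => rfl
  · exact fun p => symplectic_pairOf
  · exact fun p U₁ U₂ => ⟨_, _, fn_complexStructure_coord p U₁ U₂, fn_strain_coord p U₁ U₂,
      complexStructure_pairOf p U₁ U₂⟩
  · exact contMDiff_form (contMDiff_comp_coord Model.contDiffOn_metric)
  · exact contMDiff_comp_coord Model.contDiffOn_christoffel
  · exact fun X Y _ _ p => (bracket_eq_nabla p).symm
  · intro X Y Z _ hY hZ p
    exact totalDeriv_metric p ((isSmoothField_iff.1 hY).mdifferentiable (by simp) p)
      ((isSmoothField_iff.1 hZ).mdifferentiable (by simp) p) _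
  · exact contMDiff_form contMDiff_const
  · exact fun X Y Z hX hY hZ p => extDerivTwo_symplectic p (isSmoothField_iff.1 hX)
      (isSmoothField_iff.1 hY) (isSmoothField_iff.1 hZ)
  · exact fun X Y Z _ hY hZ p => totalDeriv_symplectic p (isSmoothField_iff.1 hY)
      (isSmoothField_iff.1 hZ) _
  · exact contMDiff_endo (contMDiff_comp_coord Model.contDiffOn_complexStructure)
  · exact fun X Y _ hY p => nabla_complexStructure p
      ((isSmoothField_iff.1 hY).mdifferentiable (by simp) p) _
  · exact fun X Y hX hY p => nijenhuis_complexStructure p (isSmoothField_iff.1 hX)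
      (isSmoothField_iff.1 hY)
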